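/- Let $\phi:\mathbb R\to\mathbb R$ be measurable with $\int_{\mathbb R}\phi^2(sz)\,Dz<\infty$ for every $s\in\mathbb R$, where $Dz=\frac1{\sqrt{2\pi}}e^{-z^2/2}dz$, and let $\sigma_\alpha,\sigma_b\in\mathbb R$. Fix a depth $L$, an input dimension $N_0=d\ge 1$ and two inputs $x^{0,1},x^{0,2}\in\mathbb R^{d}$. Consider feedforward networks with widths $N_l$ and ranks $r_l$, $1\le l\le L$, and preactivation vectors $$h^{(l)}=W^{(l)}z^{(l-1)}+\sum_{k=1}^{r_l}b^{(l)}_kC^{(l)}_k,\qquad W^{(l)}=C^{(l)}A^{(l)},\qquad z^{(0)}=x^0,\quad z^{(l)}=\phi(h^{(l)})\text{ (entrywise)},$$ where $C^{(l)}=[C^{(l)}_1,\dots,C^{(l)}_{r_l}]\in\mathbb R^{N_l\times r_l}$ is uniformly distributed (Haar measure) on the matrices with orthonormal columns, $A^{(l)}\in\mathbb R^{r_l\times N_{l-1}}$ has i.i.d. entries $\mathcal N(0,\sigma_\alpha^2/N_{l-1})$, the $b^{(l)}_1,\dots,b^{(l)}_{r_l}$ are i.i.d. $\mathcal N(0,\sigma_b^2)$,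 and all these matrices and vectors are independent. Take the infinite-width limit along any sequence of such networks with $N_l\to\infty$ and $r_l/N_l\to\gamma_l\in(0,1]$ for every $l=1,\dots,L$. Then for $l=1,\dots,L$ and $a,b\in\{1,2\}$ the lengths ($a=b$) and covariances ($a\neq b$) of the preactivations converge in probability to deterministic limits, $$\frac1{N_l}\,h^{(l)}(x^{0,a})^{T}h^{(l)}(x^{0,b})\;\longrightarrow\; q^l_{ab},\qquad q^1_{ab}=\gamma_1\Big(\sigma_\alpha^2\,\tfrac1{d}(x^{0,a})^Tx^{0,b}+\sigma_b^2\Big),$$ and for $2\le l\le L$ these limits satisfy $$q^l_{aa}=\gamma_l\Big(\sigma_\alpha^2\int_{\mathbb R}\phi^2\big(\sqrt{q^{l-1}_{aa}}\,z\big)Dz+\sigma_b^2\Big),\qquad q^l_{12}=\gamma_l\Big(\sigma_\alpha^2\int_{\mathbb R^2}\phi(u_1)\phi(u_2)\,Dz_1Dz_2+\sigma_b^2\Big),$$ with an integrable integrand $\phi(u_1)\phi(u_2)$, where $u_1=\sqrt{q^{l-1}_{11}}\,z_1$, $u_2=\sqrt{q^{l-1}_{22}}\big(c_{12}^{l-1}z_1+\sqrt{1-(c_{12}^{l-1})^2}\,z_2\big)$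 and $c_{12}^{l-1}=q^{l-1}_{12}(q^{l-1}_{11}q^{l-1}_{22})^{-1/2}\in[-1,1]$ (with $c_{12}^{l-1}:=0$ if $q^{l-1}_{11}q^{l-1}_{22}=0$). These are the full-rank maps of Poole et al., $$q\mapsto\sigma_W^2\int\phi^2(\sqrt q\,z)Dz+\sigma^2,\qquad (q_{12},q_{11},q_{22})\mapsto\sigma_W^2\int\!\!\int\phi(u_1)\phi(u_2)\,Dz_1Dz_2+\sigma^2,$$ with weight and bias variances rescaled to $\sigma_W^2=\gamma_l\sigma_\alpha^2$ and $\sigma^2=\gamma_l\sigma_b^2$. -/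

import Mathlib

open MeasureTheory ProbabilityTheory Filter Topology
open scoped Matrix

noncomputable section

/-- The product (equivalently, Borel) sigma-algebra on real matrices. -/
instance instMeasurableSpaceRealMatrix (m n : Type*) : MeasurableSpace (Matrix m n ℝ) :=
  inferInstanceAs (MeasurableSpace (m → n → ℝ))

/-- `ν` is the uniform (Haar) probability law on the `N × r` real matrices with orthonormal columns:
the unique probability measure carried by these matrices that is invariant under
`M ↦ U * M` for every orthogonal `U`. (It exists exactly when `r ≤ N`; its entries have mean zero
and variance `1 / N`, and the column span is a uniformly distributed `r`-dimensional subspace.) -/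
structure IsUniformOrthonormal {N r : ℕ} (ν : Measure (Matrix (Fin N) (Fin r) ℝ)) : Prop where
  isProbabilityMeasure : IsProbabilityMeasure ν
  orthonormal_columns : ∀ᵐ M ∂ν, Mᵀ * M = 1
  orthogonal_invariant : ∀ U ∈ Matrix.orthogonalGroup (Fin N) ℝ, ν.map (fun M => U * M) = ν

/-- Width of layer `l`: the input (layer `0`) has dimension `d`, the layers `l ≥ 1` have
width `N l`. -/
def layerWidth (d : ℕ) (N : ℕ → ℕ) : ℕ → ℕ
  | 0 => d
  | l + 1 => N (l + 1)

/-- The parameters of a low-rank feedforward network with input dimension `d`, widths `N l` and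
ranks `r l` of the layers `l = 1, 2, …`. The fields at index `l` belong to layer `l + 1`:
`C l` has the columns `C_1, …, C_r`, `A l` has the entries `α_{k,j}`, and `b l` holds the
coefficients of the bias along `C_1, …, C_r`. -/
structure LowRankNetwork (d : ℕ) (N r : ℕ → ℕ) where
  C : (l : ℕ) → Matrix (Fin (N (l + 1))) (Fin (r (l + 1))) ℝ
  A : (l : ℕ) → Matrix (Fin (r (l + 1))) (Fin (layerWidth d N l)) ℝ
  b : (l : ℕ) → Fin (r (l + 1)) → ℝ

namespace LowRankNetwork

variable {d : ℕ} {N r : ℕ → ℕ}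

/-- The weight matrix `W = C A` of layer `l + 1`. -/
def weight (θ : LowRankNetwork d N r) (l : ℕ) :
    Matrix (Fin (N (l + 1))) (Fin (layerWidth d N l)) ℝ :=
  θ.C l * θ.A l

/-- The bias vector `∑ₖ bₖ Cₖ` of layer `l + 1`, in the column span of `C`. -/
def bias (θ : LowRankNetwork d N r) (l : ℕ) : Fin (N (l + 1)) → ℝ :=
  θ.C l *ᵥ θ.b l

/-- The output of layer `l`: the input vector `x` for `l = 0`, and `φ` applied entrywise to the
preactivation vector of layer `l` for `l ≥ 1`. -/
def output (φ : ℝ → ℝ) (θ : LowRankNetwork d N r) (x : Fin d → ℝ) :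
    (l : ℕ) → Fin (layerWidth d N l) → ℝ
  | 0 => x
  | l + 1 => fun i => φ ((θ.weight l *ᵥ output φ θ x l + θ.bias l) i)

/-- The preactivation vector `h = W z + bias` of layer `l + 1`, where `z` is the output of
layer `l`. -/
def preactivation (φ : ℝ → ℝ) (θ : LowRankNetwork d N r) (x : Fin d → ℝ) (l : ℕ) :
    Fin (N (l + 1)) → ℝ :=
  θ.weight l *ᵥ θ.output φ x l + θ.bias l

/-- The length (for `x = y`) or covariance `N⁻¹ ∑ᵢ hᵢ(x) hᵢ(y)` of the preactivation vectors of
layer `l + 1`, where `N` is the width of that layer. -/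
def overlap (φ : ℝ → ℝ) (θ : LowRankNetwork d N r) (x y : Fin d → ℝ) (l : ℕ) : ℝ :=
  (∑ i, θ.preactivation φ x l i * θ.preactivation φ y l i) / (N (l + 1) : ℝ)

end LowRankNetwork

/-- The random parameters `θ` of the first `L` layers are drawn at initialization: in each layer,
`C` is uniform on the matrices with orthonormal columns, the entries of `A` are i.i.d.
`𝒩(0, σα² / width of the previous layer)`, the bias coefficients are i.i.d. `𝒩(0, σb²)`,
and `C`, `A`, `b` are mutually independent; different layers are independent. -/
structure IsLowRankInit {Ω : Type*} [MeasurableSpace Ω] (P : Measure Ω) (L : ℕ) (σα σb : ℝ)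
    {d : ℕ} {N r : ℕ → ℕ} (θ : Ω → LowRankNetwork d N r) : Prop where
  measurable_C : ∀ l < L, Measurable fun ω => (θ ω).C l
  measurable_A : ∀ l < L, Measurable fun ω => (θ ω).A l
  measurable_b : ∀ l < L, Measurable fun ω => (θ ω).b l
  law_C : ∀ l < L, IsUniformOrthonormal (P.map fun ω => (θ ω).C l)
  law_A : ∀ l < L, ∀ k j, HasLaw (fun ω => (θ ω).A l k j)
    (gaussianReal 0 (σα ^ 2 / (layerWidth d N l : ℝ)).toNNReal) P
  law_b : ∀ l < L, ∀ k, HasLaw (fun ω => (θ ω).b l k) (gaussianReal 0 (σb ^ 2).toNNReal) P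
  indep_entries_A : ∀ l < L, iIndepFun
    (fun (p : Fin (r (l + 1)) × Fin (layerWidth d N l)) ω => (θ ω).A l p.1 p.2) P
  indep_entries_b : ∀ l < L, iIndepFun (fun (k : Fin (r (l + 1))) ω => (θ ω).b l k) P
  indep_A_b : ∀ l < L, IndepFun (fun ω => (θ ω).A l) (fun ω => (θ ω).b l) P
  indep_C_Ab : ∀ l < L, IndepFun (fun ω => (θ ω).C l) (fun ω => ((θ ω).A l, (θ ω).b l)) P
  indep_layers : iIndepFun
    (fun (l : Fin L) ω => ((θ ω).C l, (θ ω).A l, (θ ω).b l)) P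

/-- The standard Gaussian measure `Dz` on the real line. -/
abbrev stdGaussian1 : Measure ℝ := gaussianReal 0 1

/-- The correlation `c₁₂ = q₁₂ (q₁₁ q₂₂)^(-1/2)`; it is `0` if `q₁₁ q₂₂ = 0`. -/
def corr (q₁₂ q₁₁ q₂₂ : ℝ) : ℝ := q₁₂ / Real.sqrt (q₁₁ * q₂₂)

/-- `u₁ = √q₁₁ z₁`. -/
def gaussU₁ (q₁₁ : ℝ) (z : ℝ × ℝ) : ℝ := Real.sqrt q₁₁ * z.1

/-- `u₂ = √q₂₂ (c z₁ + √(1 - c²) z₂)`. -/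
def gaussU₂ (q₂₂ c : ℝ) (z : ℝ × ℝ) : ℝ :=
  Real.sqrt q₂₂ * (c * z.1 + Real.sqrt (1 - c ^ 2) * z.2)

/-- The full-rank length map of Poole et al., with weight variance `vw` and bias variance `vb`. -/
def pooleLengthMap (φ : ℝ → ℝ) (vw vb q : ℝ) : ℝ :=
  vw * (∫ z, φ (Real.sqrt q * z) ^ 2 ∂stdGaussian1) + vb

/-- The full-rank covariance map of Poole et al., with weight variance `vw` and bias
variance `vb`. -/
def pooleCovMap (φ : ℝ → ℝ) (vw vb q₁₂ q₁₁ q₂₂ : ℝ) : ℝ :=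
  vw * (∫ z, φ (gaussU₁ q₁₁ z) * φ (gaussU₂ q₂₂ (corr q₁₂ q₁₁ q₂₂) z)
    ∂(stdGaussian1.prod stdGaussian1)) + vb

/-- The low-rank length map `γ (σα² ∫ φ²(√q z) Dz + σb²)`. -/
def lengthMap (φ : ℝ → ℝ) (γ σα σb q : ℝ) : ℝ :=
  γ * (σα ^ 2 * (∫ z, φ (Real.sqrt q * z) ^ 2 ∂stdGaussian1) + σb ^ 2)

/-- The low-rank covariance map `γ (σα² ∫∫ φ(u₁) φ(u₂) Dz₁ Dz₂ + σb²)`. -/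
def covMap (φ : ℝ → ℝ) (γ σα σb q₁₂ q₁₁ q₂₂ : ℝ) : ℝ :=
  γ * (σα ^ 2 * (∫ z, φ (gaussU₁ q₁₁ z) * φ (gaussU₂ q₂₂ (corr q₁₂ q₁₁ q₂₂) z)
    ∂(stdGaussian1.prod stdGaussian1)) + σb ^ 2)

end

/-! Fix the inputs `x a`, `x b` of a layer and its frame `C`. For all scalars `s`, `t` the vector `s
(A x_a + b) + t (A x_b + b)` is an isotropic Gaussian vector in `ℝ^r`, with coordinate variance `τ =
covForm (inputCov σα σb x) a b s t` (`IsGaussianLayer.map_affineImage`). So the layer sees its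
inputs only through their covariances. Multiplication by `C` preserves inner products, hence
overlaps of preactivations are polarized squared norms of such vectors. Chi-squared concentration
gives overlap ≈ `(r / N) * inputCov`, which tends to `γ * V` (`tendstoInMeasure_layer_overlap`).

The next layer needs the averages of `φ(h_i(x_a)) φ(h_i(x_b))` over the units. For a fixed frame the
units are correlated: the covariance of the coordinates is `τ` times the projection `C Cᵀ`. Two
facts replace independence. The squares of the entries of the projection sum to `r ≤ N`, so the
entries are of order `N^(-1/2)` on average. The diagonal entries, which are the squared row norms of
`C`, concentrate at `r / N`. A second moment computation then shows that the empirical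
characteristic function of the pairs of preactivations tends to that of a Gaussian pair with
covariance `γ * V` (`IsGaussianLayer.lintegral_expWave_sub_le`, `tendstoInMeasure_layer_expWave`).
Everything needed about row norms follows from one identity: a chi-squared variable with `N` degrees
of freedom times an independent squared row norm is chi-squared with `r` degrees of freedom
(`IsUniformOrthonormal.map_norm_sq_mul_rowNormSq`).

Since `φ` is only measurable and square integrable, characteristic functions alone do not suffice.
The function `φ` is approximated by a trigonometric polynomial in `L²` of the Gaussians of variance
`2 * V a a`. The error passes to every unit because its variance is comparable to `2 * V a a`, which
requires a lower bound on all row norms simultaneously and multiplicative control of `inputCov`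
(`lintegral_average_le`, `tendstoInMeasure_layer_activation`).

If `V a a = 0`, multiplicative control means that `inputCov` is exactly zero, which convergence in
probability does not give. The induction over layers (`tendsto_inputCov_layer`) therefore also
carries the claim that `inputCov` exceeds twice its limit with vanishing probability. For a zero
limit this holds because either `σα = 0` or all activations vanish with probability tending to one
(`tendsto_measure_activation_ne_zero`). -/

/-! ### Convergence in measure to constants -/

section ConvergenceInMeasure

variable {α ι : Type*} [MeasurableSpace α] {μ : Measure α} {l : Filter ι}

/-- Continuous mapping theorem for convergence in measure to constants. -/
theorem TendstoInMeasure.map₂_const {E F G : Type*} [PseudoMetricSpace E] [PseudoMetricSpace F]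
    [PseudoMetricSpace G] {f : ι → α → E} {g : ι → α → F} {c : E} {d : F} {Φ : E → F → G}
    (hf : TendstoInMeasure μ f l fun _ => c) (hg : TendstoInMeasure μ g l fun _ => d)
    (hΦ : ContinuousAt (Function.uncurry Φ) (c, d)) :
    TendstoInMeasure μ (fun i x => Φ (f i x) (g i x)) l fun _ => Φ c d := by
  rw [tendstoInMeasure_iff_dist] at hf hg ⊢
  intro ε hε
  obtain ⟨δ, hδ, h⟩ := Metric.continuousAt_iff.1 hΦ ε hε
  have hsum := (hf δ hδ).add (hg δ hδ)
  rw [add_zero] at hsum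
  refine tendsto_of_tendsto_of_tendsto_of_le_of_le tendsto_const_nhds hsum (fun _ => zero_le)
    fun i => (measure_mono fun x hx => ?_).trans (measure_union_le _ _)
  by_contra hcon
  simp only [Set.mem_union, Set.mem_ofPred_eq, not_or, not_le] at hcon
  have h' := @h (f i x, g i x) (max_lt hcon.1 hcon.2)
  simp only [Function.uncurry] at h'
  exact absurd hx (not_le.2 h')

theorem TendstoInMeasure.map_const {E G : Type*} [PseudoMetricSpace E]
    [PseudoMetricSpace G] {f : ι → α → E} {c : E} {Φ : E → G}
    (hf : TendstoInMeasure μ f l fun _ => c) (hΦ : ContinuousAt Φ c) :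
    TendstoInMeasure μ (fun i x => Φ (f i x)) l fun _ => Φ c :=
  TendstoInMeasure.map₂_const (Φ := fun a _ => Φ a) hf hf
    (ContinuousAt.comp (f := Prod.fst) (x := (c, c)) hΦ continuousAt_fst)

theorem tendstoInMeasure_const {E : Type*} [PseudoMetricSpace E] (c : E) :
    TendstoInMeasure μ (fun (_ : ι) _ => c) l fun _ => c := by
  rw [tendstoInMeasure_iff_dist]
  intro ε hε
  simpa [not_le.2 hε] using tendsto_const_nhds

theorem tendstoInMeasure_of_tendsto_const {E : Type*} [PseudoMetricSpace E] {u : ι → E} {c : E}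
    (h : Tendsto u l (𝓝 c)) :
    TendstoInMeasure μ (fun i _ => u i) l fun _ => c := by
  rw [tendstoInMeasure_iff_dist]
  intro ε hε
  refine tendsto_const_nhds.congr' ?_
  filter_upwards [(Metric.tendsto_nhds.1 h) ε hε] with i hi
  simp [not_le.2 hi]

theorem TendstoInMeasure.finset_sum_const {E κ : Type*} [SeminormedAddCommGroup E]
    (s : Finset κ) {f : κ → ι → α → E} {c : κ → E}
    (hf : ∀ k ∈ s, TendstoInMeasure μ (f k) l fun _ => c k) :
    TendstoInMeasure μ (fun i x => ∑ k ∈ s, f k i x) l fun _ => ∑ k ∈ s, c k := by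
  classical
  induction s using Finset.induction_on with
  | empty => simpa using tendstoInMeasure_const (0 : E)
  | insert a s ha ih =>
    simp only [Finset.sum_insert ha]
    exact TendstoInMeasure.map₂_const (Φ := fun x y => x + y) (hf a (by simp))
      (ih fun k hk => hf k (by simp [hk])) (by fun_prop)

end ConvergenceInMeasure

theorem ENNReal.exists_ofReal_le {κ : ENNReal} (hκ : 0 < κ) :
    ∃ κ' : ℝ, 0 < κ' ∧ ENNReal.ofReal κ' ≤ κ := by
  rcases eq_or_ne κ ⊤ with rfl | hne
  · exact ⟨1, one_pos, le_top⟩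
  · exact ⟨κ.toReal, ENNReal.toReal_pos hκ.ne' hne, ENNReal.ofReal_toReal_le⟩

/-! ### Conditioning on an independent variable -/

section Conditioning

variable {Ω 𝒰 𝒲 : Type*} [MeasurableSpace Ω] [MeasurableSpace 𝒰] [MeasurableSpace 𝒲]
  {P : Measure Ω} [IsProbabilityMeasure P]

/-- Markov's inequality, conditionally on an independent variable in a good set. -/
theorem ProbabilityTheory.IndepFun.measure_ge_le_add_div {U : Ω → 𝒰} {W : Ω → 𝒲}
    (hUW : IndepFun U W P) (hU : Measurable U) (hW : Measurable W)
    {F : 𝒰 → 𝒲 → ENNReal} (hF : Measurable (Function.uncurry F))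
    {G : Set 𝒰} (hG : MeasurableSet G) {η ε : ENNReal} (hε : ε ≠ 0) (hε' : ε ≠ ⊤)
    (h : ∀ u ∈ G, ∫⁻ ω, F u (W ω) ∂P ≤ η) :
    P {ω | ε ≤ F (U ω) (W ω)} ≤ P {ω | U ω ∉ G} + η / ε := by
  -- Cutting `F` off outside `G` makes the bound `h` available for every `u`. Markov's inequality
  -- and Tonelli for the product law then apply to the truncated function.
  have hsub : {ω | ε ≤ F (U ω) (W ω)} ⊆
      {ω | U ω ∉ G} ∪ {ω | ε ≤ G.indicator (fun u => F u (W ω)) (U ω)} := by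
    intro ω hω
    by_cases hg : U ω ∈ G
    · right; simpa [hg] using hω
    · left; exact hg
  have hmeas : Measurable (fun p : 𝒰 × 𝒲 => G.indicator (fun u => F u p.2) p.1) := by
    have : (fun p : 𝒰 × 𝒲 => G.indicator (fun u => F u p.2) p.1) =
        (Prod.fst ⁻¹' G).indicator (Function.uncurry F) := by
      ext p; by_cases hp : p.1 ∈ G <;> simp [hp, Function.uncurry]
    rw [this]
    exact hF.indicator (measurable_fst hG)
  refine (measure_mono hsub).trans ((measure_union_le _ _).trans (add_le_add le_rfl ?_))
  refine (meas_ge_le_lintegral_div (hmeas.comp (hU.prodMk hW)).aemeasurable hε hε').trans ?_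
  gcongr
  have hlaw := (indepFun_iff_map_prod_eq_prod_map_map hU.aemeasurable hW.aemeasurable).1 hUW
  have := Measure.isProbabilityMeasure_map (μ := P) hU.aemeasurable
  have := Measure.isProbabilityMeasure_map (μ := P) hW.aemeasurable
  calc ∫⁻ ω, G.indicator (fun u => F u (W ω)) (U ω) ∂P
      = ∫⁻ p, G.indicator (fun u => F u p.2) p.1 ∂((P.map U).prod (P.map W)) := by
        rw [← hlaw, lintegral_map hmeas (hU.prodMk hW)]
    _ = ∫⁻ u, ∫⁻ w, G.indicator (fun u => F u w) u ∂(P.map W) ∂(P.map U) :=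
        lintegral_prod _ hmeas.aemeasurable
    _ ≤ ∫⁻ _, η ∂(P.map U) := by
        refine lintegral_mono fun u => ?_
        by_cases hu : u ∈ G
        · simp only [hu, Set.indicator_of_mem]
          rw [lintegral_map (show Measurable (F u) from
            hF.comp (measurable_const.prodMk measurable_id)) hW]
          exact h u hu
        · simp [hu]
    _ = η := by simp

end Conditioning

/-! ### Comparison of centred Gaussian measures -/

/-- The densities compare pointwise: the normalizing factors have ratio `√(s / w) ≤ δ^(-1/2)`, and
the exponential factor grows with the variance. If `w = 0`, then `hs` forces `s = 0` and both
measures are the same Dirac mass. One reference Gaussian thereby controls all Gaussians of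
comparable variance. -/
theorem lintegral_gaussianReal_le_of_var_le {δ : ℝ} (hδ : 0 < δ) (hδ1 : δ ≤ 1) {w s : NNReal}
    (hw : w ≤ s) (hs : δ * s ≤ w) (f : ℝ → ENNReal) :
    ∫⁻ x, f x ∂(gaussianReal 0 w) ≤
      ENNReal.ofReal (Real.sqrt δ)⁻¹ * ∫⁻ x, f x ∂(gaussianReal 0 s) := by
  have hK : 1 ≤ (Real.sqrt δ)⁻¹ := (one_le_inv₀ (Real.sqrt_pos.2 hδ)).2 (Real.sqrt_le_one.2 hδ1)
  rcases eq_or_ne w 0 with rfl | hw0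
  · have hs0 : s = 0 := by
      have : (s : ℝ) ≤ 0 := by
        by_contra hcon
        push Not at hcon
        have := mul_pos hδ hcon
        simp at hs
        linarith
      exact_mod_cast le_antisymm this s.2
    subst hs0
    calc ∫⁻ x, f x ∂(gaussianReal 0 0) = 1 * ∫⁻ x, f x ∂(gaussianReal 0 0) := (one_mul _).symm
      _ ≤ _ := by gcongr; simpa using hK
  have hs0 : s ≠ 0 := fun h => hw0 (le_antisymm (h ▸ hw) zero_le)
  have hwp : (0 : ℝ) < w := by positivity
  have hsp : (0 : ℝ) < s := by positivity
  rw [← smul_eq_mul, ← lintegral_smul_measure]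
  refine lintegral_mono' ?_ le_rfl
  rw [gaussianReal_of_var_ne_zero _ hw0, gaussianReal_of_var_ne_zero _ hs0,
    ← withDensity_smul _ (measurable_gaussianPDF 0 s)]
  refine withDensity_mono (Eventually.of_forall fun x => ?_)
  simp only [Pi.smul_apply, smul_eq_mul, gaussianPDF]
  rw [← ENNReal.ofReal_mul (by positivity)]
  refine ENNReal.ofReal_le_ofReal ?_
  simp only [gaussianPDFReal]
  rw [← mul_assoc]
  refine mul_le_mul ?_ ?_ (Real.exp_nonneg _) (by positivity)
  · rw [← mul_inv, ← Real.sqrt_mul hδ.le]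
    refine inv_anti₀ (Real.sqrt_pos.2 (by positivity)) (Real.sqrt_le_sqrt ?_)
    nlinarith [Real.pi_pos]
  · refine Real.exp_le_exp.2 ?_
    have h2 : (w : ℝ) ≤ s := by exact_mod_cast hw
    have : (x - 0) ^ 2 / (2 * s) ≤ (x - 0) ^ 2 / (2 * w) := by gcongr
    simp only [neg_div]
    linarith

/-! ### Trigonometric polynomials are dense -/

/-- The exponential `x ↦ exp (i s x)`. -/
noncomputable def expWave (s x : ℝ) : ℂ := Complex.exp (((s * x : ℝ) : ℂ) * Complex.I)

theorem norm_expWave (s x : ℝ) : ‖expWave s x‖ = 1 := Complex.norm_exp_ofReal_mul_I _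

theorem continuous_expWave (s : ℝ) : Continuous (expWave s) := by
  unfold expWave; fun_prop

theorem memLp_expWave (μ : Measure ℝ) [IsFiniteMeasure μ] (s : ℝ) (p : ENNReal) :
    MemLp (expWave s) p μ :=
  MemLp.of_bound (continuous_expWave s).aestronglyMeasurable 1
    (Eventually.of_forall fun x => (norm_expWave s x).le)

theorem conj_expWave (s x : ℝ) : (starRingEnd ℂ) (expWave s x) = expWave (-s) x := by
  simp [expWave, ← Complex.exp_conj]

/-- A real function all of whose Fourier coefficients with respect to a finite measure vanish is
zero almost everywhere. -/
theorem ae_eq_zero_of_integral_expWave_eq_zero {μ : Measure ℝ} [IsFiniteMeasure μ] {g : ℝ → ℝ}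
    (hg : Integrable g μ) (h : ∀ s, ∫ x, (g x : ℂ) * expWave s x ∂μ = 0) : g =ᵐ[μ] 0 := by
  have hg' : Integrable (fun x => -g x) μ := hg.neg
  have h1 : IsFiniteMeasure (μ.withDensity fun x => ENNReal.ofReal (g x)) :=
    isFiniteMeasure_withDensity_ofReal hg.2
  have h2 : IsFiniteMeasure (μ.withDensity fun x => ENNReal.ofReal (-g x)) :=
    isFiniteMeasure_withDensity_ofReal hg'.2
  -- The positive and negative parts of `g` are densities of two finite measures, whose
  -- characteristic functions differ by the vanishing Fourier coefficients of `g`. Hence the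
  -- measures agree, and so do the parts almost everywhere.
  have key : μ.withDensity (fun x => ENNReal.ofReal (g x)) =
      μ.withDensity (fun x => ENNReal.ofReal (-g x)) := by
    refine Measure.ext_of_charFun ?_
    ext s
    have hint : ∀ f : ℝ → ℝ, Integrable f μ → Integrable (fun x => ((max (f x) 0 : ℝ) : ℂ) *
        expWave s x) μ := fun f hf => by
      have : Integrable (fun x => ((max (f x) 0 : ℝ) : ℂ)) μ := (hf.pos_part).ofReal
      refine this.mul_bdd (c := 1) (continuous_expWave s).aestronglyMeasurable ?_
      exact Eventually.of_forall fun x => (norm_expWave s x).le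
    have hch : ∀ f : ℝ → ℝ, Integrable f μ →
        charFun (μ.withDensity fun x => ENNReal.ofReal (f x)) s =
        ∫ x, ((max (f x) 0 : ℝ) : ℂ) * expWave s x ∂μ := fun f hf => by
      rw [charFun_apply_real, integral_withDensity_eq_integral_toReal_smul₀]
      · refine integral_congr_ae (Eventually.of_forall fun x => ?_)
        simp [expWave, ENNReal.toReal_ofReal', mul_comm]
      · exact hf.1.aemeasurable.ennreal_ofReal
      · exact Eventually.of_forall fun x => ENNReal.ofReal_lt_top
    rw [hch g hg, hch (fun x => -g x) hg', ← sub_eq_zero,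
      ← integral_sub (hint g hg) (hint _ hg'), ← h s]
    refine integral_congr_ae (Eventually.of_forall fun x => ?_)
    simp only
    rw [← sub_mul, ← Complex.ofReal_sub]
    congr 2
    rcases le_total (g x) 0 with hx | hx <;> simp [hx]
  have := (withDensity_eq_iff hg.1.aemeasurable.ennreal_ofReal
    hg'.1.aemeasurable.ennreal_ofReal (by
      have := hg.lintegral_lt_top; exact this.ne)).1 key
  filter_upwards [this] with x hx
  rcases le_total (g x) 0 with hx' | hx'
  · rw [ENNReal.ofReal_of_nonpos hx'] at hx
    have := ENNReal.ofReal_eq_zero.1 hx.symm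
    simp only [Pi.zero_apply]; linarith
  · rw [ENNReal.ofReal_of_nonpos (p := -g x) (by linarith)] at hx
    have := ENNReal.ofReal_eq_zero.1 hx
    simp only [Pi.zero_apply]; linarith

/-- Trigonometric polynomials are dense in `L²` of a finite measure. -/
theorem exists_trigPolynomial_eLpNorm_sub_le {μ : Measure ℝ} [IsFiniteMeasure μ] {f : ℝ → ℂ}
    (hf : MemLp f 2 μ) {ε : ENNReal} (hε : ε ≠ 0) :
    ∃ c : ℝ →₀ ℂ, eLpNorm (fun x => f x - c.sum fun s a => a * expWave s x) 2 μ ≤ ε := by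
  let e : ℝ → Lp ℂ 2 μ := fun s => (memLp_expWave μ s 2).toLp _
  let S : Submodule ℂ (Lp ℂ 2 μ) := Submodule.span ℂ (Set.range e)
  -- In a Hilbert space it is enough that nothing but zero is orthogonal to all exponentials.
  have hS : S.topologicalClosure = ⊤ := by
    rw [Submodule.topologicalClosure_eq_top_iff, Submodule.eq_bot_iff]
    intro g hgS
    have horth : ∀ s, ∫ x, (starRingEnd ℂ) (g x) * expWave s x ∂μ = 0 := by
      intro s
      have h0 := (Submodule.mem_orthogonal' S g).1 hgS (e s) (Submodule.subset_span ⟨s, rfl⟩)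
      rw [L2.inner_def] at h0
      rw [← h0]
      refine integral_congr_ae ?_
      filter_upwards [(memLp_expWave μ s 2).coeFn_toLp] with x hx
      simp only [e, hx, RCLike.inner_apply]
      ring
    -- Conjugating at frequency `-s` shows that `g` and its conjugate both have vanishing
    -- coefficients. So do the real and imaginary parts, to which the real-valued uniqueness
    -- statement applies.
    have horth' : ∀ s, ∫ x, g x * expWave s x ∂μ = 0 := by
      intro s
      have := congrArg (starRingEnd ℂ) (horth (-s))
      rw [← integral_conj] at this
      simpa [conj_expWave] using this
    have hgL : MemLp g 2 μ := Lp.memLp g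
    have hgI : Integrable g μ := hgL.integrable (by norm_num)
    have hgI' : Integrable (fun x => (starRingEnd ℂ) (g x)) μ :=
      (RCLike.conjCLE (K := ℂ)).toContinuousLinearMap.integrable_comp hgI
    have hb : ∀ s (u : ℝ → ℂ), Integrable u μ → Integrable (fun x => u x * expWave s x) μ :=
      fun s u hu => hu.mul_bdd (c := 1) (continuous_expWave s).aestronglyMeasurable
        (Eventually.of_forall fun x => (norm_expWave s x).le)
    have hre : (fun x => (g x).re) =ᵐ[μ] 0 := by
      refine ae_eq_zero_of_integral_expWave_eq_zero hgI.re fun s => ?_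
      have h3 : ∫ x, (g x * expWave s x + (starRingEnd ℂ) (g x) * expWave s x) ∂μ = 0 := by
        rw [integral_add (hb s _ hgI) (hb s _ hgI'), horth, horth', add_zero]
      have h4 : ∫ x, (g x * expWave s x + (starRingEnd ℂ) (g x) * expWave s x) ∂μ =
          2 * ∫ x, ((g x).re : ℂ) * expWave s x ∂μ := by
        rw [← integral_const_mul]
        refine integral_congr_ae (Eventually.of_forall fun x => ?_)
        simp only
        rw [← add_mul, Complex.add_conj]; push_cast; ring
      rw [h4] at h3
      simpa using h3
    have him : (fun x => (g x).im) =ᵐ[μ] 0 := by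
      refine ae_eq_zero_of_integral_expWave_eq_zero hgI.im fun s => ?_
      have h3 : ∫ x, (g x * expWave s x - (starRingEnd ℂ) (g x) * expWave s x) ∂μ = 0 := by
        rw [integral_sub (hb s _ hgI) (hb s _ hgI'), horth, horth', sub_zero]
      have h4 : ∫ x, (g x * expWave s x - (starRingEnd ℂ) (g x) * expWave s x) ∂μ =
          (2 * Complex.I) * ∫ x, ((g x).im : ℂ) * expWave s x ∂μ := by
        rw [← integral_const_mul]
        refine integral_congr_ae (Eventually.of_forall fun x => ?_)
        simp only
        rw [← sub_mul, Complex.sub_conj]; push_cast; ring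
      rw [h4] at h3
      simpa using h3
    refine Lp.ext ?_
    filter_upwards [hre, him, Lp.coeFn_zero ℂ 2 μ] with x h1 h2 h3
    rw [h3]
    exact Complex.ext h1 h2
  have hmem : hf.toLp f ∈ closure (S : Set (Lp ℂ 2 μ)) := by
    rw [← Submodule.topologicalClosure_coe, hS]; trivial
  obtain ⟨y, hyS, hy⟩ := EMetric.mem_closure_iff.1 hmem ε (pos_iff_ne_zero.2 hε)
  obtain ⟨c, rfl⟩ := (Finsupp.mem_span_range_iff_exists_finsupp).1 hyS
  refine ⟨c, ?_⟩
  rw [Lp.edist_def] at hy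
  refine le_trans (le_of_eq ?_) hy.le
  refine eLpNorm_congr_ae ?_
  have hsum : ∀ᵐ x ∂μ, (c.sum fun s a => a • e s : Lp ℂ 2 μ) x =
      c.sum fun s a => a * expWave s x := by
    have h1 : (c.sum fun s a => a • e s : Lp ℂ 2 μ) = ∑ s ∈ c.support, c s • e s := rfl
    have h2 := Lp.coeFn_finsetSum c.support fun s => c s • e s
    have h3 : ∀ᵐ x ∂μ, ∀ s ∈ c.support, (c s • e s : Lp ℂ 2 μ) x = c s * expWave s x := by
      rw [Filter.eventually_all_finset]
      intro s _
      filter_upwards [Lp.coeFn_smul (c s) (e s), (memLp_expWave μ s 2).coeFn_toLp] with x hx hx'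
      rw [hx, Pi.smul_apply, hx', smul_eq_mul]
    rw [h1]
    filter_upwards [h2, h3] with x hx hx'
    rw [hx, Finset.sum_apply]
    exact Finset.sum_congr rfl fun s hs => hx' s hs
  filter_upwards [hf.coeFn_toLp, hsum] with x h1 h2
  simp [h1, h2]

/-- A product `φ(u) φ(v)` is approximated by trigonometric polynomials in mean, with an error that
splits into functions of one variable. -/
theorem exists_trigPolynomial_mul_approx {μ : Measure ℝ} [IsFiniteMeasure μ] {φ : ℝ → ℝ}
    (hφ : Measurable φ) (hφ2 : MemLp φ 2 μ) {ε : ℝ} (hε : 0 < ε) :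
    ∃ (c : ℝ →₀ ℂ) (Φ : ℝ → ENNReal), Measurable Φ ∧ ∫⁻ x, Φ x ∂μ ≤ ENNReal.ofReal ε ∧
      ∀ u v, ‖((φ u * φ v : ℝ) : ℂ) - (c.sum fun s a => a * expWave s u) *
        (c.sum fun s a => a * expWave s v)‖ₑ ≤ Φ u + Φ v := by
  have hsq : ∀ f : ℝ → ℂ, ∫⁻ x, ‖f x‖ₑ ^ 2 ∂μ = eLpNorm f 2 μ ^ 2 := fun f => by
    have := eLpNorm_nnreal_pow_eq_lintegral (μ := μ) (f := f) (p := 2) (by norm_num)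
    simpa using this.symm
  have hφc : MemLp (fun x => (φ x : ℂ)) 2 μ := hφ2.ofReal
  set M := (eLpNorm (fun x => (φ x : ℂ)) 2 μ ^ 2).toReal with hM
  have hMfin : eLpNorm (fun x => (φ x : ℂ)) 2 μ ^ 2 ≠ ⊤ := ENNReal.pow_ne_top hφc.2.ne
  have hM0 : 0 ≤ M := ENNReal.toReal_nonneg
  -- `η` weighs the fixed mass `M` of `φ²`, so that `η * M ≤ ε / 2`. The weight `κ = η⁻¹ + 1`
  -- collects what the weighted arithmetic-geometric inequality costs on the approximation error,
  -- and the error is then taken so small that `κ` times its square is at most `ε / 2`.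
  set η : ℝ := ε / (2 * (M + 1)) with hη
  have hηp : 0 < η := by positivity
  set κ : ℝ := η⁻¹ + 1 with hκ
  have hκp : 0 < κ := by positivity
  obtain ⟨c, hc⟩ := exists_trigPolynomial_eLpNorm_sub_le hφc
    (ε := ENNReal.ofReal (Real.sqrt (ε / (2 * κ)))) (by
      rw [Ne, ENNReal.ofReal_eq_zero, not_le]; positivity)
  set ψ : ℝ → ℂ := fun x => c.sum fun s a => a * expWave s x with hψ
  have hψc : Continuous ψ := by
    simp only [hψ, Finsupp.sum]
    exact continuous_finsetSum _ fun s _ => continuous_const.mul (continuous_expWave s)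
  have hφm : Measurable fun x => (φ x : ℂ) := Complex.measurable_ofReal.comp hφ
  refine ⟨c, fun u => ENNReal.ofReal (η * ‖(φ u : ℂ)‖ ^ 2 + κ * ‖(φ u : ℂ) - ψ u‖ ^ 2), ?_, ?_, ?_⟩
  · have := hψc.measurable
    fun_prop
  · calc ∫⁻ x, ENNReal.ofReal (η * ‖(φ x : ℂ)‖ ^ 2 + κ * ‖(φ x : ℂ) - ψ x‖ ^ 2) ∂μ
        = ∫⁻ x, (ENNReal.ofReal η * ‖(φ x : ℂ)‖ₑ ^ 2 +
            ENNReal.ofReal κ * ‖(φ x : ℂ) - ψ x‖ₑ ^ 2) ∂μ := by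
          refine lintegral_congr fun x => ?_
          rw [ENNReal.ofReal_add (by positivity) (by positivity), ENNReal.ofReal_mul hηp.le,
            ENNReal.ofReal_mul hκp.le, ENNReal.ofReal_pow (norm_nonneg _),
            ENNReal.ofReal_pow (norm_nonneg _), ofReal_norm, ofReal_norm]
      _ = ENNReal.ofReal η * eLpNorm (fun x => (φ x : ℂ)) 2 μ ^ 2 +
            ENNReal.ofReal κ * eLpNorm (fun x => (φ x : ℂ) - ψ x) 2 μ ^ 2 := by
          rw [lintegral_add_left (by fun_prop), lintegral_const_mul _ (by fun_prop),
            lintegral_const_mul _ (by have := hψc.measurable; fun_prop), hsq, hsq]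
      _ ≤ ENNReal.ofReal η * ENNReal.ofReal M +
            ENNReal.ofReal κ * ENNReal.ofReal (Real.sqrt (ε / (2 * κ))) ^ 2 := by
          gcongr
          rw [hM, ENNReal.ofReal_toReal hMfin]
      _ = ENNReal.ofReal (η * M + κ * (ε / (2 * κ))) := by
          rw [← ENNReal.ofReal_pow (Real.sqrt_nonneg _), Real.sq_sqrt (by positivity),
            ← ENNReal.ofReal_mul hηp.le, ← ENNReal.ofReal_mul hκp.le,
            ← ENNReal.ofReal_add (by positivity) (by positivity)]
      _ ≤ ENNReal.ofReal ε := by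
          refine ENNReal.ofReal_le_ofReal ?_
          have h1 : κ * (ε / (2 * κ)) = ε / 2 := by field_simp
          have h2 : η * M ≤ ε / 2 := by
            rw [hη, div_mul_eq_mul_div, div_le_div_iff₀ (by positivity) (by positivity)]
            nlinarith
          linarith
  · intro u v
    rw [← ENNReal.ofReal_add (by positivity) (by positivity), ← ofReal_norm]
    refine ENNReal.ofReal_le_ofReal ?_
    set a := (φ u : ℂ)
    set b := (φ v : ℂ)
    set d := a - ψ u
    set e := b - ψ v
    -- With errors `d`, `e` this is `a b - (a - d)(b - e)`. Each product on the right has a small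
    -- factor, and its arithmetic-geometric bound separates `u` from `v`. The separation matters
    -- later, when only the marginal laws of the preactivations are controlled.
    have heq : ((φ u * φ v : ℝ) : ℂ) - (c.sum fun s a => a * expWave s u) *
        (c.sum fun s a => a * expWave s v) = a * e + d * b - d * e := by
      change ((φ u * φ v : ℝ) : ℂ) - ψ u * ψ v = _
      simp only [a, b, d, e]; push_cast; ring
    rw [heq]
    have hn : ‖a * e + d * b - d * e‖ ≤ ‖a‖ * ‖e‖ + ‖d‖ * ‖b‖ + ‖d‖ * ‖e‖ := by
      refine (norm_sub_le _ _).trans ?_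
      rw [norm_mul d e]
      gcongr
      refine (norm_add_le _ _).trans ?_
      rw [norm_mul, norm_mul]
    have hamgm : ∀ x y : ℝ, x * y ≤ η * x ^ 2 / 2 + η⁻¹ * y ^ 2 / 2 := fun x y => by
      have h0 : 0 ≤ η⁻¹ * (η * x - y) ^ 2 := by positivity
      have h1 : η⁻¹ * (η * x - y) ^ 2 = η * x ^ 2 - 2 * (x * y) + η⁻¹ * y ^ 2 := by
        field_simp
        ring
      linarith
    have h1 := hamgm ‖a‖ ‖e‖
    have h2 := hamgm ‖b‖ ‖d‖
    have h3 : ‖d‖ * ‖e‖ ≤ ‖d‖ ^ 2 / 2 + ‖e‖ ^ 2 / 2 := by nlinarith [sq_nonneg (‖d‖ - ‖e‖)]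
    have h4 : 0 ≤ η * ‖a‖ ^ 2 := by positivity
    have h5 : 0 ≤ η * ‖b‖ ^ 2 := by positivity
    have h6 : 0 ≤ η⁻¹ * ‖d‖ ^ 2 := by positivity
    have h7 : 0 ≤ η⁻¹ * ‖e‖ ^ 2 := by positivity
    have h8 := sq_nonneg ‖d‖
    have h9 := sq_nonneg ‖e‖
    rw [hκ, add_mul, add_mul]
    linarith

/-! ### Gaussian vectors -/

section GaussianVectors

variable {Ω : Type*} [MeasurableSpace Ω] {P : Measure Ω}

theorem integral_exp_sum_mul_gaussian {ι : Type*} [Fintype ι] {X : ι → Ω → ℝ} {v : NNReal}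
    (hX : ∀ i, HasLaw (X i) (gaussianReal 0 v) P) (hi : iIndepFun X P) (w : ι → ℝ) :
    charFun (P.map fun ω => ∑ i, w i * X i ω) 1 =
      Complex.exp (-((v * ∑ i, w i ^ 2 : ℝ) : ℂ) / 2) := by
  have hi' : iIndepFun (fun i ω => w i * X i ω) P :=
    hi.comp (fun i x => w i * x) fun i => measurable_const.mul measurable_id
  rw [hi'.charFun_map_fun_sum_eq_prod fun i => (hX i).aemeasurable.const_mul _, Finset.prod_apply]
  have hone : ∀ i, charFun (P.map fun ω => w i * X i ω) 1 =
      Complex.exp (-((v * w i ^ 2 : ℝ) : ℂ) / 2) := fun i => by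
    rw [charFun_map_mul_comp (hX i).aemeasurable, (hX i).map_eq, charFun_gaussianReal]
    congr 1
    push_cast
    ring
  simp_rw [hone]
  rw [← Complex.exp_sum]
  congr 1
  push_cast
  rw [Finset.mul_sum, ← Finset.sum_div, Finset.sum_neg_distrib]

variable [IsProbabilityMeasure P]

/-- The pair of a random matrix `A` and a random vector `b` with independent centred Gaussian
entries, of variance `va` and `vb` respectively. -/
structure IsGaussianLayer (P : Measure Ω) {r m : ℕ} (va vb : NNReal)
    (A : Ω → Matrix (Fin r) (Fin m) ℝ) (b : Ω → Fin r → ℝ) : Prop where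
  measurable_A : Measurable A
  measurable_b : Measurable b
  law_A : ∀ k j, HasLaw (fun ω => A ω k j) (gaussianReal 0 va) P
  law_b : ∀ k, HasLaw (fun ω => b ω k) (gaussianReal 0 vb) P
  indep_entries_A : iIndepFun (fun (p : Fin r × Fin m) ω => A ω p.1 p.2) P
  indep_entries_b : iIndepFun (fun (k : Fin r) ω => b ω k) P
  indep_A_b : IndepFun A b P

/-- The image `A y + β b` of a vector under the affine map with data `A`, `b`. -/
noncomputable def affineImage {r m : ℕ} (A : Matrix (Fin r) (Fin m) ℝ) (b : Fin r → ℝ)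
    (y : Fin m → ℝ) (β : ℝ) : EuclideanSpace ℝ (Fin r) :=
  WithLp.toLp 2 (A *ᵥ y + β • b)

theorem measurable_matrix_apply {m n : Type*} (i : m) (j : n) :
    Measurable fun M : Matrix m n ℝ => M i j :=
  (measurable_pi_apply j).comp (measurable_pi_apply (X := fun _ : m => n → ℝ) i)

theorem measurable_affineImage {r m : ℕ} :
    Measurable fun p : (Matrix (Fin r) (Fin m) ℝ × (Fin r → ℝ)) × ((Fin m → ℝ) × ℝ) =>
      affineImage p.1.1 p.1.2 p.2.1 p.2.2 := by
  unfold affineImage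
  refine (WithLp.measurable_toLp 2 _).comp (measurable_pi_lambda _ fun k => ?_)
  simp only [Pi.add_apply, Matrix.mulVec, dotProduct, Pi.smul_apply, smul_eq_mul]
  have h := fun j => (measurable_matrix_apply (m := Fin r) (n := Fin m) k j)
  fun_prop

/-- Paired with `w`, the vector is a combination of independent entries with coefficients `y j * w
k` and `β * w k`. The weighted sum of their squares factors as `‖w‖²` times a scalar, so the
characteristic function is that of a scaled standard Gaussian. -/
theorem IsGaussianLayer.map_affineImage {r m : ℕ} {va vb : NNReal}
    {A : Ω → Matrix (Fin r) (Fin m) ℝ} {b : Ω → Fin r → ℝ} (h : IsGaussianLayer P va vb A b)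
    (y : Fin m → ℝ) (β : ℝ) :
    P.map (fun ω => affineImage (A ω) (b ω) y β) =
      (stdGaussian (EuclideanSpace ℝ (Fin r))).map
        (fun z => Real.sqrt (va * ∑ j, y j ^ 2 + vb * β ^ 2) • z) := by
  have hm : Measurable fun ω => affineImage (A ω) (b ω) y β := by
    have h0 : Measurable fun ω => ((A ω, b ω), (y, β)) :=
      (h.measurable_A.prodMk h.measurable_b).prodMk measurable_const
    exact measurable_affineImage.comp h0
  have := Measure.isProbabilityMeasure_map (μ := P) hm.aemeasurable
  have := Measure.isProbabilityMeasure_map (μ := stdGaussian (EuclideanSpace ℝ (Fin r)))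
    (f := fun z => Real.sqrt (va * ∑ j, y j ^ 2 + vb * β ^ 2) • z) (by fun_prop)
  refine Measure.ext_of_charFun ?_
  ext w
  rw [charFun_map_smul, charFun_stdGaussian, charFun_apply,
    integral_map hm.aemeasurable (by fun_prop)]
  have hA : Measurable fun ω => ∑ p : Fin r × Fin m, (y p.2 * w p.1) * A ω p.1 p.2 :=
    Finset.measurable_fun_sum _ fun p _ =>
      ((measurable_matrix_apply p.1 p.2).comp h.measurable_A).const_mul _
  have hb : Measurable fun ω => ∑ k, (β * w k) * b ω k :=
    Finset.measurable_fun_sum _ fun k _ =>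
      ((measurable_pi_apply k).comp h.measurable_b).const_mul _
  have hinner : ∀ ω, inner ℝ (affineImage (A ω) (b ω) y β) w =
      ∑ p : Fin r × Fin m, (y p.2 * w p.1) * A ω p.1 p.2 + ∑ k, (β * w k) * b ω k := fun ω => by
    simp only [affineImage, PiLp.inner_apply, Pi.add_apply, Matrix.mulVec, dotProduct,
      Pi.smul_apply, smul_eq_mul, Fintype.sum_prod_type, RCLike.inner_apply, conj_trivial]
    rw [← Finset.sum_add_distrib]
    refine Finset.sum_congr rfl fun k _ => ?_
    rw [mul_add, Finset.mul_sum]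
    congr 1
    · exact Finset.sum_congr rfl fun j _ => by ring
    · ring
  have hind : IndepFun (fun ω => ∑ p : Fin r × Fin m, (y p.2 * w p.1) * A ω p.1 p.2)
      (fun ω => ∑ k, (β * w k) * b ω k) P :=
    h.indep_A_b.comp (φ := fun M : Matrix (Fin r) (Fin m) ℝ =>
        ∑ p : Fin r × Fin m, (y p.2 * w p.1) * M p.1 p.2)
      (ψ := fun u : Fin r → ℝ => ∑ k, (β * w k) * u k)
      (Finset.measurable_fun_sum _ fun p _ => (measurable_matrix_apply p.1 p.2).const_mul _)
      (by fun_prop)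
  have hch := congrFun (hind.charFun_map_fun_add_eq_mul hA.aemeasurable hb.aemeasurable) 1
  rw [Pi.mul_apply, integral_exp_sum_mul_gaussian (fun p : Fin r × Fin m => h.law_A p.1 p.2)
    h.indep_entries_A, integral_exp_sum_mul_gaussian h.law_b h.indep_entries_b, ← Complex.exp_add,
    charFun_apply_real, integral_map (φ := fun ω => ∑ p : Fin r × Fin m, (y p.2 * w p.1) * A ω p.1 p.2 +
      ∑ k, (β * w k) * b ω k) (hA.add hb).aemeasurable (by fun_prop)] at hch
  simp_rw [hinner]
  refine Eq.trans ?_ (hch.trans ?_)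
  · refine integral_congr_ae (Eventually.of_forall fun ω => ?_)
    simp
  · congr 1
    have h1 : ‖Real.sqrt (va * ∑ j, y j ^ 2 + vb * β ^ 2) • w‖ ^ 2 =
        (va * ∑ j, y j ^ 2 + vb * β ^ 2) * ∑ k, w k ^ 2 := by
      rw [norm_smul, mul_pow, Real.norm_eq_abs, sq_abs, Real.sq_sqrt (by positivity),
        EuclideanSpace.real_norm_sq_eq]
    rw [← Complex.ofReal_pow, h1, ← add_div, ← neg_add]
    have h2 : ∑ p : Fin r × Fin m, (y p.2 * w p.1) ^ 2 = (∑ j, y j ^ 2) * ∑ k, w k ^ 2 := by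
      rw [Fintype.sum_prod_type, mul_comm, Finset.sum_mul_sum]
      exact Finset.sum_congr rfl fun k _ => Finset.sum_congr rfl fun j _ => by ring
    have h3 : ∑ k, (β * w k) ^ 2 = β ^ 2 * ∑ k, w k ^ 2 := by
      rw [Finset.mul_sum]; exact Finset.sum_congr rfl fun k _ => by ring
    rw [h2, h3]
    push_cast
    ring

/-- A linear functional of a standard Gaussian vector. -/
theorem map_inner_stdGaussian {r : ℕ} (w : EuclideanSpace ℝ (Fin r)) {t : ℝ}
    (ht : 0 ≤ t) :
    (stdGaussian (EuclideanSpace ℝ (Fin r))).map (fun z => inner ℝ w (Real.sqrt t • z)) =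
      gaussianReal 0 (t * ‖w‖ ^ 2).toNNReal := by
  have := Measure.isProbabilityMeasure_map (μ := stdGaussian (EuclideanSpace ℝ (Fin r)))
    (f := fun z => inner ℝ w (Real.sqrt t • z)) (by fun_prop)
  refine Measure.ext_of_charFun ?_
  ext s
  rw [charFun_gaussianReal, charFun_apply_real, integral_map (by fun_prop) (by fun_prop)]
  have h := charFun_stdGaussian (s • Real.sqrt t • w)
  rw [charFun_apply] at h
  refine Eq.trans ?_ (h.trans ?_)
  · refine integral_congr_ae (Eventually.of_forall fun z => ?_)
    simp only [inner_smul_right, real_inner_comm]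
    push_cast
    rfl
  · congr 1
    have hn : ‖s • Real.sqrt t • w‖ ^ 2 = s ^ 2 * (t * ‖w‖ ^ 2) := by
      rw [norm_smul, norm_smul, mul_pow, mul_pow, Real.norm_eq_abs, sq_abs, Real.norm_eq_abs,
        sq_abs, Real.sq_sqrt ht]
    rw [← Complex.ofReal_pow, hn, Real.coe_toNNReal _ (by positivity)]
    push_cast
    simp
    ring

/-- The law of the squared norm of a standard Gaussian vector. -/
noncomputable def chiSq (r : ℕ) : Measure ℝ :=
  (stdGaussian (EuclideanSpace ℝ (Fin r))).map fun z => ‖z‖ ^ 2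

instance (r : ℕ) : IsProbabilityMeasure (chiSq r) :=
  Measure.isProbabilityMeasure_map (by fun_prop)

theorem chiSq_eq_map_pi (r : ℕ) :
    chiSq r = (Measure.pi fun _ : Fin r => gaussianReal 0 1).map fun x => ∑ k, x k ^ 2 := by
  rw [chiSq, ← map_pi_eq_stdGaussian, Measure.map_map (by fun_prop) (by fun_prop)]
  congr 1
  ext x
  simp [EuclideanSpace.real_norm_sq_eq]

theorem memLp_sq_gaussianReal : MemLp (fun x : ℝ => x ^ 2) 2 (gaussianReal 0 1) := by
  have h : MemLp (fun x : ℝ => x) 4 (gaussianReal 0 1) := memLp_id_gaussianReal' 4 (by simp)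
  have := h.mul h (r := 2) (hpqr := ⟨by
    rw [← ENNReal.toReal_eq_toReal_iff' (by simp) (by simp), ENNReal.toReal_add (by simp) (by simp)]
    norm_num⟩)
  simpa [sq, Pi.mul_def] using this

/-- The variance of the square of a standard Gaussian variable. -/
noncomputable def sqVariance : ℝ := Var[fun x => x ^ 2; gaussianReal 0 1]

theorem sqVariance_nonneg : 0 ≤ sqVariance := variance_nonneg _ _

theorem memLp_id_chiSq (r : ℕ) : MemLp (fun x : ℝ => x) 2 (chiSq r) := by
  rw [chiSq_eq_map_pi, memLp_map_measure_iff (by fun_prop) (show Measurable _ by fun_prop).aemeasurable]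
  refine memLp_finsetSum Finset.univ (f := fun k (x : Fin r → ℝ) => x k ^ 2) fun k _ => ?_
  exact memLp_sq_gaussianReal.comp_measurePreserving (measurePreserving_eval _ k)

theorem integral_chiSq (r : ℕ) : ∫ x, x ∂(chiSq r) = r := by
  rw [chiSq_eq_map_pi, integral_map (show Measurable _ by fun_prop).aemeasurable (by fun_prop), integral_finsetSum]
  · have h1 : ∫ x : ℝ, x ^ 2 ∂(gaussianReal 0 1) = 1 := by
      have h := variance_fun_id_gaussianReal (μ := 0) (v := 1)
      rw [variance_eq_integral (by fun_prop)] at h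
      simpa using h
    simp_rw [integral_comp_eval (μ := fun _ : Fin r => gaussianReal 0 1) (f := fun x => x ^ 2)
      (by fun_prop), h1]
    simp
  · exact fun k _ => (memLp_sq_gaussianReal.comp_measurePreserving
      (measurePreserving_eval (fun _ : Fin r => gaussianReal 0 1) k)).integrable (by norm_num)

theorem variance_chiSq (r : ℕ) : Var[fun x => x; chiSq r] = sqVariance * r := by
  rw [chiSq_eq_map_pi, variance_map (by fun_prop) (show Measurable _ by fun_prop).aemeasurable]
  have h := variance_sum_pi (μ := fun _ : Fin r => gaussianReal 0 1)
    (X := fun _ x => x ^ 2) fun _ => memLp_sq_gaussianReal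
  have h2 : (∑ i, fun ω : Fin r → ℝ => ω i ^ 2) = (fun x => x) ∘ fun x => ∑ k, x k ^ 2 := by
    ext x; simp
  rw [← h2, h]
  simp [sqVariance, mul_comm]

theorem integral_sq_chiSq (r : ℕ) : ∫ x, x ^ 2 ∂(chiSq r) = r ^ 2 + sqVariance * r := by
  have h := variance_eq_sub (memLp_id_chiSq r)
  rw [variance_chiSq, integral_chiSq] at h
  simp only [Pi.pow_apply] at h
  linarith

/-- The Laplace transform of the square of a standard Gaussian variable at `1`. -/
noncomputable def sqLaplace : ℝ := ∫ x, Real.exp (-x ^ 2) ∂(gaussianReal 0 1)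

theorem integrable_exp_neg_sq : Integrable (fun x : ℝ => Real.exp (-x ^ 2)) (gaussianReal 0 1) :=
  Integrable.of_bound (by fun_prop) 1 (Eventually.of_forall fun x => by
    simp only [Real.norm_eq_abs, Real.abs_exp, Real.exp_le_one_iff]; nlinarith)

theorem sqLaplace_pos : 0 < sqLaplace :=
  integral_exp_pos integrable_exp_neg_sq

/-- The integrand is below `1` except at the null set `{0}`. Strictness makes `sqLaplace ^ r`
exponentially small, which later beats a union bound over the `N` rows. -/
theorem sqLaplace_lt_one : sqLaplace < 1 := by
  have h : 0 < ∫ x, (1 - Real.exp (-x ^ 2)) ∂(gaussianReal 0 1) := by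
    rw [integral_pos_iff_support_of_nonneg]
    · have hs : Function.support (fun x : ℝ => 1 - Real.exp (-x ^ 2)) = {0}ᶜ := by
        ext x
        simp [sub_eq_zero, eq_comm (a := (1 : ℝ))]
      have := nullSingletonClass_gaussianReal (μ := 0) (v := 1) one_ne_zero
      rw [hs, prob_compl_eq_one_sub (measurableSet_singleton _), measure_singleton]
      simp
    · intro x
      simp only [Pi.zero_apply, sub_nonneg, Real.exp_le_one_iff]; nlinarith
    · exact (integrable_const _).sub integrable_exp_neg_sq
  rw [integral_sub (integrable_const _) integrable_exp_neg_sq] at h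
  simp at h
  exact h

/-- Chernoff bound for the lower tail of the chi-squared law. -/
theorem chiSq_le_le (r : ℕ) (a : ℝ) :
    (chiSq r).real {x | x ≤ a} ≤ Real.exp a * sqLaplace ^ r := by
  have hpi : ∫ x, Real.exp (-x) ∂(chiSq r) = sqLaplace ^ r := by
    rw [chiSq_eq_map_pi, integral_map (show Measurable _ by fun_prop).aemeasurable (by fun_prop)]
    have := integral_fintype_prod_eq_pow (ι := Fin r) (μ := gaussianReal 0 1)
      (fun x : ℝ => Real.exp (-x ^ 2))
    rw [Fintype.card_fin] at this
    rw [sqLaplace, ← this]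
    refine integral_congr_ae (Eventually.of_forall fun x => ?_)
    simp only
    rw [← Real.exp_sum, Finset.sum_neg_distrib]
  have hsupp : ∀ᵐ x ∂(chiSq r), 0 ≤ x := by
    rw [chiSq, ae_map_iff (by fun_prop) measurableSet_Ici]
    exact Eventually.of_forall fun z => by positivity
  have hint : Integrable (fun x => Real.exp (-x)) (chiSq r) :=
    Integrable.of_bound (by fun_prop) 1 (by
      filter_upwards [hsupp] with x hx
      simpa [Real.abs_exp] using hx)
  have h := measure_le_le_exp_mul_mgf (μ := chiSq r) (X := fun x => x) (t := -1) a (by norm_num)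
    (by simpa using hint)
  simpa [mgf, hpi] using h

end GaussianVectors

/-! ### Uniformly distributed matrices with orthonormal columns -/

section OrthonormalColumns

variable {N r : ℕ}

/-- The squared norm of a row of a matrix. -/
def rowNormSq (M : Matrix (Fin N) (Fin r) ℝ) (i : Fin N) : ℝ := ∑ k, M i k ^ 2

theorem rowNormSq_nonneg (M : Matrix (Fin N) (Fin r) ℝ) (i : Fin N) : 0 ≤ rowNormSq M i :=
  Finset.sum_nonneg fun _ _ => sq_nonneg _

theorem measurable_rowNormSq (i : Fin N) :
    Measurable fun M : Matrix (Fin N) (Fin r) ℝ => rowNormSq M i :=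
  Finset.measurable_fun_sum _ fun k _ => (measurable_matrix_apply i k).pow_const 2

theorem rowNormSq_eq_mul_transpose (M : Matrix (Fin N) (Fin r) ℝ) (i : Fin N) :
    rowNormSq M i = (M * Mᵀ) i i := by
  simp [rowNormSq, Matrix.mul_apply, sq]

/-- `M * Mᵀ` is a symmetric idempotent; this compares the `i`-th diagonal entries of its square and
of itself. -/
theorem sum_sq_mul_transpose {M : Matrix (Fin N) (Fin r) ℝ} (hM : Mᵀ * M = 1) (i : Fin N) :
    ∑ j, (M * Mᵀ) i j ^ 2 = rowNormSq M i := by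
  have h : (M * Mᵀ) * (M * Mᵀ) = M * Mᵀ := by
    rw [Matrix.mul_assoc, ← Matrix.mul_assoc Mᵀ, hM, Matrix.one_mul]
  rw [rowNormSq_eq_mul_transpose]
  conv_rhs => rw [← h, Matrix.mul_apply]
  refine Finset.sum_congr rfl fun j _ => ?_
  rw [sq]
  congr 1
  conv_lhs => rw [← Matrix.transpose_apply (M * Mᵀ) j i, Matrix.transpose_mul,
    Matrix.transpose_transpose]

/-- A diagonal entry `ρ` of an orthogonal projection satisfies `ρ² ≤ ρ`. -/
theorem rowNormSq_le_one {M : Matrix (Fin N) (Fin r) ℝ} (hM : Mᵀ * M = 1) (i : Fin N) :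
    rowNormSq M i ≤ 1 := by
  have h1 := sum_sq_mul_transpose hM i
  have h2 : (M * Mᵀ) i i ^ 2 ≤ ∑ j, (M * Mᵀ) i j ^ 2 :=
    Finset.single_le_sum (f := fun j => (M * Mᵀ) i j ^ 2) (fun j _ => sq_nonneg _)
      (Finset.mem_univ i)
  rw [h1, ← rowNormSq_eq_mul_transpose] at h2
  nlinarith [rowNormSq_nonneg M i]

theorem sum_rowNormSq {M : Matrix (Fin N) (Fin r) ℝ} (hM : Mᵀ * M = 1) :
    ∑ i, rowNormSq M i = r := by
  have h := congrArg Matrix.trace hM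
  rw [Matrix.trace_mul_comm, Matrix.trace_one, Fintype.card_fin] at h
  rw [← h]
  exact Finset.sum_congr rfl fun i _ => rowNormSq_eq_mul_transpose M i

/-- A Householder reflection takes any vector to a multiple of a unit coordinate vector. -/
theorem exists_orthogonal_vecMul_eq_single (ξ : EuclideanSpace ℝ (Fin N)) (i : Fin N) :
    ∃ U ∈ Matrix.orthogonalGroup (Fin N) ℝ,
      Matrix.vecMul (WithLp.ofLp ξ) U = Pi.single i ‖ξ‖ := by
  -- `w` is normal to the mirror that exchanges `ξ` with `‖ξ‖ e_i`. The relation `w ⬝ᵥ w = 2 (ξ ⬝ᵥ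
  -- w)` below makes the reflection land exactly there; for `w = 0` the identity matrix serves.
  set w : Fin N → ℝ := WithLp.ofLp ξ - Pi.single i ‖ξ‖ with hw
  have hξ : WithLp.ofLp ξ ⬝ᵥ WithLp.ofLp ξ = ‖ξ‖ ^ 2 := by
    rw [EuclideanSpace.real_norm_sq_eq]; simp [dotProduct, sq]
  have hξw : WithLp.ofLp ξ ⬝ᵥ w = ‖ξ‖ ^ 2 - ξ i * ‖ξ‖ := by
    rw [hw, dotProduct_sub, hξ, dotProduct_single]
  have hww : w ⬝ᵥ w = 2 * (WithLp.ofLp ξ ⬝ᵥ w) := by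
    rw [hξw]
    conv_lhs => rw [hw]
    rw [sub_dotProduct, ← hw, hξw, single_dotProduct, hw]
    simp
    ring
  by_cases h0 : w ⬝ᵥ w = 0
  · have hw0 : w = 0 := dotProduct_self_eq_zero.1 h0
    exact ⟨1, one_mem _, by rw [Matrix.vecMul_one]; exact sub_eq_zero.1 hw0⟩
  · set c : ℝ := 2 / (w ⬝ᵥ w) with hc
    have hcw : c * (w ⬝ᵥ w) = 2 := by rw [hc]; field_simp
    refine ⟨1 - c • Matrix.vecMulVec w w, ?_, ?_⟩
    · rw [Matrix.mem_orthogonalGroup_iff, Matrix.transpose_sub, Matrix.transpose_one,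
        Matrix.transpose_smul, Matrix.transpose_vecMulVec, sub_mul, mul_sub, mul_sub, one_mul,
        mul_one, one_mul, Matrix.smul_mul, Matrix.mul_smul, Matrix.vecMulVec_mul_vecMulVec,
        Matrix.vecMulVec_smul, smul_smul, smul_smul]
      have : c * (c * (w ⬝ᵥ w)) = c + c := by rw [hcw]; ring
      rw [mul_assoc, this, add_smul]
      abel
    · rw [Matrix.vecMul_sub, Matrix.vecMul_one, Matrix.vecMul_smul, Matrix.vecMul_vecMulVec,
        smul_smul]
      have : c * (WithLp.ofLp ξ ⬝ᵥ w) = 1 := by rw [hww] at hcw; linarith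
      rw [this, one_smul, hw, sub_sub_cancel]

variable {ν : Measure (Matrix (Fin N) (Fin r) ℝ)}

theorem measurable_vecMul_sq :
    Measurable fun p : EuclideanSpace ℝ (Fin N) × Matrix (Fin N) (Fin r) ℝ =>
      ∑ k, (Matrix.vecMul (WithLp.ofLp p.1) p.2) k ^ 2 := by
  have h := fun (i : Fin N) (k : Fin r) => measurable_matrix_apply (m := Fin N) i k
  simp only [Matrix.vecMul, dotProduct]
  fun_prop

theorem measurable_vecMul_sq_right (ξ : EuclideanSpace ℝ (Fin N)) :
    Measurable fun M : Matrix (Fin N) (Fin r) ℝ => ∑ k, (Matrix.vecMul (WithLp.ofLp ξ) M) k ^ 2 := by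
  simp only [Matrix.vecMul, dotProduct]
  exact Finset.measurable_fun_sum _ fun k _ => (Finset.measurable_fun_sum _ fun i _ =>
    (measurable_matrix_apply i k).const_mul _).pow_const 2

theorem measurable_vecMul_sq_left (M : Matrix (Fin N) (Fin r) ℝ) :
    Measurable fun ξ : EuclideanSpace ℝ (Fin N) =>
      ∑ k, (Matrix.vecMul (WithLp.ofLp ξ) M) k ^ 2 := by
  simp only [Matrix.vecMul, dotProduct]
  fun_prop

/-- The squared norm of the image of a fixed vector `ξ` has the law of `‖ξ‖²` times the squared
norm of a row. -/
theorem IsUniformOrthonormal.map_vecMul_sq (hν : IsUniformOrthonormal ν)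
    (ξ : EuclideanSpace ℝ (Fin N)) (i : Fin N) :
    ν.map (fun M => ∑ k, (Matrix.vecMul (WithLp.ofLp ξ) M) k ^ 2) =
      ν.map (fun M => ‖ξ‖ ^ 2 * rowNormSq M i) := by
  -- By invariance `M` may be replaced by `U * M`, and `ξᵀ U M` is `‖ξ‖` times the `i`-th row of
  -- `M`.
  obtain ⟨U, hU, hUξ⟩ := exists_orthogonal_vecMul_eq_single ξ i
  have hUm : Measurable fun M : Matrix (Fin N) (Fin r) ℝ => U * M := by
    refine measurable_pi_lambda _ fun a => measurable_pi_lambda _ fun k => ?_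
    simp only [Matrix.mul_apply]
    exact Finset.measurable_fun_sum _ fun j _ => (measurable_matrix_apply j k).const_mul _
  conv_lhs => rw [← hν.orthogonal_invariant U hU, Measure.map_map (measurable_vecMul_sq_right ξ) hUm]
  congr 1
  ext M
  simp only [Function.comp, ← Matrix.vecMul_vecMul, hUξ, rowNormSq, Finset.mul_sum]
  refine Finset.sum_congr rfl fun k _ => ?_
  rw [Matrix.single_vecMul, Pi.smul_apply, Matrix.row_apply, smul_eq_mul, mul_pow]

/-- A matrix with orthonormal columns takes standard Gaussian vectors to standard Gaussian
vectors. -/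
theorem map_vecMul_sq_stdGaussian {M : Matrix (Fin N) (Fin r) ℝ} (hM : Mᵀ * M = 1) :
    (stdGaussian (EuclideanSpace ℝ (Fin N))).map
      (fun ξ => ∑ k, (Matrix.vecMul (WithLp.ofLp ξ) M) k ^ 2) = chiSq r := by
  let T : EuclideanSpace ℝ (Fin N) → EuclideanSpace ℝ (Fin r) :=
    fun ξ => WithLp.toLp 2 (Matrix.vecMul (WithLp.ofLp ξ) M)
  have hT : Measurable T := by
    refine (WithLp.measurable_toLp 2 _).comp (measurable_pi_lambda _ fun k => ?_)
    simp only [Matrix.vecMul, dotProduct]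
    fun_prop
  have hlaw : (stdGaussian (EuclideanSpace ℝ (Fin N))).map T =
      stdGaussian (EuclideanSpace ℝ (Fin r)) := by
    have := Measure.isProbabilityMeasure_map (μ := stdGaussian (EuclideanSpace ℝ (Fin N)))
      hT.aemeasurable
    refine Measure.ext_of_charFun ?_
    ext w
    rw [charFun_stdGaussian, charFun_apply, integral_map hT.aemeasurable (by fun_prop)]
    set v : EuclideanSpace ℝ (Fin N) := WithLp.toLp 2 (M *ᵥ WithLp.ofLp w) with hv
    have hinner : ∀ ξ, inner ℝ (T ξ) w = inner ℝ ξ v := fun ξ => by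
      rw [EuclideanSpace.inner_eq_star_dotProduct, EuclideanSpace.inner_eq_star_dotProduct]
      simp only [T, hv, star_trivial]
      rw [dotProduct_comm, ← Matrix.dotProduct_mulVec, dotProduct_comm]
    have hnorm : ‖v‖ ^ 2 = ‖w‖ ^ 2 := by
      rw [← real_inner_self_eq_norm_sq, ← real_inner_self_eq_norm_sq,
        EuclideanSpace.inner_eq_star_dotProduct, EuclideanSpace.inner_eq_star_dotProduct]
      simp only [hv, star_trivial]
      rw [Matrix.dotProduct_mulVec, ← Matrix.mulVec_transpose, Matrix.mulVec_mulVec, hM,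
        Matrix.one_mulVec]
    have h := charFun_stdGaussian v
    rw [charFun_apply, ← Complex.ofReal_pow, hnorm] at h
    simp_rw [hinner]
    rw [h, Complex.ofReal_pow]
  rw [chiSq, ← hlaw, Measure.map_map (by fun_prop) hT]
  congr 1
  ext ξ
  simp [T, EuclideanSpace.real_norm_sq_eq]

/-- The law of a chi-squared variable with `N` degrees of freedom times the squared norm of a row
of an independent uniform `N × r` matrix with orthonormal columns is the chi-squared law with `r`
degrees of freedom. -/
theorem IsUniformOrthonormal.map_norm_sq_mul_rowNormSq (hν : IsUniformOrthonormal ν) (i : Fin N) :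
    ((chiSq N).prod ν).map (fun p => p.1 * rowNormSq p.2 i) = chiSq r := by
  have := hν.isProbabilityMeasure
  have hf : Measurable fun p : EuclideanSpace ℝ (Fin N) × Matrix (Fin N) (Fin r) ℝ =>
      ‖p.1‖ ^ 2 * rowNormSq p.2 i :=
    (measurable_fst.norm.pow_const 2).mul ((measurable_rowNormSq i).comp measurable_snd)
  have hg : Measurable fun p : ℝ × Matrix (Fin N) (Fin r) ℝ => p.1 * rowNormSq p.2 i :=
    measurable_fst.mul ((measurable_rowNormSq i).comp measurable_snd)
  have hprod : (chiSq N).prod ν = ((stdGaussian (EuclideanSpace ℝ (Fin N))).prod ν).map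
      (Prod.map (fun z => ‖z‖ ^ 2) id) := by
    rw [← Measure.map_prod_map _ _ (by fun_prop) measurable_id, Measure.map_id, chiSq]
  rw [hprod, Measure.map_map hg (by fun_prop)]
  change Measure.map (fun p : EuclideanSpace ℝ (Fin N) × Matrix (Fin N) (Fin r) ℝ =>
      ‖p.1‖ ^ 2 * rowNormSq p.2 i) _ = _
  ext s hs
  rw [Measure.map_apply hf hs, Measure.prod_apply (hf hs)]
  -- The law of `‖ξᵀ M‖²`, for `ξ` standard Gaussian and independent of `M`, is computed in two
  -- ways. For fixed `ξ`, invariance turns it into `‖ξ‖² * rowNormSq M i`. For fixed `M` with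
  -- orthonormal columns, it is the squared norm of a standard Gaussian vector in `ℝ^r`.
  have h1 : ∀ ξ : EuclideanSpace ℝ (Fin N),
      ν (Prod.mk ξ ⁻¹' ((fun p : EuclideanSpace ℝ (Fin N) × Matrix (Fin N) (Fin r) ℝ =>
        ‖p.1‖ ^ 2 * rowNormSq p.2 i) ⁻¹' s)) =
      ν (Prod.mk ξ ⁻¹' ((fun p : EuclideanSpace ℝ (Fin N) × Matrix (Fin N) (Fin r) ℝ =>
        ∑ k, (Matrix.vecMul (WithLp.ofLp p.1) p.2) k ^ 2) ⁻¹' s)) := fun ξ => by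
    have h := DFunLike.congr_fun (hν.map_vecMul_sq ξ i) s
    rw [Measure.map_apply (measurable_vecMul_sq_right ξ) hs,
      Measure.map_apply ((measurable_rowNormSq i).const_mul _) hs] at h
    exact h.symm
  simp_rw [h1]
  rw [← Measure.prod_apply (measurable_vecMul_sq hs),
    Measure.prod_apply_symm (measurable_vecMul_sq hs)]
  have h2 : ∀ᵐ M ∂ν, (stdGaussian (EuclideanSpace ℝ (Fin N)))
      ((fun ξ => (ξ, M)) ⁻¹' ((fun p : EuclideanSpace ℝ (Fin N) × Matrix (Fin N) (Fin r) ℝ =>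
        ∑ k, (Matrix.vecMul (WithLp.ofLp p.1) p.2) k ^ 2) ⁻¹' s)) = chiSq r s := by
    filter_upwards [hν.orthonormal_columns] with M hM
    rw [← map_vecMul_sq_stdGaussian hM, Measure.map_apply (measurable_vecMul_sq_left M) hs]
    rfl
  rw [lintegral_congr_ae h2]
  simp

theorem IsUniformOrthonormal.integrable_rowNormSq_pow (hν : IsUniformOrthonormal ν) (i : Fin N)
    (n : ℕ) : Integrable (fun M => rowNormSq M i ^ n) ν := by
  have := hν.isProbabilityMeasure
  refine Integrable.of_bound ((measurable_rowNormSq i).pow_const n).aestronglyMeasurable 1 ?_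
  filter_upwards [hν.orthonormal_columns] with M hM
  rw [norm_pow, Real.norm_of_nonneg (rowNormSq_nonneg M i)]
  exact pow_le_one₀ (rowNormSq_nonneg M i) (rowNormSq_le_one hM i)

/-- Moments of an independent product factor, so each moment of the row norm is a quotient of
chi-squared moments. -/
theorem IsUniformOrthonormal.integral_rowNormSq (hν : IsUniformOrthonormal ν) (i : Fin N) :
    N * ∫ M, rowNormSq M i ∂ν = r := by
  have := hν.isProbabilityMeasure
  have hg : Measurable fun p : ℝ × Matrix (Fin N) (Fin r) ℝ => p.1 * rowNormSq p.2 i :=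
    measurable_fst.mul ((measurable_rowNormSq i).comp measurable_snd)
  have h := integral_chiSq r
  rw [← hν.map_norm_sq_mul_rowNormSq i, integral_map hg.aemeasurable (by fun_prop),
    integral_prod_mul (fun x : ℝ => x) (fun M => rowNormSq M i), integral_chiSq] at h
  exact h

theorem IsUniformOrthonormal.integral_sq_rowNormSq (hν : IsUniformOrthonormal ν) (i : Fin N) :
    (N ^ 2 + sqVariance * N) * ∫ M, rowNormSq M i ^ 2 ∂ν = r ^ 2 + sqVariance * r := by
  have := hν.isProbabilityMeasure
  have hg : Measurable fun p : ℝ × Matrix (Fin N) (Fin r) ℝ => p.1 * rowNormSq p.2 i :=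
    measurable_fst.mul ((measurable_rowNormSq i).comp measurable_snd)
  have h := integral_sq_chiSq r
  rw [← hν.map_norm_sq_mul_rowNormSq i, integral_map hg.aemeasurable (by fun_prop)] at h
  simp_rw [mul_pow] at h
  rw [integral_prod_mul (fun x : ℝ => x ^ 2) (fun M => rowNormSq M i ^ 2), integral_sq_chiSq] at h
  exact h

/-- The squared norm of a row concentrates around its mean. -/
theorem IsUniformOrthonormal.integral_rowNormSq_sub_sq_le (hν : IsUniformOrthonormal ν)
    (i : Fin N) : ∫ M, (rowNormSq M i - r / N) ^ 2 ∂ν ≤ sqVariance / N := by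
  have := hν.isProbabilityMeasure
  have hN : (0 : ℝ) < N := by exact_mod_cast i.pos
  have h1 := hν.integral_rowNormSq i
  have h2 := hν.integral_sq_rowNormSq i
  have hi1 : Integrable (fun M => rowNormSq M i) ν := by
    simpa using hν.integrable_rowNormSq_pow i 1
  have hi2 := hν.integrable_rowNormSq_pow i 2
  have hle : ∫ M, rowNormSq M i ∂ν ≤ 1 := by
    have : ∫ M, rowNormSq M i ∂ν ≤ ∫ _, 1 ∂ν := by
      refine integral_mono_ae hi1 (integrable_const _) ?_
      filter_upwards [hν.orthonormal_columns] with M hM using rowNormSq_le_one hM i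
    simpa using this
  have hexp : ∫ M, (rowNormSq M i - r / N) ^ 2 ∂ν =
      ∫ M, rowNormSq M i ^ 2 ∂ν - (r / N) ^ 2 := by
    have heq : ∀ M : Matrix (Fin N) (Fin r) ℝ, (rowNormSq M i - (r : ℝ) / N) ^ 2 =
        rowNormSq M i ^ 2 - 2 * (r / N) * rowNormSq M i + (r / N) ^ 2 := fun M => by ring
    simp_rw [heq]
    rw [integral_add (f := fun M => rowNormSq M i ^ 2 - 2 * (r / N) * rowNormSq M i)
      (hi2.sub (hi1.const_mul _)) (integrable_const _),
      integral_sub hi2 (hi1.const_mul _), integral_const_mul]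
    have : ∫ M, rowNormSq M i ∂ν = r / N := by rw [← h1]; field_simp
    rw [this]
    simp
    ring
  have hκ := sqVariance_nonneg
  rw [hexp]
  set m := ∫ M, rowNormSq M i ∂ν
  set e := ∫ M, rowNormSq M i ^ 2 ∂ν
  have hm : (r : ℝ) / N = m := by rw [← h1]; field_simp
  have hm0 : 0 ≤ m := by rw [← hm]; positivity
  rw [hm]
  -- Rearranged, `N (e - m²) = sqVariance * (m - e)`, and the right side is at most `sqVariance`
  -- because `e ≥ 0` and `m ≤ 1`.
  have h3 : (N + sqVariance) * e = N * m ^ 2 + sqVariance * m := by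
    have : N * ((N + sqVariance) * e) = N * (N * m ^ 2 + sqVariance * m) := by
      rw [← h1] at h2; linear_combination h2
    exact mul_left_cancel₀ hN.ne' this
  have he0 : 0 ≤ e := integral_nonneg fun M => sq_nonneg _
  rw [le_div_iff₀ hN]
  nlinarith [mul_nonneg hκ he0]

/-- The rows of a uniform matrix with orthonormal columns are unlikely to be small. -/
theorem IsUniformOrthonormal.rowNormSq_lt_le (hν : IsUniformOrthonormal ν) (i : Fin N) (δ : ℝ) :
    ν.real {M | rowNormSq M i < δ} ≤
      2 * (Real.exp (2 * N * δ) * sqLaplace ^ r) := by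
  have := hν.isProbabilityMeasure
  have hN : (0 : ℝ) < N := by exact_mod_cast i.pos
  have hg : Measurable fun p : ℝ × Matrix (Fin N) (Fin r) ℝ => p.1 * rowNormSq p.2 i :=
    measurable_fst.mul ((measurable_rowNormSq i).comp measurable_snd)
  have hnn : ∀ᵐ x ∂(chiSq N), 0 ≤ x := by
    rw [chiSq, ae_map_iff (by fun_prop) measurableSet_Ici]
    exact Eventually.of_forall fun z => by positivity
  -- Markov's inequality for a variable of mean `N`. This probability is divided out at the end and
  -- produces the factor `2` of the bound.
  have hhalf : 1 / 2 ≤ (chiSq N).real {x | x < 2 * N} := by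
    have h1 := mul_meas_ge_le_integral_of_nonneg (μ := chiSq N) (f := fun x => x) hnn
      ((memLp_id_chiSq N).integrable (by norm_num)) (2 * N)
    rw [integral_chiSq] at h1
    have h2 : (chiSq N).real {x | x < 2 * N} = 1 - (chiSq N).real {x : ℝ | 2 * N ≤ x} := by
      rw [← probReal_compl_eq_one_sub (s := {x : ℝ | 2 * N ≤ x}) measurableSet_Ici]
      congr 1
      ext x; simp
    rw [h2]
    nlinarith
  -- If both independent events occur, the product is at most `2 N δ`. Since the product is
  -- chi-squared with `r` degrees of freedom, the Chernoff bound applies.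
  have h3 : (chiSq N).real {x | x < 2 * N} * ν.real {M | rowNormSq M i < δ} ≤
      (chiSq r).real {x | x ≤ 2 * N * δ} := by
    rw [← measureReal_prod_prod, ← hν.map_norm_sq_mul_rowNormSq i,
      map_measureReal_apply hg (s := {x : ℝ | x ≤ 2 * N * δ}) measurableSet_Iic]
    refine measureReal_mono (fun p hp => ?_)
    have h4 : p.1 < 2 * N := hp.1
    have h5 : rowNormSq p.2 i < δ := hp.2
    have h6 := rowNormSq_nonneg p.2 i
    change p.1 * rowNormSq p.2 i ≤ 2 * N * δ
    nlinarith
  have h7 := chiSq_le_le r (2 * N * δ)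
  have h8 : 0 ≤ ν.real {M | rowNormSq M i < δ} := measureReal_nonneg
  nlinarith

/-- Matrices with orthonormal columns whose rows are not too small and have nearly equal norms. -/
def balancedFrames (N r : ℕ) (δ η : ℝ) : Set (Matrix (Fin N) (Fin r) ℝ) :=
  {M | Mᵀ * M = 1 ∧ (∀ i, δ ≤ rowNormSq M i) ∧
    ∑ i, (rowNormSq M i - (r : ℝ) / N) ^ 2 ≤ N * η ^ 2}

theorem measurableSet_balancedFrames (N r : ℕ) (δ η : ℝ) :
    MeasurableSet (balancedFrames N r δ η) := by
  refine MeasurableSet.inter ?_ (MeasurableSet.inter ?_ ?_)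
  · have h : {M : Matrix (Fin N) (Fin r) ℝ | Mᵀ * M = 1} =
        ⋂ k, ⋂ l, {M : Matrix (Fin N) (Fin r) ℝ | (Mᵀ * M) k l = (1 : Matrix _ _ ℝ) k l} := by
      ext M
      simp only [Set.mem_ofPred_eq, Set.mem_iInter]
      exact ⟨fun h k l => by rw [h], fun h => by ext k l; exact h k l⟩
    change MeasurableSet {M : Matrix (Fin N) (Fin r) ℝ | Mᵀ * M = 1}
    rw [h]
    refine MeasurableSet.iInter fun k => MeasurableSet.iInter fun l => ?_
    refine measurableSet_eq_fun ?_ measurable_const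
    simp only [Matrix.mul_apply, Matrix.transpose_apply]
    exact Finset.measurable_fun_sum _ fun j _ =>
      (measurable_matrix_apply j k).mul (measurable_matrix_apply j l)
  · have h : {M : Matrix (Fin N) (Fin r) ℝ | ∀ i, δ ≤ rowNormSq M i} =
        ⋂ i, {M : Matrix (Fin N) (Fin r) ℝ | δ ≤ rowNormSq M i} := by
      ext M; simp
    change MeasurableSet {M : Matrix (Fin N) (Fin r) ℝ | ∀ i, δ ≤ rowNormSq M i}
    rw [h]
    exact MeasurableSet.iInter fun i => measurableSet_le measurable_const (measurable_rowNormSq i)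
  · exact measurableSet_le (Finset.measurable_fun_sum _ fun i _ =>
      ((measurable_rowNormSq i).sub_const _).pow_const 2) measurable_const

/-- A union bound over the rows controls the small ones. Markov's inequality controls the spread,
whose mean is at most `N * (sqVariance / N)`. -/
theorem IsUniformOrthonormal.compl_balancedFrames_le (hν : IsUniformOrthonormal ν) {δ η : ℝ}
    (hη : 0 < η) :
    ν.real (balancedFrames N r δ η)ᶜ ≤
      2 * (N * (Real.exp (2 * N * δ) * sqLaplace ^ r)) + sqVariance / (N * η ^ 2) := by
  have := hν.isProbabilityMeasure
  have hsub : ν.real (balancedFrames N r δ η)ᶜ ≤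
      ν.real ({M | Mᵀ * M = 1}ᶜ ∪ ((⋃ i, {M | rowNormSq M i < δ}) ∪
        {M | N * η ^ 2 < ∑ i, (rowNormSq M i - (r : ℝ) / N) ^ 2})) := by
    refine measureReal_mono fun M hM => ?_
    by_contra hcon
    simp only [Set.mem_union, Set.mem_compl_iff, Set.mem_ofPred_eq, Set.mem_iUnion, not_or, not_not,
      not_exists, not_lt] at hcon
    exact hM hcon
  refine hsub.trans ((measureReal_union_le _ _).trans ?_)
  have h0 : ν.real {M : Matrix (Fin N) (Fin r) ℝ | Mᵀ * M = 1}ᶜ = 0 := by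
    rw [measureReal_def, show ν {M : Matrix (Fin N) (Fin r) ℝ | Mᵀ * M = 1}ᶜ = 0 from
      hν.orthonormal_columns, ENNReal.toReal_zero]
  rw [h0, zero_add]
  refine (measureReal_union_le _ _).trans (add_le_add ?_ ?_)
  · refine (measureReal_iUnion_fintype_le _).trans ?_
    calc ∑ i, ν.real {M | rowNormSq M i < δ}
        ≤ ∑ _i : Fin N, 2 * (Real.exp (2 * N * δ) * sqLaplace ^ r) :=
          Finset.sum_le_sum fun i _ => hν.rowNormSq_lt_le i δ
      _ = _ := by simp; ring
  · rcases Nat.eq_zero_or_pos N with rfl | hN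
    -- Without rows the event is empty, and the quotient on the right is `0` by division by zero.
    · simp
    have hN' : (0 : ℝ) < N := by exact_mod_cast hN
    have hint : ∀ i, Integrable (fun M => (rowNormSq M i - (r : ℝ) / N) ^ 2) ν := fun i => by
      have heq : ∀ M : Matrix (Fin N) (Fin r) ℝ, (rowNormSq M i - (r : ℝ) / N) ^ 2 =
        rowNormSq M i ^ 2 - 2 * (r / N) * rowNormSq M i ^ 1 + (r / N) ^ 2 := fun M => by ring
      simp_rw [heq]
      exact ((hν.integrable_rowNormSq_pow i 2).sub
        ((hν.integrable_rowNormSq_pow i 1).const_mul _)).add (integrable_const _)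
    have h1 := mul_meas_ge_le_integral_of_nonneg (μ := ν)
      (f := fun M => ∑ i, (rowNormSq M i - (r : ℝ) / N) ^ 2)
      (Eventually.of_forall fun M => Finset.sum_nonneg fun i _ => sq_nonneg _)
      (integrable_finsetSum _ fun i _ => hint i) (N * η ^ 2)
    rw [integral_finsetSum _ fun i _ => hint i] at h1
    have h2 : ∑ i, ∫ M, (rowNormSq M i - (r : ℝ) / N) ^ 2 ∂ν ≤ sqVariance := by
      calc _ ≤ ∑ _i : Fin N, sqVariance / N :=
            Finset.sum_le_sum fun i _ => hν.integral_rowNormSq_sub_sq_le i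
        _ = sqVariance := by simp; field_simp
    rw [le_div_iff₀ (by positivity), mul_comm]
    refine le_trans (mul_le_mul_of_nonneg_left (measureReal_mono ?_) (by positivity)) (h1.trans h2)
    exact Set.ofPred_subset_ofPred.2 fun M hM => le_of_lt hM

end OrthonormalColumns

/-- In the limit of large dimension, uniform matrices with orthonormal columns are balanced. -/
theorem exists_tendsto_compl_balancedFrames {N r : ℕ → ℕ} {γ : ℝ} (hγ : 0 < γ)
    (hN : Tendsto N atTop atTop) (hr : Tendsto (fun n => (r n : ℝ) / N n) atTop (𝓝 γ))
    {ν : (n : ℕ) → Measure (Matrix (Fin (N n)) (Fin (r n)) ℝ)}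
    (hν : ∀ n, IsUniformOrthonormal (ν n)) :
    ∃ δ, 0 < δ ∧ δ ≤ 1 ∧ ∀ η, 0 < η →
      Tendsto (fun n => ν n (balancedFrames (N n) (r n) δ η)ᶜ) atTop (𝓝 0) := by
  set ℓ : ℝ := -Real.log sqLaplace with hℓ
  have hℓp : 0 < ℓ := by
    have := Real.log_neg sqLaplace_pos sqLaplace_lt_one
    linarith
  -- The Chernoff exponent is `2 N δ - ℓ r`. Eventually `r ≥ γ N / 2`, so this choice leaves at most
  -- `-γ ℓ N / 4`, enough to absorb the factor `N` of the union bound.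
  set δ : ℝ := min 1 (γ * ℓ / 8) with hδ
  have hδp : 0 < δ := lt_min one_pos (by positivity)
  refine ⟨δ, hδp, min_le_left _ _, fun η hη => ?_⟩
  have hNR : Tendsto (fun n => (N n : ℝ)) atTop atTop := tendsto_natCast_atTop_atTop.comp hN
  have hreal : Tendsto (fun n => (ν n).real (balancedFrames (N n) (r n) δ η)ᶜ) atTop (𝓝 0) := by
    have h1 : Tendsto (fun n => 2 * ((N n : ℝ) * Real.exp (-(γ * ℓ / 4 * N n))) +
        sqVariance / (N n * η ^ 2)) atTop (𝓝 0) := by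
      have ha : Tendsto (fun x : ℝ => x * Real.exp (-(γ * ℓ / 4 * x))) atTop (𝓝 0) := by
        have := Real.tendsto_pow_mul_exp_neg_atTop_nhds_zero 1
        have hc := (this.comp (tendsto_id.const_mul_atTop (show 0 < γ * ℓ / 4 by positivity))).const_mul
          (γ * ℓ / 4)⁻¹
        rw [mul_zero] at hc
        refine hc.congr fun x => ?_
        simp only [Function.comp, pow_one, id]
        field_simp
      have hb : Tendsto (fun n => sqVariance / (N n * η ^ 2)) atTop (𝓝 0) :=
        tendsto_const_nhds.div_atTop (hNR.atTop_mul_const (by positivity))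
      have := ((ha.comp hNR).const_mul 2).add hb
      simpa [Function.comp] using this
    refine squeeze_zero' (Eventually.of_forall fun n => measureReal_nonneg) ?_ h1
    filter_upwards [hr.eventually (lt_mem_nhds (show γ / 2 < γ by linarith)),
      hNR.eventually_gt_atTop 0] with n hn hN0
    refine ((hν n).compl_balancedFrames_le hη).trans ?_
    gcongr
    have hpow : sqLaplace ^ r n = Real.exp (-(ℓ * r n)) := by
      rw [hℓ, neg_mul, neg_neg, mul_comm, Real.exp_nat_mul, Real.exp_log sqLaplace_pos]
    rw [hpow, ← Real.exp_add]
    refine Real.exp_le_exp.2 ?_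
    rw [lt_div_iff₀ hN0] at hn
    have hd : δ ≤ γ * ℓ / 8 := min_le_right _ _
    nlinarith [mul_le_mul_of_nonneg_left hd hN0.le, mul_le_mul_of_nonneg_left hn.le hℓp.le]
  have := fun n => (hν n).isProbabilityMeasure
  have h2 := ENNReal.tendsto_ofReal hreal
  rw [ENNReal.ofReal_zero] at h2
  exact h2.congr fun n => ofReal_measureReal

/-! ### A layer with fixed input and fixed frame -/

section FixedInput

variable {Ω : Type*} [MeasurableSpace Ω] {P : Measure Ω}
  {m N r : ℕ} {va vb : NNReal} {A : Ω → Matrix (Fin r) (Fin m) ℝ} {b : Ω → Fin r → ℝ}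

theorem IsGaussianLayer.measurable_affineImage (h : IsGaussianLayer P va vb A b)
    (y : Fin m → ℝ) (β : ℝ) : Measurable fun ω => affineImage (A ω) (b ω) y β := by
  have h0 : Measurable fun ω => ((A ω, b ω), (y, β)) :=
    (h.measurable_A.prodMk h.measurable_b).prodMk measurable_const
  exact _root_.measurable_affineImage.comp h0

variable [IsProbabilityMeasure P]

/-- The squared norm of `A y + β b` concentrates. -/
theorem IsGaussianLayer.lintegral_norm_sq_sub_le (h : IsGaussianLayer P va vb A b)
    (y : Fin m → ℝ) (β : ℝ) (s : ℝ) {τ : ℝ} (hτ : τ = va * ∑ j, y j ^ 2 + vb * β ^ 2) :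
    ∫⁻ ω, ENNReal.ofReal ((s * ‖affineImage (A ω) (b ω) y β‖ ^ 2 - s * (r * τ)) ^ 2) ∂P =
      ENNReal.ofReal (s ^ 2 * τ ^ 2 * (sqVariance * r)) := by
  have hτ0 : 0 ≤ τ := by rw [hτ]; positivity
  have h1 : ∀ z : EuclideanSpace ℝ (Fin r), ‖Real.sqrt τ • z‖ ^ 2 = τ * ‖z‖ ^ 2 := fun z => by
    rw [norm_smul, mul_pow, Real.norm_eq_abs, sq_abs, Real.sq_sqrt hτ0]
  have h2 := lintegral_map (μ := P)
    (f := fun z : EuclideanSpace ℝ (Fin r) => ENNReal.ofReal ((s * ‖z‖ ^ 2 - s * (r * τ)) ^ 2))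
    (by fun_prop) (h.measurable_affineImage y β)
  rw [← h2, h.map_affineImage, lintegral_map (by fun_prop) (by fun_prop), ← hτ]
  simp_rw [h1]
  have h3 := lintegral_map (μ := stdGaussian (EuclideanSpace ℝ (Fin r)))
    (f := fun x : ℝ => ENNReal.ofReal ((s * (τ * x) - s * (r * τ)) ^ 2))
    (g := fun z => ‖z‖ ^ 2) (by fun_prop) (by fun_prop)
  rw [← h3]
  change ∫⁻ x, _ ∂(chiSq r) = _
  have h4 : ∀ x : ℝ, (s * (τ * x) - s * (r * τ)) ^ 2 = s ^ 2 * τ ^ 2 * (x - r) ^ 2 := fun x => by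
    ring
  have h5 : Integrable (fun x : ℝ => (x - r) ^ 2) (chiSq r) :=
    ((memLp_id_chiSq r).sub (memLp_const (r : ℝ))).integrable_sq
  have h6 := variance_chiSq r
  rw [variance_eq_integral (by fun_prop), integral_chiSq] at h6
  simp_rw [h4]
  rw [← ofReal_integral_eq_lintegral_ofReal (h5.const_mul _)
    (Eventually.of_forall fun x => by positivity), integral_const_mul, h6]

theorem IsGaussianLayer.map_inner_affineImage (h : IsGaussianLayer P va vb A b)
    (y : Fin m → ℝ) (β : ℝ) {τ : ℝ} (hτ : τ = va * ∑ j, y j ^ 2 + vb * β ^ 2)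
    (w : EuclideanSpace ℝ (Fin r)) :
    P.map (fun ω => inner ℝ w (affineImage (A ω) (b ω) y β)) =
      gaussianReal 0 (τ * ‖w‖ ^ 2).toNNReal := by
  have hτ0 : 0 ≤ τ := by rw [hτ]; positivity
  rw [← map_inner_stdGaussian w hτ0]
  have h1 := Measure.map_map (μ := P) (g := fun z : EuclideanSpace ℝ (Fin r) => inner ℝ w z)
    (by fun_prop) (h.measurable_affineImage y β)
  have h2 := Measure.map_map (μ := stdGaussian (EuclideanSpace ℝ (Fin r)))
    (g := fun z : EuclideanSpace ℝ (Fin r) => inner ℝ w z)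
    (f := fun z => Real.sqrt τ • z) (by fun_prop) (by fun_prop)
  rw [h.map_affineImage, ← hτ, h2] at h1
  exact h1.symm

theorem integral_cos_gaussianReal (v : NNReal) :
    ∫ x, Real.cos x ∂(gaussianReal 0 v) = Real.exp (-v / 2) := by
  have h := charFun_gaussianReal (μ := 0) (v := v) 1
  rw [charFun_apply_real] at h
  have h1 : Integrable (fun x : ℝ => Complex.exp (((1 : ℝ) : ℂ) * x * Complex.I))
      (gaussianReal 0 v) := by
    refine Integrable.of_bound (by fun_prop) 1 (Eventually.of_forall fun x => ?_)
    rw [← Complex.ofReal_mul, Complex.norm_exp_ofReal_mul_I]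
  have h2 := congrArg Complex.re h
  rw [← RCLike.re_eq_complex_re, ← integral_re h1] at h2
  have h3 : ((1 : ℝ) : ℂ) * ((0 : ℝ) : ℂ) * Complex.I - (v : ℂ) * ((1 : ℝ) : ℂ) ^ 2 / 2 =
      ((-v / 2 : ℝ) : ℂ) := by push_cast; ring
  rw [h3, ← Complex.ofReal_exp] at h2
  simp only [RCLike.re_eq_complex_re, Complex.ofReal_re] at h2
  rw [← h2]
  refine integral_congr_ae (Eventually.of_forall fun x => ?_)
  simp only [Complex.ofReal_one, one_mul, Complex.exp_ofReal_mul_I_re]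

theorem IsGaussianLayer.integral_cos_inner (h : IsGaussianLayer P va vb A b)
    (y : Fin m → ℝ) (β : ℝ) {τ : ℝ} (hτ : τ = va * ∑ j, y j ^ 2 + vb * β ^ 2)
    (w : EuclideanSpace ℝ (Fin r)) :
    ∫ ω, Real.cos (inner ℝ w (affineImage (A ω) (b ω) y β)) ∂P =
      Real.exp (-(τ * ‖w‖ ^ 2) / 2) := by
  have hτ0 : 0 ≤ τ := by rw [hτ]; positivity
  have hm := h.measurable_affineImage y β
  have h1 := integral_map (μ := P) (φ := fun ω => inner ℝ w (affineImage (A ω) (b ω) y β))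
    (f := Real.cos) (show Measurable _ by fun_prop).aemeasurable (by fun_prop)
  rw [← h1, h.map_inner_affineImage y β hτ, integral_cos_gaussianReal,
    Real.coe_toNNReal _ (by positivity)]

/-- A row of a matrix as a Euclidean vector. -/
def euclideanRow (c : Matrix (Fin N) (Fin r) ℝ) (i : Fin N) : EuclideanSpace ℝ (Fin r) :=
  WithLp.toLp 2 (c i)

theorem norm_sq_euclideanRow (c : Matrix (Fin N) (Fin r) ℝ) (i : Fin N) :
    ‖euclideanRow c i‖ ^ 2 = rowNormSq c i := by
  simp [EuclideanSpace.real_norm_sq_eq, euclideanRow, rowNormSq]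

theorem inner_euclideanRow (c : Matrix (Fin N) (Fin r) ℝ) (i j : Fin N) :
    inner ℝ (euclideanRow c i) (euclideanRow c j) = (c * cᵀ) i j := by
  simp [euclideanRow, PiLp.inner_apply, Matrix.mul_apply, mul_comm]

theorem mulVec_eq_inner_euclideanRow (c : Matrix (Fin N) (Fin r) ℝ) (i : Fin N)
    (z : EuclideanSpace ℝ (Fin r)) :
    (c *ᵥ WithLp.ofLp z) i = inner ℝ (euclideanRow c i) z := by
  simp [euclideanRow, PiLp.inner_apply, Matrix.mulVec, dotProduct, mul_comm]

/-- Each coordinate of the preactivation is Gaussian, of a variance comparable to the reference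
variance. -/
theorem IsGaussianLayer.lintegral_mulVec_le (h : IsGaussianLayer P va vb A b)
    (y : Fin m → ℝ) (β : ℝ) {τ : ℝ} (hτ : τ = va * ∑ j, y j ^ 2 + vb * β ^ 2)
    (c : Matrix (Fin N) (Fin r) ℝ) (i : Fin N) {δ : ℝ} (hδ : 0 < δ) (hδ1 : δ ≤ 1) {s : NNReal}
    (hs : τ * rowNormSq c i ≤ s) (hs' : δ * s ≤ τ * rowNormSq c i)
    {f : ℝ → ENNReal} (hf : Measurable f) :
    ∫⁻ ω, f ((c *ᵥ WithLp.ofLp (affineImage (A ω) (b ω) y β)) i) ∂P ≤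
      ENNReal.ofReal (Real.sqrt δ)⁻¹ * ∫⁻ x, f x ∂(gaussianReal 0 s) := by
  have hτ0 : 0 ≤ τ := by rw [hτ]; positivity
  have hρ := rowNormSq_nonneg c i
  have hm := h.measurable_affineImage y β
  simp_rw [mulVec_eq_inner_euclideanRow]
  have h1 := lintegral_map (μ := P) (f := f)
    (g := fun ω => inner ℝ (euclideanRow c i) (affineImage (A ω) (b ω) y β)) hf (by fun_prop)
  rw [← h1, h.map_inner_affineImage y β hτ, norm_sq_euclideanRow]
  refine lintegral_gaussianReal_le_of_var_le hδ hδ1 ?_ ?_ f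
  · rw [Real.toNNReal_le_iff_le_coe]; exact hs
  · rw [Real.coe_toNNReal _ (by positivity)]; exact hs'

theorem abs_exp_neg_sub_exp_neg_le {x y : ℝ} (hx : 0 ≤ x) (hy : 0 ≤ y) :
    |Real.exp (-x) - Real.exp (-y)| ≤ |x - y| := by
  wlog hxy : x ≤ y generalizing x y
  · rw [abs_sub_comm, abs_sub_comm x]
    exact this hy hx (le_of_not_ge hxy)
  rw [abs_of_nonneg (sub_nonneg.2 (Real.exp_le_exp.2 (by linarith))), abs_sub_comm,
    abs_of_nonneg (sub_nonneg.2 hxy)]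
  have h1 : Real.exp (-y) = Real.exp (-x) * Real.exp (-(y - x)) := by
    rw [← Real.exp_add]; congr 1; ring
  have h2 : 1 - (y - x) ≤ Real.exp (-(y - x)) := by
    have := Real.add_one_le_exp (-(y - x)); linarith
  have h3 : Real.exp (-x) ≤ 1 := Real.exp_le_one_iff.2 (by linarith)
  rw [h1]
  nlinarith [Real.exp_pos (-x)]

theorem card_le_of_orthonormal {c : Matrix (Fin N) (Fin r) ℝ} (hc : cᵀ * c = 1) :
    (r : ℝ) ≤ N := by
  rw [← sum_rowNormSq hc]
  calc ∑ i, rowNormSq c i ≤ ∑ _i : Fin N, (1 : ℝ) :=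
        Finset.sum_le_sum fun i _ => rowNormSq_le_one hc i
    _ = N := by simp

/-- Cauchy–Schwarz over the `N²` entries, whose squares sum to the trace `r ≤ N` of the projection.
The average correlation between two units is thus of order `N^(-1/2)`, which stands in for
independence. -/
theorem sum_abs_mul_transpose_le {c : Matrix (Fin N) (Fin r) ℝ} (hc : cᵀ * c = 1) :
    ∑ i, ∑ j, |(c * cᵀ) i j| ≤ N * Real.sqrt N := by
  have h1 : (∑ p : Fin N × Fin N, |(c * cᵀ) p.1 p.2|) ^ 2 ≤ (N * Real.sqrt N) ^ 2 := by
    refine (sq_sum_le_card_mul_sum_sq).trans ?_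
    simp_rw [sq_abs]
    rw [Fintype.sum_prod_type]
    simp_rw [sum_sq_mul_transpose hc]
    rw [sum_rowNormSq hc, mul_pow, Real.sq_sqrt (by positivity)]
    simp only [Finset.card_univ, Fintype.card_prod, Fintype.card_fin]
    push_cast
    nlinarith [card_le_of_orthonormal hc, mul_self_nonneg (N : ℝ)]
  rw [← Fintype.sum_prod_type (f := fun p : Fin N × Fin N => |(c * cᵀ) p.1 p.2|)]
  exact (abs_le_of_sq_le_sq' h1 (by positivity)).2

/-- The empirical characteristic function of the preactivation concentrates. -/
theorem IsGaussianLayer.lintegral_expWave_sub_le (h : IsGaussianLayer P va vb A b)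
    (y : Fin m → ℝ) (β : ℝ) {τ : ℝ} (hτ : τ = va * ∑ j, y j ^ 2 + vb * β ^ 2)
    {c : Matrix (Fin N) (Fin r) ℝ} (hc : cᵀ * c = 1) (hN : 0 < N) {q : ℝ} (hq0 : 0 ≤ q)
    (hq1 : q ≤ 1) :
    ∫⁻ ω, ENNReal.ofReal (‖(∑ i, expWave 1 ((c *ᵥ WithLp.ofLp (affineImage (A ω) (b ω) y β)) i)) / N
        - (q : ℂ)‖ ^ 2) ∂P ≤
      ENNReal.ofReal (τ / Real.sqrt N +
        (∑ i, |Real.exp (-(τ * rowNormSq c i / 2)) - q|) / N) := by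
  have hτ0 : 0 ≤ τ := by rw [hτ]; positivity
  have hN' : (0 : ℝ) < N := by exact_mod_cast hN
  have hm := h.measurable_affineImage y β
  set θ : Fin N → Ω → ℝ := fun i ω => inner ℝ (euclideanRow c i) (affineImage (A ω) (b ω) y β)
    with hθ
  have hθm : ∀ i, Measurable (θ i) := fun i => by simp only [hθ]; fun_prop
  -- The squared modulus of an average of phases is expanded into a double sum, using `cos θᵢ cos θⱼ
  -- + sin θᵢ sin θⱼ = cos (θᵢ - θⱼ)`. Each term has an explicit Gaussian mean.
  have hnorm : ∀ ω, ‖(∑ i, expWave 1 ((c *ᵥ WithLp.ofLp (affineImage (A ω) (b ω) y β)) i)) / N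
        - (q : ℂ)‖ ^ 2 = (∑ i, ∑ j, (Real.cos (θ i ω - θ j ω) - q * Real.cos (θ i ω)
          - q * Real.cos (θ j ω) + q ^ 2)) / N ^ 2 := fun ω => by
    have h1 : (∑ i, expWave 1 ((c *ᵥ WithLp.ofLp (affineImage (A ω) (b ω) y β)) i)) / N - (q : ℂ) =
        (((∑ i, (Real.cos (θ i ω) - q)) / N : ℝ) : ℂ) +
          (((∑ i, Real.sin (θ i ω)) / N : ℝ) : ℂ) * Complex.I := by
      have hNc : (N : ℂ) ≠ 0 := by exact_mod_cast hN.ne'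
      simp_rw [mulVec_eq_inner_euclideanRow]
      change (∑ i, expWave 1 (θ i ω)) / (N : ℂ) - q = _
      simp only [expWave, one_mul, Complex.exp_mul_I, Finset.sum_add_distrib,
        Finset.sum_sub_distrib, Complex.ofReal_div, Complex.ofReal_sub, Complex.ofReal_sum,
        Complex.ofReal_cos, Complex.ofReal_sin, Complex.ofReal_natCast, ← Finset.sum_mul]
      simp
      field_simp
      ring
    rw [h1, ← Complex.normSq_eq_norm_sq, Complex.normSq_add_mul_I, div_pow, div_pow, ← add_div,
      sq, sq (∑ i, Real.sin (θ i ω)), Finset.sum_mul_sum, Finset.sum_mul_sum,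
      ← Finset.sum_add_distrib]
    congr 1
    refine Finset.sum_congr rfl fun i _ => ?_
    rw [← Finset.sum_add_distrib]
    refine Finset.sum_congr rfl fun j _ => ?_
    rw [Real.cos_sub]
    ring
  have hcos : ∀ f : Ω → ℝ, Measurable f → Integrable (fun ω => Real.cos (f ω)) P := fun f hf =>
    Integrable.of_bound (by fun_prop) 1 (Eventually.of_forall fun ω => by
      simpa using Real.abs_cos_le_one (f ω))
  have hterm : ∀ i j, Integrable (fun ω => Real.cos (θ i ω - θ j ω) - q * Real.cos (θ i ω)
          - q * Real.cos (θ j ω) + q ^ 2) P := fun i j =>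
    (((hcos _ ((hθm i).sub (hθm j))).sub ((hcos _ (hθm i)).const_mul q)).sub
      ((hcos _ (hθm j)).const_mul q)).add (integrable_const _)
  have hint : Integrable (fun ω => (∑ i, ∑ j, (Real.cos (θ i ω - θ j ω) - q * Real.cos (θ i ω)
          - q * Real.cos (θ j ω) + q ^ 2)) / N ^ 2) P :=
    (integrable_finsetSum _ fun i _ => integrable_finsetSum _ fun j _ => hterm i j).div_const _
  have hnn : ∀ ω, 0 ≤ (∑ i, ∑ j, (Real.cos (θ i ω - θ j ω) - q * Real.cos (θ i ω)
          - q * Real.cos (θ j ω) + q ^ 2)) / N ^ 2 := fun ω => by rw [← hnorm]; positivity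
  simp_rw [hnorm]
  rw [← ofReal_integral_eq_lintegral_ofReal hint (Eventually.of_forall hnn)]
  refine ENNReal.ofReal_le_ofReal ?_
  rw [integral_div, integral_finsetSum _ fun i _ => integrable_finsetSum _ fun j _ => hterm i j]
  set ρ := rowNormSq c with hρ
  have hρ0 : ∀ i, 0 ≤ ρ i := rowNormSq_nonneg c
  set a : Fin N → ℝ := fun i => Real.exp (-(τ * ρ i / 2)) with ha
  have ha0 : ∀ i, 0 ≤ a i := fun i => (Real.exp_pos _).le
  have ha1 : ∀ i, a i ≤ 1 := fun i => by
    have := hρ0 i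
    exact Real.exp_le_one_iff.2 (neg_nonpos.2 (by positivity))
  -- Dropping the correlation from the mean of `cos (θᵢ - θⱼ)` leaves `a i * a j`, at a cost of at
  -- most `τ |(c cᵀ)ᵢⱼ|`. The rest factors as `(a i - q) (a j - q)`, whose second factor has modulus
  -- at most `1`. The diagonal `i = j` needs no separate treatment.
  have hbound : ∀ i j, ∫ ω, (Real.cos (θ i ω - θ j ω) - q * Real.cos (θ i ω)
          - q * Real.cos (θ j ω) + q ^ 2) ∂P ≤ τ * |(c * cᵀ) i j| + |a i - q| := fun i j => by
    have hi : ∀ i, ∫ ω, Real.cos (θ i ω) ∂P = a i := fun i => by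
      rw [h.integral_cos_inner y β hτ, norm_sq_euclideanRow, ha, neg_div]
    have hd : ‖euclideanRow c i - euclideanRow c j‖ ^ 2 = ρ i + ρ j - 2 * (c * cᵀ) i j := by
      rw [norm_sub_sq_real, norm_sq_euclideanRow, norm_sq_euclideanRow, inner_euclideanRow]
      ring
    have hij : ∫ ω, Real.cos (θ i ω - θ j ω) ∂P =
        Real.exp (-(τ * (ρ i + ρ j - 2 * (c * cᵀ) i j) / 2)) := by
      have := h.integral_cos_inner y β hτ (euclideanRow c i - euclideanRow c j)
      simp_rw [inner_sub_left] at this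
      rw [this, hd, neg_div]
    have hnn' : 0 ≤ ρ i + ρ j - 2 * (c * cᵀ) i j := by rw [← hd]; positivity
    rw [integral_add (f := fun ω => Real.cos (θ i ω - θ j ω) - q * Real.cos (θ i ω)
        - q * Real.cos (θ j ω)) (((hcos _ ((hθm i).sub (hθm j))).sub
        ((hcos _ (hθm i)).const_mul q)).sub ((hcos _ (hθm j)).const_mul q)) (integrable_const _),
      integral_sub (f := fun ω => Real.cos (θ i ω - θ j ω) - q * Real.cos (θ i ω))
        ((hcos _ ((hθm i).sub (hθm j))).sub ((hcos _ (hθm i)).const_mul q))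
        ((hcos _ (hθm j)).const_mul q),
      integral_sub (f := fun ω => Real.cos (θ i ω - θ j ω))
        (hcos _ ((hθm i).sub (hθm j))) ((hcos _ (hθm i)).const_mul q),
      integral_const_mul, integral_const_mul, hi, hi, hij]
    have h1 := abs_exp_neg_sub_exp_neg_le (x := τ * (ρ i + ρ j - 2 * (c * cᵀ) i j) / 2)
      (y := τ * ρ i / 2 + τ * ρ j / 2) (by positivity)
      (by have := hρ0 i; have := hρ0 j; positivity)
    have h2 : Real.exp (-(τ * ρ i / 2 + τ * ρ j / 2)) = a i * a j := by
      rw [neg_add, Real.exp_add]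
    have h3 : |τ * (ρ i + ρ j - 2 * (c * cᵀ) i j) / 2 - (τ * ρ i / 2 + τ * ρ j / 2)| =
        τ * |(c * cᵀ) i j| := by
      rw [← abs_of_nonneg hτ0, ← abs_mul, abs_of_nonneg hτ0, ← abs_neg]
      congr 1; ring
    rw [h2, h3] at h1
    have h4 : (a i - q) * (a j - q) ≤ |a i - q| := by
      refine (le_abs_self _).trans ?_
      rw [abs_mul]
      have : |a j - q| ≤ 1 := abs_le.2 ⟨by linarith [ha0 j], by linarith [ha1 j]⟩
      nlinarith [abs_nonneg (a i - q)]
    have h5 := (abs_le.1 h1).2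
    simp only [integral_const, probReal_univ, one_smul]
    nlinarith
  calc (∑ i, ∫ ω, ∑ j, (Real.cos (θ i ω - θ j ω) - q * Real.cos (θ i ω)
          - q * Real.cos (θ j ω) + q ^ 2) ∂P) / N ^ 2
      ≤ (∑ i, ∑ j, (τ * |(c * cᵀ) i j| + |a i - q|)) / N ^ 2 := by
        gcongr with i
        rw [integral_finsetSum _ fun j _ => hterm i j]
        exact Finset.sum_le_sum fun j _ => hbound i j
    _ = (τ * (∑ i, ∑ j, |(c * cᵀ) i j|) + N * ∑ i, |a i - q|) / N ^ 2 := by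
        simp_rw [Finset.sum_add_distrib, Finset.mul_sum]
        simp
    _ ≤ (τ * (N * Real.sqrt N) + N * ∑ i, |a i - q|) / N ^ 2 := by
        gcongr
        exact sum_abs_mul_transpose_le hc
    _ = τ / Real.sqrt N + (∑ i, |a i - q|) / N := by
        have hs : Real.sqrt N ≠ 0 := (Real.sqrt_pos.2 hN').ne'
        rw [add_div]
        congr 1
        · rw [div_eq_div_iff (by positivity) hs]
          have := Real.mul_self_sqrt hN'.le
          rw [sq]
          linear_combination (τ * N) * this
        · field_simp

/-- Since `x ↦ exp (-x)` is 1-Lipschitz on nonnegative reals, exponents may be compared instead.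
Cauchy–Schwarz bounds the average deviation of row norms from `r / N` by `η`; replacing `r / N * τ`
by `γ * t` gives the second term. -/
theorem sum_abs_exp_sub_le_of_mem_balancedFrames {c : Matrix (Fin N) (Fin r) ℝ} {δ η τ t γ : ℝ}
    (hc : c ∈ balancedFrames N r δ η) (hη : 0 ≤ η) (hN : 0 < N) (hτ : 0 ≤ τ) (ht : 0 ≤ t)
    (hγ : 0 ≤ γ) :
    (∑ i, |Real.exp (-(τ * rowNormSq c i / 2)) - Real.exp (-(γ * t / 2))|) / N ≤
      τ * η / 2 + |r / N * τ - γ * t| / 2 := by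
  have hN' : (0 : ℝ) < N := by exact_mod_cast hN
  have h1 : (∑ i, |rowNormSq c i - (r : ℝ) / N|) ^ 2 ≤ (N * η) ^ 2 := by
    refine (sq_sum_le_card_mul_sum_sq).trans ?_
    simp_rw [sq_abs]
    simp only [Finset.card_univ, Fintype.card_fin]
    nlinarith [hc.2.2]
  have h2 := (abs_le_of_sq_le_sq' h1 (by positivity)).2
  have h3 : ∀ i, |Real.exp (-(τ * rowNormSq c i / 2)) - Real.exp (-(γ * t / 2))| ≤
      τ / 2 * |rowNormSq c i - (r : ℝ) / N| + |r / N * τ - γ * t| / 2 := fun i => by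
    have h0 := rowNormSq_nonneg c i
    refine (abs_exp_neg_sub_exp_neg_le (by positivity) (by positivity)).trans ?_
    have h4 : τ * rowNormSq c i / 2 - γ * t / 2 =
        τ / 2 * (rowNormSq c i - (r : ℝ) / N) + (r / N * τ - γ * t) / 2 := by ring
    rw [h4]
    refine (abs_add_le _ _).trans ?_
    rw [abs_mul, abs_of_nonneg (show 0 ≤ τ / 2 by positivity), abs_div,
      abs_of_pos (show (0 : ℝ) < 2 by norm_num)]
  rw [div_le_iff₀ hN']
  calc _ ≤ ∑ i, (τ / 2 * |rowNormSq c i - (r : ℝ) / N| + |r / N * τ - γ * t| / 2) :=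
        Finset.sum_le_sum fun i _ => h3 i
    _ = τ / 2 * ∑ i, |rowNormSq c i - (r : ℝ) / N| + N * (|r / N * τ - γ * t| / 2) := by
        rw [Finset.sum_add_distrib, ← Finset.mul_sum]; simp
    _ ≤ τ / 2 * (N * η) + N * (|r / N * τ - γ * t| / 2) := by gcongr
    _ = _ := by ring

end FixedInput

/-! ### A random layer -/

section RandomLayer

variable {m N r : ℕ}

/-- The covariance of the Gaussian coefficients of a layer, given the inputs of the layer. -/
noncomputable def inputCov (σα σb : ℝ) (x : Fin 2 → Fin m → ℝ) (a b : Fin 2) : ℝ :=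
  σα ^ 2 * ((∑ j, x a j * x b j) / m) + σb ^ 2

/-- The quadratic form `s² V_aa + 2 s t V_ab + t² V_bb`. -/
def covForm (V : Fin 2 → Fin 2 → ℝ) (a b : Fin 2) (s t : ℝ) : ℝ :=
  s ^ 2 * V a a + 2 * s * t * V a b + t ^ 2 * V b b

/-- Identifies the form with the variance in `IsGaussianLayer.map_affineImage` for `y = s x_a + t
x_b` and `β = s + t`. Nonnegativity of the form is then evident. -/
theorem covForm_inputCov (σα σb : ℝ) (x : Fin 2 → Fin m → ℝ) (a b : Fin 2) (s t : ℝ) :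
    covForm (inputCov σα σb x) a b s t = ((σα ^ 2 / m : ℝ).toNNReal : ℝ) *
      ∑ j, (s • x a + t • x b) j ^ 2 + ((σb ^ 2).toNNReal : ℝ) * (s + t) ^ 2 := by
  rw [Real.coe_toNNReal _ (by positivity), Real.coe_toNNReal _ (by positivity)]
  have h : ∑ j, (s • x a + t • x b) j ^ 2 = s ^ 2 * ∑ j, x a j * x a j +
      2 * s * t * ∑ j, x a j * x b j + t ^ 2 * ∑ j, x b j * x b j := by
    simp only [Finset.mul_sum, ← Finset.sum_add_distrib]
    refine Finset.sum_congr rfl fun j _ => ?_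
    simp only [Pi.add_apply, Pi.smul_apply, smul_eq_mul]
    ring
  rw [h, covForm]
  simp only [inputCov]
  ring

theorem covForm_inputCov_nonneg (σα σb : ℝ) (x : Fin 2 → Fin m → ℝ) (a b : Fin 2) (s t : ℝ) :
    0 ≤ covForm (inputCov σα σb x) a b s t := by
  rw [covForm_inputCov]; positivity

theorem inputCov_self_nonneg (σα σb : ℝ) (x : Fin 2 → Fin m → ℝ) (a : Fin 2) :
    0 ≤ inputCov σα σb x a a := by
  simpa [covForm] using covForm_inputCov_nonneg σα σb x a a 1 0

theorem abs_covForm_sub_le {V W : Fin 2 → Fin 2 → ℝ} {e : ℝ} (h : ∀ a b, |V a b - W a b| ≤ e)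
    (a b : Fin 2) (s t : ℝ) : |covForm V a b s t - covForm W a b s t| ≤ (|s| + |t|) ^ 2 * e := by
  have h1 : covForm V a b s t - covForm W a b s t =
      s ^ 2 * (V a a - W a a) + 2 * s * t * (V a b - W a b) + t ^ 2 * (V b b - W b b) := by
    simp only [covForm]; ring
  rw [h1]
  refine (abs_add_three _ _ _).trans ?_
  simp only [abs_mul, abs_two, abs_pow]
  have h2 := mul_le_mul_of_nonneg_left (h a a) (sq_nonneg |s|)
  have h3 := mul_le_mul_of_nonneg_left (h a b) (show 0 ≤ 2 * |s| * |t| by positivity)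
  have h4 := mul_le_mul_of_nonneg_left (h b b) (sq_nonneg |t|)
  linarith

/-- The preactivation of a layer with inputs and frame `u` and Gaussian coefficients `w`. -/
noncomputable def layerPreactivation (u : (Fin 2 → Fin m → ℝ) × Matrix (Fin N) (Fin r) ℝ)
    (w : Matrix (Fin r) (Fin m) ℝ × (Fin r → ℝ)) (a : Fin 2) (i : Fin N) : ℝ :=
  (u.2 *ᵥ WithLp.ofLp (affineImage w.1 w.2 (u.1 a) 1)) i

theorem measurable_affineImage_comb (a b : Fin 2) (s t : ℝ) :
    Measurable fun p : ((Fin 2 → Fin m → ℝ) × Matrix (Fin N) (Fin r) ℝ) ×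
      (Matrix (Fin r) (Fin m) ℝ × (Fin r → ℝ)) =>
        affineImage p.2.1 p.2.2 (s • p.1.1 a + t • p.1.1 b) (s + t) := by
  have h0 : Measurable fun p : ((Fin 2 → Fin m → ℝ) × Matrix (Fin N) (Fin r) ℝ) ×
      (Matrix (Fin r) (Fin m) ℝ × (Fin r → ℝ)) =>
      (p.2, ((s • p.1.1 a + t • p.1.1 b : Fin m → ℝ), s + t)) := by fun_prop
  exact measurable_affineImage.comp h0

theorem measurable_layerPreactivation (a : Fin 2) (i : Fin N) :
    Measurable fun p : ((Fin 2 → Fin m → ℝ) × Matrix (Fin N) (Fin r) ℝ) ×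
      (Matrix (Fin r) (Fin m) ℝ × (Fin r → ℝ)) => layerPreactivation p.1 p.2 a i := by
  have h1 : Measurable fun p : ((Fin 2 → Fin m → ℝ) × Matrix (Fin N) (Fin r) ℝ) ×
      (Matrix (Fin r) (Fin m) ℝ × (Fin r → ℝ)) => affineImage p.2.1 p.2.2 (p.1.1 a) 1 := by
    have h0 : Measurable fun p : ((Fin 2 → Fin m → ℝ) × Matrix (Fin N) (Fin r) ℝ) ×
        (Matrix (Fin r) (Fin m) ℝ × (Fin r → ℝ)) => (p.2, (p.1.1 a, (1 : ℝ))) := by fun_prop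
    exact measurable_affineImage.comp h0
  simp only [layerPreactivation, Matrix.mulVec, dotProduct]
  refine Finset.measurable_fun_sum _ fun k _ => ?_
  refine Measurable.mul ?_ ?_
  · have h0 : Measurable fun p : ((Fin 2 → Fin m → ℝ) × Matrix (Fin N) (Fin r) ℝ) ×
      (Matrix (Fin r) (Fin m) ℝ × (Fin r → ℝ)) => p.1.2 := by fun_prop
    exact (measurable_matrix_apply i k).comp h0
  · exact (measurable_pi_apply k).comp ((WithLp.measurable_ofLp 2 _).comp h1)

/-- The bias is shared by both inputs, hence the coefficient `s + t`. Joint statements about two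
preactivations thereby reduce to a single affine image, in the manner of Cramér and Wold. -/
theorem affineImage_comb (A : Matrix (Fin r) (Fin m) ℝ) (b : Fin r → ℝ) (y z : Fin m → ℝ)
    (s t : ℝ) : affineImage A b (s • y + t • z) (s + t) =
      s • affineImage A b y 1 + t • affineImage A b z 1 := by
  ext k
  simp only [affineImage, Matrix.mulVec_add, Matrix.mulVec_smul, PiLp.add_apply, PiLp.smul_apply,
    Pi.add_apply, Pi.smul_apply, smul_eq_mul]
  ring

theorem comb_layerPreactivation (u : (Fin 2 → Fin m → ℝ) × Matrix (Fin N) (Fin r) ℝ)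
    (w : Matrix (Fin r) (Fin m) ℝ × (Fin r → ℝ)) (a b : Fin 2) (s t : ℝ) (i : Fin N) :
    (u.2 *ᵥ WithLp.ofLp (affineImage w.1 w.2 (s • u.1 a + t • u.1 b) (s + t))) i =
      s * layerPreactivation u w a i + t * layerPreactivation u w b i := by
  rw [affineImage_comb, WithLp.ofLp_add, WithLp.ofLp_smul, WithLp.ofLp_smul, Matrix.mulVec_add,
    Matrix.mulVec_smul, Matrix.mulVec_smul]
  rfl

/-- Orthonormal columns preserve inner products; polarization then leaves squared norms of single
Gaussian vectors. The explicit scalars match the shape `(s, t, s + t)` of `affineImage_comb`. -/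
theorem sum_layerPreactivation_mul (u : (Fin 2 → Fin m → ℝ) × Matrix (Fin N) (Fin r) ℝ)
    (w : Matrix (Fin r) (Fin m) ℝ × (Fin r → ℝ)) (hu : u.2ᵀ * u.2 = 1) (a b : Fin 2) :
    ∑ i, layerPreactivation u w a i * layerPreactivation u w b i =
      (‖affineImage w.1 w.2 ((1 : ℝ) • u.1 a + (1 : ℝ) • u.1 b) (1 + 1)‖ ^ 2 -
        ‖affineImage w.1 w.2 ((1 : ℝ) • u.1 a + (-1 : ℝ) • u.1 b) (1 + -1)‖ ^ 2) / 4 := by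
  rw [affineImage_comb, affineImage_comb, one_smul, one_smul, neg_one_smul, ← sub_eq_add_neg,
    norm_add_sq_real, norm_sub_sq_real]
  have h : ∑ i, layerPreactivation u w a i * layerPreactivation u w b i =
      inner ℝ (affineImage w.1 w.2 (u.1 a) 1) (affineImage w.1 w.2 (u.1 b) 1) := by
    change (u.2 *ᵥ _) ⬝ᵥ (u.2 *ᵥ _) = _
    rw [Matrix.dotProduct_mulVec, ← Matrix.mulVec_transpose, Matrix.mulVec_mulVec, hu,
      Matrix.one_mulVec, EuclideanSpace.inner_eq_star_dotProduct, star_trivial, dotProduct_comm]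
  rw [h]
  ring

variable {Ω : Type*} [MeasurableSpace Ω]

/-- A layer with random inputs, a uniform orthonormal frame `C` and Gaussian coefficients `A`, `b`,
such that the coefficients are independent of the inputs and the frame. -/
structure IsRandomLayer (P : Measure Ω) (σα σb : ℝ) (X : Ω → Fin 2 → Fin m → ℝ)
    (C : Ω → Matrix (Fin N) (Fin r) ℝ) (A : Ω → Matrix (Fin r) (Fin m) ℝ) (b : Ω → Fin r → ℝ) :
    Prop where
  measurable_X : Measurable X
  measurable_C : Measurable C
  gaussian : IsGaussianLayer P (σα ^ 2 / m : ℝ).toNNReal (σb ^ 2).toNNReal A b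
  law_C : IsUniformOrthonormal (P.map C)
  indep : IndepFun (fun ω => (X ω, C ω)) (fun ω => (A ω, b ω)) P

/-- Inputs whose covariances are close to `V`. -/
def closeInputs (m : ℕ) (σα σb : ℝ) (V : Fin 2 → Fin 2 → ℝ) (e : ℝ) : Set (Fin 2 → Fin m → ℝ) :=
  {x | (∀ a b, |inputCov σα σb x a b - V a b| ≤ e) ∧
    ∀ a, V a a / 2 ≤ inputCov σα σb x a a ∧ inputCov σα σb x a a ≤ 2 * V a a}

theorem measurable_inputCov (σα σb : ℝ) (a b : Fin 2) :
    Measurable fun x : Fin 2 → Fin m → ℝ => inputCov σα σb x a b := by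
  unfold inputCov; fun_prop

theorem measurableSet_closeInputs (m : ℕ) (σα σb : ℝ) (V : Fin 2 → Fin 2 → ℝ) (e : ℝ) :
    MeasurableSet (closeInputs m σα σb V e) := by
  have h := fun a b => measurable_inputCov (m := m) σα σb a b
  have heq : closeInputs m σα σb V e =
      (⋂ a, ⋂ b, {x | |inputCov σα σb x a b - V a b| ≤ e}) ∩
      ⋂ a, ({x | V a a / 2 ≤ inputCov σα σb x a a} ∩ {x | inputCov σα σb x a a ≤ 2 * V a a}) := by
    ext x; simp [closeInputs]
  rw [heq]
  refine MeasurableSet.inter (MeasurableSet.iInter fun a => MeasurableSet.iInter fun b => ?_)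
    (MeasurableSet.iInter fun a => MeasurableSet.inter ?_ ?_)
  · exact measurableSet_le (by fun_prop) measurable_const
  · exact measurableSet_le measurable_const (h a a)
  · exact measurableSet_le (h a a) measurable_const

/-- Pairs of inputs close to `V` and balanced frames. -/
def goodConditions (m N r : ℕ) (σα σb : ℝ) (V : Fin 2 → Fin 2 → ℝ) (δ e : ℝ) :
    Set ((Fin 2 → Fin m → ℝ) × Matrix (Fin N) (Fin r) ℝ) :=
  closeInputs m σα σb V e ×ˢ balancedFrames N r δ e

end RandomLayer

/-! ### Concentration of the overlaps in one wide layer -/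

section LayerLimit

variable {Ω : Type*} [MeasurableSpace Ω] {P : Measure Ω} [IsProbabilityMeasure P]
  {m N r : ℕ → ℕ} {σα σb γ : ℝ}
  {X : (n : ℕ) → Ω → Fin 2 → Fin (m n) → ℝ}
  {C : (n : ℕ) → Ω → Matrix (Fin (N n)) (Fin (r n)) ℝ}
  {A : (n : ℕ) → Ω → Matrix (Fin (r n)) (Fin (m n)) ℝ} {b : (n : ℕ) → Ω → Fin (r n) → ℝ}
  {V : Fin 2 → Fin 2 → ℝ}

-- Convergence in probability yields the additive bounds and the lower multiplicative bound, which
-- for `V a a ≤ 0` is automatic because input variances are nonnegative. The upper multiplicative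
-- bound does not follow when `V a a = 0`, so it enters as `hV2`.
omit [IsProbabilityMeasure P] in
theorem tendsto_compl_closeInputs
    (hV : ∀ a b, TendstoInMeasure P (fun n ω => inputCov σα σb (X n ω) a b) atTop fun _ => V a b)
    (hV2 : ∀ a, Tendsto (fun n => P {ω | 2 * V a a < inputCov σα σb (X n ω) a a}) atTop (𝓝 0))
    {e : ℝ} (he : 0 < e) :
    Tendsto (fun n => P {ω | X n ω ∉ closeInputs (m n) σα σb V e}) atTop (𝓝 0) := by
  have h1 : ∀ a b, Tendsto (fun n => P {ω | e ≤ dist (inputCov σα σb (X n ω) a b) (V a b)}) atTop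
      (𝓝 0) := fun a b => tendstoInMeasure_iff_dist.1 (hV a b) e he
  have h2 : ∀ a, Tendsto (fun n => P {ω | inputCov σα σb (X n ω) a a < V a a / 2}) atTop
      (𝓝 0) := fun a => by
    rcases le_or_gt (V a a) 0 with h0 | h0
    · refine tendsto_const_nhds.congr fun n => ?_
      have : {ω | inputCov σα σb (X n ω) a a < V a a / 2} = ∅ := by
        ext ω
        simp only [Set.mem_ofPred_eq, Set.mem_empty_iff_false, iff_false, not_lt]
        linarith [inputCov_self_nonneg σα σb (X n ω) a]
      rw [this, measure_empty]
    · refine tendsto_of_tendsto_of_tendsto_of_le_of_le tendsto_const_nhds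
        (tendstoInMeasure_iff_dist.1 (hV a a) (V a a / 2) (by linarith)) (fun _ => zero_le)
        fun n => measure_mono (Set.ofPred_subset_ofPred.2 fun ω hω => ?_)
      rw [Real.dist_eq, abs_sub_comm]
      exact le_trans (by linarith) (le_abs_self _)
  have hsum : Tendsto (fun n => (∑ a, ∑ b, P {ω | e ≤ dist (inputCov σα σb (X n ω) a b) (V a b)}) +
      ∑ a, (P {ω | inputCov σα σb (X n ω) a a < V a a / 2} +
        P {ω | 2 * V a a < inputCov σα σb (X n ω) a a})) atTop (𝓝 0) := by
    have := (tendsto_finsetSum Finset.univ fun a _ => tendsto_finsetSum Finset.univ fun b _ =>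
      h1 a b).add (tendsto_finsetSum Finset.univ fun a _ => (h2 a).add (hV2 a))
    simpa using this
  refine tendsto_of_tendsto_of_tendsto_of_le_of_le tendsto_const_nhds hsum (fun _ => zero_le)
    fun n => ?_
  have hsub : {ω | X n ω ∉ closeInputs (m n) σα σb V e} ⊆
      (⋃ a, ⋃ b, {ω | e ≤ dist (inputCov σα σb (X n ω) a b) (V a b)}) ∪
      ⋃ a, ({ω | inputCov σα σb (X n ω) a a < V a a / 2} ∪
        {ω | 2 * V a a < inputCov σα σb (X n ω) a a}) := by
    intro ω hω
    by_contra hcon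
    simp only [Set.mem_union, Set.mem_iUnion, Set.mem_ofPred_eq, not_or, not_exists, not_lt,
      not_le, Real.dist_eq] at hcon
    exact hω ⟨fun a b => (hcon.1 a b).le, hcon.2⟩
  refine (measure_mono hsub).trans ((measure_union_le _ _).trans (add_le_add ?_ ?_))
  · refine (measure_iUnion_fintype_le _ _).trans (Finset.sum_le_sum fun a _ => ?_)
    exact measure_iUnion_fintype_le _ _
  · refine (measure_iUnion_fintype_le _ _).trans (Finset.sum_le_sum fun a _ => ?_)
    exact measure_union_le _ _

-- The lower bound `δ` on row norms is fixed once, while the closeness `e` stays free to be refined.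
omit [IsProbabilityMeasure P] in
theorem exists_tendsto_compl_goodConditions
    (H : ∀ n, IsRandomLayer P σα σb (X n) (C n) (A n) (b n))
    (hγ : 0 < γ) (hN : Tendsto N atTop atTop)
    (hr : Tendsto (fun n => (r n : ℝ) / N n) atTop (𝓝 γ))
    (hV : ∀ a b, TendstoInMeasure P (fun n ω => inputCov σα σb (X n ω) a b) atTop fun _ => V a b)
    (hV2 : ∀ a, Tendsto (fun n => P {ω | 2 * V a a < inputCov σα σb (X n ω) a a}) atTop (𝓝 0)) :
    ∃ δ, 0 < δ ∧ δ ≤ 1 ∧ ∀ e, 0 < e → Tendsto (fun n =>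
      P {ω | (X n ω, C n ω) ∉ goodConditions (m n) (N n) (r n) σα σb V δ e}) atTop (𝓝 0) := by
  obtain ⟨δ, hδ, hδ1, h⟩ := exists_tendsto_compl_balancedFrames hγ hN hr fun n => (H n).law_C
  refine ⟨δ, hδ, hδ1, fun e he => ?_⟩
  have hsum := (tendsto_compl_closeInputs hV hV2 he).add (h e he)
  rw [add_zero] at hsum
  refine tendsto_of_tendsto_of_tendsto_of_le_of_le tendsto_const_nhds hsum (fun _ => zero_le)
    fun n => ?_
  simp only
  rw [Measure.map_apply (H n).measurable_C (measurableSet_balancedFrames _ _ _ _).compl]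
  refine (measure_mono fun ω hω => ?_).trans (measure_union_le _ _)
  by_contra hcon
  simp only [Set.mem_union, not_or] at hcon
  exact hω ⟨not_not.1 hcon.1, not_not.1 hcon.2⟩

/-- If a nonnegative function of the layer has small conditional mean under good conditions, it is
small in probability. -/
theorem tendsto_measure_ge_of_lintegral_le
    (H : ∀ n, IsRandomLayer P σα σb (X n) (C n) (A n) (b n)) {δ : ℝ}
    (hgood : ∀ e, 0 < e → Tendsto (fun n =>
      P {ω | (X n ω, C n ω) ∉ goodConditions (m n) (N n) (r n) σα σb V δ e}) atTop (𝓝 0))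
    {F : (n : ℕ) → ((Fin 2 → Fin (m n) → ℝ) × Matrix (Fin (N n)) (Fin (r n)) ℝ) →
      (Matrix (Fin (r n)) (Fin (m n)) ℝ × (Fin (r n) → ℝ)) → ENNReal}
    (hF : ∀ n, Measurable (Function.uncurry (F n)))
    (hle : ∀ η : ℝ, 0 < η → ∃ e, 0 < e ∧ ∀ᶠ n in atTop,
      ∀ u ∈ goodConditions (m n) (N n) (r n) σα σb V δ e,
        ∫⁻ ω, F n u (A n ω, b n ω) ∂P ≤ ENNReal.ofReal η)
    {ε : ℝ} (hε : 0 < ε) :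
    Tendsto (fun n => P {ω | ENNReal.ofReal ε ≤ F n (X n ω, C n ω) (A n ω, b n ω)}) atTop (𝓝 0) := by
  rw [ENNReal.tendsto_nhds_zero]
  intro κ hκ
  obtain ⟨κ', hκ'0, hκ'⟩ := ENNReal.exists_ofReal_le hκ
  -- Markov's inequality divides by `ε`, leaving `κ' / 2`; the other half pays for bad conditions.
  obtain ⟨e, he, hev⟩ := hle (ε * (κ' / 2)) (by positivity)
  filter_upwards [hev, (ENNReal.tendsto_nhds_zero.1 (hgood e he)) (ENNReal.ofReal (κ' / 2))
    (ENNReal.ofReal_pos.2 (by positivity))] with n hn hn'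
  have hmark := (H n).indep.measure_ge_le_add_div
    ((H n).measurable_X.prodMk (H n).measurable_C)
    ((H n).gaussian.measurable_A.prodMk (H n).gaussian.measurable_b) (hF n)
    ((measurableSet_closeInputs _ _ _ _ _).prod (measurableSet_balancedFrames _ _ _ _))
    (ENNReal.ofReal_pos.2 hε).ne' ENNReal.ofReal_ne_top hn
  have h1 : ENNReal.ofReal (ε * (κ' / 2)) / ENNReal.ofReal ε = ENNReal.ofReal (κ' / 2) := by
    rw [← ENNReal.ofReal_div_of_pos hε, mul_div_cancel_left₀ _ hε.ne']
  rw [h1] at hmark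
  refine hmark.trans ((add_le_add_left hn' _).trans ?_)
  rw [← ENNReal.ofReal_add (by positivity) (by positivity)]
  simpa using hκ'

/-- The limit covariances form a positive semidefinite matrix. -/
theorem covForm_nonneg_of_tendstoInMeasure
    (hV : ∀ a b, TendstoInMeasure P (fun n ω => inputCov σα σb (X n ω) a b) atTop fun _ => V a b)
    (a b : Fin 2) (s t : ℝ) : 0 ≤ covForm V a b s t := by
  have h : TendstoInMeasure P (fun n ω => covForm (inputCov σα σb (X n ω)) a b s t) atTop
      fun _ => covForm V a b s t := by
    have h1 := TendstoInMeasure.map₂_const (Φ := fun x y => s ^ 2 * x + 2 * s * t * y) (hV a a)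
      (hV a b) (by simp only [Function.uncurry_def]; fun_prop)
    exact TendstoInMeasure.map₂_const (Φ := fun x y => x + t ^ 2 * y) h1
      (hV b b) (by simp only [Function.uncurry_def]; fun_prop)
  -- Along an almost surely convergent subsequence, the limit is a pointwise limit of nonnegative
  -- numbers.
  obtain ⟨ns, -, hns⟩ := h.exists_seq_tendsto_ae
  obtain ⟨ω, hω⟩ := hns.exists
  exact ge_of_tendsto' hω fun n => covForm_inputCov_nonneg _ _ _ _ _ _ _

/-- Lengths and covariances of the preactivation of a layer converge in probability. -/
theorem tendstoInMeasure_layer_overlap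
    (H : ∀ n, IsRandomLayer P σα σb (X n) (C n) (A n) (b n))
    (hγ : 0 < γ) (hN : Tendsto N atTop atTop)
    (hr : Tendsto (fun n => (r n : ℝ) / N n) atTop (𝓝 γ))
    (hV : ∀ a b, TendstoInMeasure P (fun n ω => inputCov σα σb (X n ω) a b) atTop fun _ => V a b)
    (hV2 : ∀ a, Tendsto (fun n => P {ω | 2 * V a a < inputCov σα σb (X n ω) a a}) atTop (𝓝 0))
    (a a' : Fin 2) :
    TendstoInMeasure P (fun n ω =>
      (∑ i, layerPreactivation (X n ω, C n ω) (A n ω, b n ω) a i *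
        layerPreactivation (X n ω, C n ω) (A n ω, b n ω) a' i) / (N n : ℝ)) atTop
      fun _ => γ * V a a' := by
  obtain ⟨δ, hδ, hδ1, hgood⟩ := exists_tendsto_compl_goodConditions H hγ hN hr hV hV2
  have hNR : Tendsto (fun n => (N n : ℝ)) atTop atTop := tendsto_natCast_atTop_atTop.comp hN
  have hnorm : ∀ s t : ℝ, TendstoInMeasure P (fun n ω => (N n : ℝ)⁻¹ *
      ‖affineImage (A n ω) (b n ω) (s • X n ω a + t • X n ω a') (s + t)‖ ^ 2) atTop
      fun _ => γ * covForm V a a' s t := fun s t => by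
    have hdev : TendstoInMeasure P (fun n ω => (N n : ℝ)⁻¹ *
        ‖affineImage (A n ω) (b n ω) (s • X n ω a + t • X n ω a') (s + t)‖ ^ 2 -
        (N n : ℝ)⁻¹ * (r n * covForm (inputCov σα σb (X n ω)) a a' s t)) atTop fun _ => (0 : ℝ) := by
      rw [tendstoInMeasure_iff_dist]
      intro ε hε
      have hcov : ∀ n, Measurable fun p : ((Fin 2 → Fin (m n) → ℝ) ×
          Matrix (Fin (N n)) (Fin (r n)) ℝ) × (Matrix (Fin (r n)) (Fin (m n)) ℝ × (Fin (r n) → ℝ)) =>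
          covForm (inputCov σα σb p.1.1) a a' s t := fun n => by
        unfold covForm inputCov; fun_prop
      have h1 := tendsto_measure_ge_of_lintegral_le (V := V) H hgood
        (F := fun n u w => ENNReal.ofReal (((N n : ℝ)⁻¹ *
          ‖affineImage w.1 w.2 (s • u.1 a + t • u.1 a') (s + t)‖ ^ 2 -
          (N n : ℝ)⁻¹ * (r n * covForm (inputCov σα σb u.1) a a' s t)) ^ 2))
        (fun n => by
          have h2 := measurable_affineImage_comb (N := N n) (r := r n) (m := m n) a a' s t
          have h3 := hcov n
          simp only [Function.uncurry_def]
          fun_prop)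
        (fun η hη => by
          -- Only boundedness of `τ` is needed, so closeness `1` suffices. With `r ≤ N` the
          -- conditional variance is then at most `B / N`.
          refine ⟨1, one_pos, ?_⟩
          set B : ℝ := (covForm V a a' s t + (|s| + |t|) ^ 2 * 1) ^ 2 * sqVariance with hB
          have hlim : Tendsto (fun n => B / (N n : ℝ)) atTop (𝓝 0) :=
            tendsto_const_nhds.div_atTop hNR
          filter_upwards [hlim.eventually (gt_mem_nhds hη), hNR.eventually_gt_atTop 0] with n hn hN0
          intro u hu
          rw [(H n).gaussian.lintegral_norm_sq_sub_le _ _ _ (covForm_inputCov σα σb u.1 a a' s t)]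
          refine ENNReal.ofReal_le_ofReal (le_trans ?_ hn.le)
          set τ := covForm (inputCov σα σb u.1) a a' s t
          have hτ0 : 0 ≤ τ := covForm_inputCov_nonneg _ _ _ _ _ _ _
          have hτ1 : τ ≤ covForm V a a' s t + (|s| + |t|) ^ 2 * 1 := by
            have := (abs_le.1 (abs_covForm_sub_le hu.1.1 a a' s t)).2
            linarith
          have hrN : (r n : ℝ) ≤ N n := card_le_of_orthonormal hu.2.1
          have hκ := sqVariance_nonneg
          rw [hB]
          calc ((N n : ℝ)⁻¹) ^ 2 * τ ^ 2 * (sqVariance * r n)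
              ≤ ((N n : ℝ)⁻¹) ^ 2 * (covForm V a a' s t + (|s| + |t|) ^ 2 * 1) ^ 2 *
                  (sqVariance * N n) := by gcongr
            _ = _ := by field_simp)
        (ε := ε ^ 2) (by positivity)
      refine tendsto_of_tendsto_of_tendsto_of_le_of_le tendsto_const_nhds h1 (fun _ => zero_le)
        fun n => measure_mono (Set.ofPred_subset_ofPred.2 fun ω hω => ?_)
      refine ENNReal.ofReal_le_ofReal ?_
      rw [Real.dist_eq, sub_zero] at hω
      rw [← sq_abs (_ - _)]
      gcongr
    have hcovlim : TendstoInMeasure P (fun n ω => covForm (inputCov σα σb (X n ω)) a a' s t) atTop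
        fun _ => covForm V a a' s t := by
      have h1 := TendstoInMeasure.map₂_const (Φ := fun x y => s ^ 2 * x + 2 * s * t * y) (hV a a)
        (hV a a') (by simp only [Function.uncurry_def]; fun_prop)
      exact TendstoInMeasure.map₂_const (Φ := fun x y => x + t ^ 2 * y) h1
        (hV a' a') (by simp only [Function.uncurry_def]; fun_prop)
    have hprod := TendstoInMeasure.map₂_const (Φ := fun x y => x * y)
      (tendstoInMeasure_of_tendsto_const (μ := P) hr) hcovlim
      (by simp only [Function.uncurry_def]; fun_prop)
    have hfin := TendstoInMeasure.map₂_const (Φ := fun x y => x + y) hdev hprod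
      (by simp only [Function.uncurry_def]; fun_prop)
    rw [zero_add] at hfin
    refine hfin.congr_left fun n => Eventually.of_forall fun ω => ?_
    simp only
    ring
  have hcomb := TendstoInMeasure.map₂_const (Φ := fun x y => (x - y) / 4) (hnorm 1 1) (hnorm 1 (-1))
    (by simp only [Function.uncurry_def]; fun_prop)
  have hval : (γ * covForm V a a' 1 1 - γ * covForm V a a' 1 (-1)) / 4 = γ * V a a' := by
    simp only [covForm]; ring
  rw [hval] at hcomb
  refine hcomb.congr_left fun n => ?_
  have horth : ∀ᵐ ω ∂P, (C n ω)ᵀ * C n ω = 1 :=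
    ae_of_ae_map (H n).measurable_C.aemeasurable (H n).law_C.orthonormal_columns
  filter_upwards [horth] with ω hω
  rw [sum_layerPreactivation_mul (X n ω, C n ω) (A n ω, b n ω) hω]
  ring

end LayerLimit

/-! ### The Gaussian pair of the covariance map -/

section GaussianPair

theorem sq_le_mul_of_covForm_nonneg {q : Fin 2 → Fin 2 → ℝ} {a b : Fin 2}
    (h : ∀ s t, 0 ≤ covForm q a b s t) : q a b ^ 2 ≤ q a a * q b b := by
  have h1 := discrim_le_zero (a := q a a) (b := 2 * q a b) (c := q b b) fun s => by
    have := h s 1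
    simp only [covForm] at this
    nlinarith
  simp only [discrim] at h1
  nlinarith

theorem covForm_self_nonneg {q : Fin 2 → Fin 2 → ℝ} {a b : Fin 2}
    (h : ∀ s t, 0 ≤ covForm q a b s t) : 0 ≤ q a a ∧ 0 ≤ q b b :=
  ⟨by simpa [covForm] using h 1 0, by simpa [covForm] using h 0 1⟩

theorem abs_corr_le_one {q₁₂ q₁₁ q₂₂ : ℝ} (h : q₁₂ ^ 2 ≤ q₁₁ * q₂₂) : |corr q₁₂ q₁₁ q₂₂| ≤ 1 := by
  rw [corr, abs_div, abs_of_nonneg (Real.sqrt_nonneg _)]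
  exact div_le_one_of_le₀ (Real.abs_le_sqrt h) (Real.sqrt_nonneg _)

theorem sqrt_mul_sqrt_mul_corr {q₁₂ q₁₁ q₂₂ : ℝ} (h₁ : 0 ≤ q₁₁) (h : q₁₂ ^ 2 ≤ q₁₁ * q₂₂) :
    Real.sqrt q₁₁ * Real.sqrt q₂₂ * corr q₁₂ q₁₁ q₂₂ = q₁₂ := by
  rw [← Real.sqrt_mul h₁, corr]
  rcases eq_or_ne (Real.sqrt (q₁₁ * q₂₂)) 0 with h0 | h0
  -- In the degenerate case the correlation takes its default value, and the Cauchy–Schwarz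
  -- hypothesis forces `q₁₂ = 0`.
  · have h2 := Real.abs_le_sqrt h
    rw [h0] at h2
    rw [h0, zero_mul]
    exact (abs_nonpos_iff.1 h2).symm
  · field_simp

/-- A linear combination of the coordinates of the Gaussian pair. -/
theorem map_comb_gaussU {q : Fin 2 → Fin 2 → ℝ} {a b : Fin 2}
    (h : ∀ s t, 0 ≤ covForm q a b s t) (s t : ℝ) :
    (stdGaussian1.prod stdGaussian1).map (fun z => s * gaussU₁ (q a a) z +
      t * gaussU₂ (q b b) (corr (q a b) (q a a) (q b b)) z) =
      gaussianReal 0 (covForm q a b s t).toNNReal := by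
  set c := corr (q a b) (q a a) (q b b)
  -- `α` and `β` are the coefficients of the two independent standard Gaussian coordinates; `α² +
  -- β²` turns out to be `covForm q a b s t`.
  set α := s * Real.sqrt (q a a) + t * (Real.sqrt (q b b) * c) with hα
  set β := t * (Real.sqrt (q b b) * Real.sqrt (1 - c ^ 2)) with hβ
  have hsq := sq_le_mul_of_covForm_nonneg h
  obtain ⟨ha, hb⟩ := covForm_self_nonneg h
  have hc : c ^ 2 ≤ 1 := (sq_le_one_iff_abs_le_one c).2 (abs_corr_le_one hsq)
  have heq : (fun z : ℝ × ℝ => s * gaussU₁ (q a a) z + t * gaussU₂ (q b b) c z) =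
      (fun z => α * z.1) + fun z => β * z.2 := by
    ext z
    simp only [gaussU₁, gaussU₂, hα, hβ, Pi.add_apply]
    ring
  have hind : IndepFun (fun z : ℝ × ℝ => α * z.1) (fun z => β * z.2)
      (stdGaussian1.prod stdGaussian1) :=
    indepFun_prod (X := fun x => α * x) (Y := fun x => β * x) (by fun_prop) (by fun_prop)
  have h1 : (stdGaussian1.prod stdGaussian1).map (fun z : ℝ × ℝ => α * z.1) =
      gaussianReal 0 (α ^ 2).toNNReal := by
    have := Measure.map_map (μ := stdGaussian1.prod stdGaussian1) (g := fun x : ℝ => α * x)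
      (f := Prod.fst) (by fun_prop) measurable_fst
    rw [Measure.map_fst_prod, measure_univ, one_smul, gaussianReal_map_const_mul] at this
    rw [mul_zero] at this
    rw [show (fun z : ℝ × ℝ => α * z.1) = (fun x => α * x) ∘ Prod.fst from rfl, ← this]
    simp [Real.toNNReal_of_nonneg (sq_nonneg α)]
  have h2 : (stdGaussian1.prod stdGaussian1).map (fun z : ℝ × ℝ => β * z.2) =
      gaussianReal 0 (β ^ 2).toNNReal := by
    have := Measure.map_map (μ := stdGaussian1.prod stdGaussian1) (g := fun x : ℝ => β * x)
      (f := Prod.snd) (by fun_prop) measurable_snd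
    rw [Measure.map_snd_prod, measure_univ, one_smul, gaussianReal_map_const_mul] at this
    rw [mul_zero] at this
    rw [show (fun z : ℝ × ℝ => β * z.2) = (fun x => β * x) ∘ Prod.snd from rfl, ← this]
    simp [Real.toNNReal_of_nonneg (sq_nonneg β)]
  rw [heq, gaussianReal_add_gaussianReal_of_indepFun hind h1 h2, add_zero,
    ← Real.toNNReal_add (sq_nonneg _) (sq_nonneg _)]
  congr 2
  have h3 := sqrt_mul_sqrt_mul_corr ha hsq
  have h4 := Real.sq_sqrt ha
  have h5 := Real.sq_sqrt hb
  have h6 := Real.sq_sqrt (sub_nonneg.2 hc)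
  change Real.sqrt (q a a) * Real.sqrt (q b b) * c = q a b at h3
  simp only [hα, hβ, covForm]
  rw [← h3, mul_pow, mul_pow, h6, h5]
  linear_combination s ^ 2 * h4 + t ^ 2 * c ^ 2 * h5

theorem map_gaussU₁ {q : Fin 2 → Fin 2 → ℝ} {a b : Fin 2}
    (h : ∀ s t, 0 ≤ covForm q a b s t) :
    (stdGaussian1.prod stdGaussian1).map (gaussU₁ (q a a)) = gaussianReal 0 (q a a).toNNReal := by
  have := map_comb_gaussU h 1 0
  simpa [covForm] using this

theorem map_gaussU₂ {q : Fin 2 → Fin 2 → ℝ} {a b : Fin 2}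
    (h : ∀ s t, 0 ≤ covForm q a b s t) :
    (stdGaussian1.prod stdGaussian1).map (gaussU₂ (q b b) (corr (q a b) (q a a) (q b b))) =
      gaussianReal 0 (q b b).toNNReal := by
  have := map_comb_gaussU h 0 1
  simpa [covForm] using this

theorem measurable_gaussU₁ (q : ℝ) : Measurable (gaussU₁ q) := by unfold gaussU₁; fun_prop

theorem measurable_gaussU₂ (q c : ℝ) : Measurable (gaussU₂ q c) := by unfold gaussU₂; fun_prop

theorem expWave_mul_expWave (s t u v : ℝ) :
    expWave s u * expWave t v = expWave 1 (s * u + t * v) := by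
  simp only [expWave, ← Complex.exp_add]
  congr 1
  push_cast
  ring

theorem integral_expWave_mul_gaussU {q : Fin 2 → Fin 2 → ℝ} {a b : Fin 2}
    (h : ∀ s t, 0 ≤ covForm q a b s t) (s t : ℝ) :
    ∫ z, expWave s (gaussU₁ (q a a) z) *
      expWave t (gaussU₂ (q b b) (corr (q a b) (q a a) (q b b)) z) ∂(stdGaussian1.prod stdGaussian1)
      = ((Real.exp (-(covForm q a b s t / 2)) : ℝ) : ℂ) := by
  have h1 := measurable_gaussU₁ (q a a)
  have h2 := measurable_gaussU₂ (q b b) (corr (q a b) (q a a) (q b b))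
  have h3 := charFun_gaussianReal (μ := 0) (v := (covForm q a b s t).toNNReal) 1
  rw [charFun_apply_real, ← map_comb_gaussU h s t,
    integral_map (show Measurable _ by fun_prop).aemeasurable (by fun_prop)] at h3
  simp_rw [expWave_mul_expWave]
  refine Eq.trans ?_ (h3.trans ?_)
  · refine integral_congr_ae (Eventually.of_forall fun z => ?_)
    simp [expWave]
  · rw [Real.coe_toNNReal _ (h s t)]
    push_cast
    congr 1
    ring

theorem memLp_gaussianReal_of_integrable {φ : ℝ → ℝ} (hφ : Measurable φ)
    (hφ2 : ∀ s : ℝ, Integrable (fun z => φ (s * z) ^ 2) stdGaussian1) (v : NNReal) :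
    MemLp φ 2 (gaussianReal 0 v) := by
  have h1 : (stdGaussian1).map (fun z => Real.sqrt v * z) = gaussianReal 0 v := by
    rw [gaussianReal_map_const_mul]
    congr 1
    · simp
    · ext
      simp
  rw [← h1, memLp_map_measure_iff (by fun_prop) (by fun_prop)]
  exact (memLp_two_iff_integrable_sq
    (hφ.comp (measurable_const.mul measurable_id)).aestronglyMeasurable).2 (hφ2 (Real.sqrt v))

/-- The integrand of the covariance map is integrable. -/
theorem integrable_mul_gaussU {φ : ℝ → ℝ} (hφ : Measurable φ)
    (hφ2 : ∀ s : ℝ, Integrable (fun z => φ (s * z) ^ 2) stdGaussian1)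
    {q : Fin 2 → Fin 2 → ℝ} {a b : Fin 2} (h : ∀ s t, 0 ≤ covForm q a b s t) :
    Integrable (fun z => φ (gaussU₁ (q a a) z) *
      φ (gaussU₂ (q b b) (corr (q a b) (q a a) (q b b)) z)) (stdGaussian1.prod stdGaussian1) := by
  have h1 : MemLp (fun z => φ (gaussU₁ (q a a) z)) 2 (stdGaussian1.prod stdGaussian1) := by
    have := memLp_gaussianReal_of_integrable hφ hφ2 (q a a).toNNReal
    rw [← map_gaussU₁ h] at this
    exact this.comp_of_map (measurable_gaussU₁ _).aemeasurable
  have h2 : MemLp (fun z => φ (gaussU₂ (q b b) (corr (q a b) (q a a) (q b b)) z)) 2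
      (stdGaussian1.prod stdGaussian1) := by
    have := memLp_gaussianReal_of_integrable hφ hφ2 (q b b).toNNReal
    rw [← map_gaussU₂ h] at this
    exact this.comp_of_map (measurable_gaussU₂ _ _).aemeasurable
  exact h1.integrable_mul h2

end GaussianPair

/-! ### Averages over the units: domination and empirical characteristic functions -/

section LayerProducts

variable {Ω : Type*} [MeasurableSpace Ω] {P : Measure Ω} [IsProbabilityMeasure P]

/-- Functions of the preactivation have a conditional mean controlled by a Gaussian integral. -/
theorem lintegral_average_le {m N r : ℕ} {σα σb : ℝ} {X : Ω → Fin 2 → Fin m → ℝ}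
    {C : Ω → Matrix (Fin N) (Fin r) ℝ} {A : Ω → Matrix (Fin r) (Fin m) ℝ} {b : Ω → Fin r → ℝ}
    (H : IsRandomLayer P σα σb X C A b) {V : Fin 2 → Fin 2 → ℝ} {δ δ' e : ℝ}
    (hδ' : 0 < δ') (hδ : 4 * δ' ≤ δ) (hδ1 : δ' ≤ 1)
    {u : (Fin 2 → Fin m → ℝ) × Matrix (Fin N) (Fin r) ℝ}
    (hu : u ∈ goodConditions m N r σα σb V δ e) (a : Fin 2) {Φ : ℝ → ENNReal}
    (hΦ : Measurable Φ) :
    ∫⁻ ω, (N : ENNReal)⁻¹ * ∑ i, Φ (layerPreactivation u (A ω, b ω) a i) ∂P ≤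
      ENNReal.ofReal (Real.sqrt δ')⁻¹ * ∫⁻ x, Φ x ∂(gaussianReal 0 (2 * V a a).toNNReal) := by
  have hAb : Measurable fun ω => (A ω, b ω) :=
    H.gaussian.measurable_A.prodMk H.gaussian.measurable_b
  have hm : ∀ i, Measurable fun ω => layerPreactivation u (A ω, b ω) a i := fun i => by
    have h0 : Measurable fun ω => (u, (A ω, b ω)) := measurable_const.prodMk hAb
    exact (measurable_layerPreactivation a i).comp h0
  obtain ⟨⟨-, hV⟩, horth, hrow, -⟩ := hu
  have hτ := covForm_inputCov σα σb u.1 a a 1 0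
  simp only [one_smul, zero_smul, add_zero] at hτ
  have hτ' : covForm (inputCov σα σb u.1) a a 1 0 = inputCov σα σb u.1 a a := by simp [covForm]
  rw [hτ'] at hτ
  have hτ0 := inputCov_self_nonneg σα σb u.1 a
  have hV0 : 0 ≤ V a a := by linarith [(hV a).1, (hV a).2]
  have hΦm : ∀ i, Measurable fun ω => Φ (layerPreactivation u (A ω, b ω) a i) :=
    fun i => hΦ.comp (hm i)
  have hterm : ∀ i, ∫⁻ ω, Φ (layerPreactivation u (A ω, b ω) a i) ∂P ≤
      ENNReal.ofReal (Real.sqrt δ')⁻¹ * ∫⁻ x, Φ x ∂(gaussianReal 0 (2 * V a a).toNNReal) := by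
    intro i
    have h1 := rowNormSq_nonneg u.2 i
    have h2 := rowNormSq_le_one horth i
    have h3 := hrow i
    -- The unit has variance `τ ρᵢ` with `δ ≤ ρᵢ ≤ 1` and `V a a / 2 ≤ τ ≤ 2 V a a`. It thus lies
    -- between `δ' * (2 V a a)` and `2 V a a`, which is where `4 δ' ≤ δ` is used.
    refine H.gaussian.lintegral_mulVec_le (u.1 a) 1 hτ u.2 i hδ' hδ1 ?_ ?_ hΦ
    · rw [Real.coe_toNNReal _ (by positivity)]
      nlinarith [(hV a).2]
    · rw [Real.coe_toNNReal _ (by positivity)]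
      calc δ' * (2 * V a a) = (4 * δ') * (V a a / 2) := by ring
        _ ≤ rowNormSq u.2 i * inputCov σα σb u.1 a a :=
            mul_le_mul (hδ.trans h3) (hV a).1 (by positivity) h1
        _ = _ := mul_comm _ _
  rw [lintegral_const_mul _ (Finset.measurable_fun_sum _ fun i _ => hΦm i),
    lintegral_finsetSum _ fun i _ => hΦm i]
  rcases Nat.eq_zero_or_pos N with hN | hN
  · subst hN; simp
  calc (N : ENNReal)⁻¹ * ∑ i, ∫⁻ ω, Φ (layerPreactivation u (A ω, b ω) a i) ∂P
      ≤ (N : ENNReal)⁻¹ * ∑ _i : Fin N, (ENNReal.ofReal (Real.sqrt δ')⁻¹ *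
          ∫⁻ x, Φ x ∂(gaussianReal 0 (2 * V a a).toNNReal)) := by
        gcongr with i
        exact hterm i
    _ = _ := by
        rw [Finset.sum_const, Finset.card_univ, Fintype.card_fin, nsmul_eq_mul, ← mul_assoc,
          ENNReal.inv_mul_cancel (by exact_mod_cast hN.ne') (by simp), one_mul]

variable {m N r : ℕ → ℕ} {σα σb γ : ℝ}
  {X : (n : ℕ) → Ω → Fin 2 → Fin (m n) → ℝ}
  {C : (n : ℕ) → Ω → Matrix (Fin (N n)) (Fin (r n)) ℝ}
  {A : (n : ℕ) → Ω → Matrix (Fin (r n)) (Fin (m n)) ℝ} {b : (n : ℕ) → Ω → Fin (r n) → ℝ}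
  {V : Fin 2 → Fin 2 → ℝ}

/-- The joint empirical characteristic function of the preactivations converges in probability. -/
theorem tendstoInMeasure_layer_expWave
    (H : ∀ n, IsRandomLayer P σα σb (X n) (C n) (A n) (b n))
    (hγ : 0 < γ) (hN : Tendsto N atTop atTop)
    (hr : Tendsto (fun n => (r n : ℝ) / N n) atTop (𝓝 γ))
    (hV : ∀ a b, TendstoInMeasure P (fun n ω => inputCov σα σb (X n ω) a b) atTop fun _ => V a b)
    {δ : ℝ} (hgood : ∀ e, 0 < e → Tendsto (fun n =>
      P {ω | (X n ω, C n ω) ∉ goodConditions (m n) (N n) (r n) σα σb V δ e}) atTop (𝓝 0))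
    (a a' : Fin 2) (s t : ℝ) :
    TendstoInMeasure P (fun n ω =>
      (∑ i, expWave s (layerPreactivation (X n ω, C n ω) (A n ω, b n ω) a i) *
        expWave t (layerPreactivation (X n ω, C n ω) (A n ω, b n ω) a' i)) / (N n : ℂ)) atTop
      fun _ => ((Real.exp (-(γ * covForm V a a' s t / 2)) : ℝ) : ℂ) := by
  have hNR : Tendsto (fun n => (N n : ℝ)) atTop atTop := tendsto_natCast_atTop_atTop.comp hN
  have hT0 : 0 ≤ covForm V a a' s t := covForm_nonneg_of_tendstoInMeasure hV a a' s t
  set T := covForm V a a' s t with hT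
  set M := (|s| + |t|) ^ 2 with hM
  have hM0 : 0 ≤ M := by positivity
  rw [tendstoInMeasure_iff_dist]
  intro ε hε
  have hmeas : ∀ n, Measurable (Function.uncurry
      fun (u : (Fin 2 → Fin (m n) → ℝ) × Matrix (Fin (N n)) (Fin (r n)) ℝ)
        (w : Matrix (Fin (r n)) (Fin (m n)) ℝ × (Fin (r n) → ℝ)) =>
        ENNReal.ofReal (‖(∑ i, expWave s (layerPreactivation u w a i) *
          expWave t (layerPreactivation u w a' i)) / (N n : ℂ) -
            ((Real.exp (-(γ * T / 2)) : ℝ) : ℂ)‖ ^ 2)) := fun n => by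
    have h1 := fun i => measurable_layerPreactivation (m := m n) (N := N n) (r := r n) a i
    have h2 := fun i => measurable_layerPreactivation (m := m n) (N := N n) (r := r n) a' i
    have h3 : Measurable fun p : ((Fin 2 → Fin (m n) → ℝ) × Matrix (Fin (N n)) (Fin (r n)) ℝ) ×
        (Matrix (Fin (r n)) (Fin (m n)) ℝ × (Fin (r n) → ℝ)) =>
        ∑ i, expWave s (layerPreactivation p.1 p.2 a i) *
          expWave t (layerPreactivation p.1 p.2 a' i) :=
      Finset.measurable_fun_sum _ fun i _ => ((continuous_expWave s).measurable.comp (h1 i)).mul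
        ((continuous_expWave t).measurable.comp (h2 i))
    simp only [Function.uncurry_def]
    fun_prop
  have h1 := tendsto_measure_ge_of_lintegral_le H hgood hmeas (fun η hη => by
      -- All error terms turn out to be multiples of `e`, with total factor at most `2 (T + M) + M`;
      -- the `+ 1` keeps the denominator positive.
      set e := min 1 (η / (2 * (T + M) + M + 1)) with he
      have hep : 0 < e := lt_min one_pos (by positivity)
      have he1 : e ≤ 1 := min_le_left _ _
      have heη : e * (2 * (T + M) + M) ≤ η := by
        have h2 : e ≤ η / (2 * (T + M) + M + 1) := min_le_right _ _
        rw [le_div_iff₀ (by positivity)] at h2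
        nlinarith
      have hsqrt : Tendsto (fun n => 1 / Real.sqrt (N n)) atTop (𝓝 0) :=
        tendsto_const_nhds.div_atTop (Real.tendsto_sqrt_atTop.comp hNR)
      refine ⟨e, hep, ?_⟩
      filter_upwards [hsqrt.eventually (gt_mem_nhds hep), hNR.eventually_gt_atTop 0,
        Metric.tendsto_nhds.1 hr e hep, hN.eventually_gt_atTop 0] with n hn1 hn2 hn3 hn4
      intro u hu
      have hrN : (r n : ℝ) / N n ≤ 1 :=
        (div_le_one hn2).2 (card_le_of_orthonormal hu.2.1)
      set τ := covForm (inputCov σα σb u.1) a a' s t with hτ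
      have hτ0 : 0 ≤ τ := covForm_inputCov_nonneg _ _ _ _ _ _ _
      have hτT : |τ - T| ≤ M * e := abs_covForm_sub_le hu.1.1 a a' s t
      have hτM : τ ≤ T + M := by
        have := (abs_le.1 hτT).2
        nlinarith
      -- The product of the waves at frequencies `s` and `t` is one wave evaluated at a single
      -- affine image, so the bound for one vector gives the joint characteristic function.
      simp_rw [expWave_mul_expWave, ← comb_layerPreactivation]
      refine ((H n).gaussian.lintegral_expWave_sub_le _ _ (covForm_inputCov σα σb u.1 a a' s t)
        hu.2.1 hn4 (Real.exp_nonneg _) (Real.exp_le_one_iff.2 (neg_nonpos.2 (by positivity)))).trans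
        (ENNReal.ofReal_le_ofReal ?_)
      have h3 := sum_abs_exp_sub_le_of_mem_balancedFrames hu.2 hep.le hn4 hτ0 hT0 hγ.le
      rw [← hτ]
      have h4 : τ / Real.sqrt (N n) ≤ (T + M) * e := by
        rw [div_eq_mul_one_div]
        exact mul_le_mul hτM hn1.le (by positivity) (by positivity)
      have h5 : |r n / N n * τ - γ * T| ≤ e * (T + M) + M * e := by
        have h6 : (r n : ℝ) / N n * τ - γ * T =
            (r n / N n - γ) * T + r n / N n * (τ - T) := by ring
        rw [h6]
        refine (abs_add_le _ _).trans ?_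
        rw [abs_mul, abs_mul, abs_of_nonneg hT0, abs_of_nonneg (show 0 ≤ (r n : ℝ) / N n by positivity)]
        rw [Real.dist_eq] at hn3
        have h7 : |(r n : ℝ) / N n - γ| * T ≤ e * (T + M) :=
          mul_le_mul hn3.le (by linarith) hT0 hep.le
        have h8 : (r n : ℝ) / N n * |τ - T| ≤ 1 * (M * e) :=
          mul_le_mul hrN hτT (abs_nonneg _) zero_le_one
        linarith
      have h9 : τ * e ≤ (T + M) * e := mul_le_mul_of_nonneg_right hτM hep.le
      have h10 : 0 ≤ M * e := by positivity
      linarith) (ε := ε ^ 2) (by positivity)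
  refine tendsto_of_tendsto_of_tendsto_of_le_of_le tendsto_const_nhds h1 (fun _ => zero_le)
    fun n => measure_mono (Set.ofPred_subset_ofPred.2 fun ω hω => ?_)
  refine ENNReal.ofReal_le_ofReal ?_
  rw [dist_eq_norm] at hω
  gcongr

end LayerProducts

/-! ### Convergence of the averaged products of activations -/

section LayerProductLimit

variable {Ω : Type*} [MeasurableSpace Ω] {P : Measure Ω} [IsProbabilityMeasure P]
  {m N r : ℕ → ℕ} {σα σb γ : ℝ}
  {X : (n : ℕ) → Ω → Fin 2 → Fin (m n) → ℝ}
  {C : (n : ℕ) → Ω → Matrix (Fin (N n)) (Fin (r n)) ℝ}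
  {A : (n : ℕ) → Ω → Matrix (Fin (r n)) (Fin (m n)) ℝ} {b : (n : ℕ) → Ω → Fin (r n) → ℝ}
  {V : Fin 2 → Fin 2 → ℝ} {φ : ℝ → ℝ}

/-- The limit of the average products of the activations in a layer. -/
noncomputable def activationCov (φ : ℝ → ℝ) (q : Fin 2 → Fin 2 → ℝ) (a a' : Fin 2) : ℝ :=
  ∫ z, φ (gaussU₁ (q a a) z) * φ (gaussU₂ (q a' a') (corr (q a a') (q a a) (q a' a')) z)
    ∂(stdGaussian1.prod stdGaussian1)

theorem enorm_average_sub_le {ι : Type*} [Fintype ι] (k : ℕ) (f g : ι → ℂ) {Φ : ι → ENNReal}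
    (h : ∀ i, ‖f i - g i‖ₑ ≤ Φ i) :
    ‖(∑ i, f i) / (k : ℂ) - (∑ i, g i) / (k : ℂ)‖ₑ ≤ (k : ENNReal)⁻¹ * ∑ i, Φ i := by
  rcases Nat.eq_zero_or_pos k with rfl | hk
  · simp
  have hk0 : (k : ℂ) ≠ 0 := by exact_mod_cast hk.ne'
  rw [← sub_div, ← Finset.sum_sub_distrib, div_eq_inv_mul, enorm_mul, enorm_inv hk0]
  have hkk : ‖(k : ℂ)‖ₑ = (k : ENNReal) := by
    rw [← ofReal_norm, Complex.norm_natCast, ENNReal.ofReal_natCast]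
  rw [hkk]
  gcongr
  exact (enorm_sum_le _ _).trans (Finset.sum_le_sum fun i _ => h i)

theorem finsupp_sum_mul_sum (c : ℝ →₀ ℂ) (f g : ℝ → ℂ) :
    (c.sum fun s a => a * f s) * (c.sum fun s a => a * g s) =
      ∑ s ∈ c.support, ∑ t ∈ c.support, (c s * c t) * (f s * g t) := by
  rw [Finsupp.sum, Finsupp.sum, Finset.sum_mul_sum]
  exact Finset.sum_congr rfl fun s _ => Finset.sum_congr rfl fun t _ => by ring

omit [IsProbabilityMeasure P] in
/-- Sums of trigonometric polynomials over the units of a layer converge in probability. -/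
theorem tendstoInMeasure_trigPolynomial_mul {g : (n : ℕ) → Ω → Fin (N n) → ℝ}
    {g' : (n : ℕ) → Ω → Fin (N n) → ℝ} {L : ℝ → ℝ → ℂ}
    (h : ∀ s t, TendstoInMeasure P (fun n ω =>
      (∑ i, expWave s (g n ω i) * expWave t (g' n ω i)) / (N n : ℂ)) atTop fun _ => L s t)
    (c : ℝ →₀ ℂ) :
    TendstoInMeasure P (fun n ω => (∑ i, (c.sum fun s d => d * expWave s (g n ω i)) *
      (c.sum fun s d => d * expWave s (g' n ω i))) / (N n : ℂ)) atTop
      fun _ => ∑ s ∈ c.support, ∑ t ∈ c.support, (c s * c t) * L s t := by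
  have h1 : ∀ s t, TendstoInMeasure P (fun n ω => (c s * c t) *
      ((∑ i, expWave s (g n ω i) * expWave t (g' n ω i)) / (N n : ℂ))) atTop
      fun _ => (c s * c t) * L s t := fun s t =>
    TendstoInMeasure.map_const (Φ := fun x => (c s * c t) * x) (h s t) (by fun_prop)
  have h2 : TendstoInMeasure P (fun n ω => ∑ s ∈ c.support, ∑ t ∈ c.support, (c s * c t) *
      ((∑ i, expWave s (g n ω i) * expWave t (g' n ω i)) / (N n : ℂ))) atTop
      fun _ => ∑ s ∈ c.support, ∑ t ∈ c.support, (c s * c t) * L s t :=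
    TendstoInMeasure.finset_sum_const _ fun s _ =>
      TendstoInMeasure.finset_sum_const _ fun t _ => h1 s t
  refine h2.congr_left fun n => Eventually.of_forall fun ω => ?_
  simp only [finsupp_sum_mul_sum]
  rw [Finset.sum_comm (s := Finset.univ) (t := c.support), Finset.sum_div]
  refine Finset.sum_congr rfl fun s _ => ?_
  rw [Finset.sum_comm (s := Finset.univ) (t := c.support), Finset.sum_div]
  refine Finset.sum_congr rfl fun t _ => ?_
  rw [← Finset.mul_sum, mul_div_assoc]

/-- The error of approximating the limit covariance by that of a trigonometric polynomial. -/
theorem enorm_activationCov_sub_le (hφ : Measurable φ)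
    (hφ2 : ∀ s : ℝ, Integrable (fun z => φ (s * z) ^ 2) stdGaussian1)
    {q : Fin 2 → Fin 2 → ℝ} {a a' : Fin 2} (hq : ∀ s t, 0 ≤ covForm q a a' s t) {c : ℝ →₀ ℂ}
    {Φ : ℝ → ENNReal} (hΦm : Measurable Φ)
    (hΦ : ∀ u v, ‖((φ u * φ v : ℝ) : ℂ) - (c.sum fun s d => d * expWave s u) *
        (c.sum fun s d => d * expWave s v)‖ₑ ≤ Φ u + Φ v) :
    ‖((activationCov φ q a a' : ℝ) : ℂ) - ∑ s ∈ c.support, ∑ t ∈ c.support, (c s * c t) *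
      ((Real.exp (-(covForm q a a' s t / 2)) : ℝ) : ℂ)‖ₑ ≤
      ∫⁻ x, Φ x ∂(gaussianReal 0 (q a a).toNNReal) +
        ∫⁻ x, Φ x ∂(gaussianReal 0 (q a' a').toNNReal) := by
  have m1 := measurable_gaussU₁ (q a a)
  have m2 := measurable_gaussU₂ (q a' a') (corr (q a a') (q a a) (q a' a'))
  have hexp : ∀ s t, Integrable (fun z => (c s * c t) * (expWave s (gaussU₁ (q a a) z) *
      expWave t (gaussU₂ (q a' a') (corr (q a a') (q a a) (q a' a')) z)))
      (stdGaussian1.prod stdGaussian1) := fun s t => by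
    refine Integrable.const_mul (Integrable.of_bound ?_ 1 (Eventually.of_forall fun z => ?_)) _
    · exact (((continuous_expWave s).measurable.comp m1).mul
        ((continuous_expWave t).measurable.comp m2)).aestronglyMeasurable
    · rw [norm_mul, norm_expWave, norm_expWave, one_mul]
  have hsum : ∑ s ∈ c.support, ∑ t ∈ c.support, (c s * c t) *
      ((Real.exp (-(covForm q a a' s t / 2)) : ℝ) : ℂ) =
      ∫ z, (c.sum fun s d => d * expWave s (gaussU₁ (q a a) z)) *
        (c.sum fun s d => d * expWave s (gaussU₂ (q a' a') (corr (q a a') (q a a) (q a' a')) z))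
        ∂(stdGaussian1.prod stdGaussian1) := by
    simp_rw [finsupp_sum_mul_sum]
    rw [integral_finsetSum _ fun s _ => integrable_finsetSum _ fun t _ => hexp s t]
    refine Finset.sum_congr rfl fun s _ => ?_
    rw [integral_finsetSum _ fun t _ => hexp s t]
    refine Finset.sum_congr rfl fun t _ => ?_
    rw [integral_const_mul, integral_expWave_mul_gaussU hq]
  have hint := integrable_mul_gaussU hφ hφ2 hq
  have hint2 : Integrable (fun z => (c.sum fun s d => d * expWave s (gaussU₁ (q a a) z)) *
        (c.sum fun s d => d * expWave s (gaussU₂ (q a' a') (corr (q a a') (q a a) (q a' a')) z)))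
        (stdGaussian1.prod stdGaussian1) := by
    simp_rw [finsupp_sum_mul_sum]
    exact integrable_finsetSum _ fun s _ => integrable_finsetSum _ fun t _ => hexp s t
  have hintC : Integrable (fun z => ((φ (gaussU₁ (q a a) z) * φ (gaussU₂ (q a' a')
      (corr (q a a') (q a a) (q a' a')) z) : ℝ) : ℂ)) (stdGaussian1.prod stdGaussian1) :=
    hint.ofReal
  rw [hsum, activationCov, ← integral_complex_ofReal, ← integral_sub hintC hint2]
  refine (enorm_integral_le_lintegral_enorm _).trans ?_
  -- The error bound is a sum of functions of one variable, so only the marginals of the Gaussian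
  -- pair enter.
  refine (lintegral_mono fun z => hΦ _ _).trans ?_
  rw [lintegral_add_left (f := fun z => Φ (gaussU₁ (q a a) z)) (hΦm.comp m1), ← map_gaussU₁ hq, ← map_gaussU₂ hq,
    lintegral_map hΦm m1, lintegral_map hΦm m2]

/-- A Markov bound for averages over the units of a layer under good conditions. -/
theorem measure_ge_average_add_le {m N r : ℕ} {X : Ω → Fin 2 → Fin m → ℝ}
    {C : Ω → Matrix (Fin N) (Fin r) ℝ} {A : Ω → Matrix (Fin r) (Fin m) ℝ} {b : Ω → Fin r → ℝ}
    (H : IsRandomLayer P σα σb X C A b) {δ δ' e : ℝ}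
    (hδ' : 0 < δ') (hδ : 4 * δ' ≤ δ) (hδ1 : δ' ≤ 1) (a a' : Fin 2) {Φ : ℝ → ENNReal}
    (hΦ : Measurable Φ) {ε : ENNReal} (hε : ε ≠ 0) (hε' : ε ≠ ⊤) :
    P {ω | ε ≤ (N : ENNReal)⁻¹ * ∑ i, Φ (layerPreactivation (X ω, C ω) (A ω, b ω) a i) +
        (N : ENNReal)⁻¹ * ∑ i, Φ (layerPreactivation (X ω, C ω) (A ω, b ω) a' i)} ≤
      P {ω | (X ω, C ω) ∉ goodConditions m N r σα σb V δ e} +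
        ENNReal.ofReal (Real.sqrt δ')⁻¹ * (∫⁻ x, Φ x ∂(gaussianReal 0 (2 * V a a).toNNReal) +
          ∫⁻ x, Φ x ∂(gaussianReal 0 (2 * V a' a').toNNReal)) / ε := by
  have hFm : ∀ a, Measurable fun p : ((Fin 2 → Fin m → ℝ) × Matrix (Fin N) (Fin r) ℝ) ×
      (Matrix (Fin r) (Fin m) ℝ × (Fin r → ℝ)) =>
      (N : ENNReal)⁻¹ * ∑ i, Φ (layerPreactivation p.1 p.2 a i) := fun a =>
    (Finset.measurable_fun_sum _ fun i _ => hΦ.comp (measurable_layerPreactivation a i)).const_mul _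
  have hAb : Measurable fun ω => (A ω, b ω) :=
    H.gaussian.measurable_A.prodMk H.gaussian.measurable_b
  have hG : MeasurableSet (goodConditions m N r σα σb V δ e) :=
    (measurableSet_closeInputs _ _ _ _ _).prod (measurableSet_balancedFrames _ _ _ _)
  have hF : Measurable (Function.uncurry fun (u : (Fin 2 → Fin m → ℝ) × Matrix (Fin N) (Fin r) ℝ)
      (w : Matrix (Fin r) (Fin m) ℝ × (Fin r → ℝ)) =>
      (N : ENNReal)⁻¹ * ∑ i, Φ (layerPreactivation u w a i) +
        (N : ENNReal)⁻¹ * ∑ i, Φ (layerPreactivation u w a' i)) := (hFm a).add (hFm a')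
  refine H.indep.measure_ge_le_add_div (H.measurable_X.prodMk H.measurable_C) hAb hF hG
    hε hε' fun u hu => ?_
  have h0 : Measurable fun ω => (u, (A ω, b ω)) := measurable_const.prodMk hAb
  have hm : Measurable fun ω => (N : ENNReal)⁻¹ * ∑ i, Φ (layerPreactivation u (A ω, b ω) a i) :=
    (Finset.measurable_fun_sum _ fun i _ =>
      hΦ.comp ((measurable_layerPreactivation a i).comp h0)).const_mul _
  rw [lintegral_add_left hm, mul_add]
  exact add_le_add (lintegral_average_le H hδ' hδ hδ1 hu a hΦ)
    (lintegral_average_le H hδ' hδ hδ1 hu a' hΦ)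

/-- The average products of the activations in a layer converge in probability. -/
theorem tendstoInMeasure_layer_activation (hφ : Measurable φ)
    (hφ2 : ∀ s : ℝ, Integrable (fun z => φ (s * z) ^ 2) stdGaussian1)
    (H : ∀ n, IsRandomLayer P σα σb (X n) (C n) (A n) (b n))
    (hγ : 0 < γ) (hγ1 : γ ≤ 1) (hN : Tendsto N atTop atTop)
    (hr : Tendsto (fun n => (r n : ℝ) / N n) atTop (𝓝 γ))
    (hV : ∀ a b, TendstoInMeasure P (fun n ω => inputCov σα σb (X n ω) a b) atTop fun _ => V a b)
    (hV2 : ∀ a, Tendsto (fun n => P {ω | 2 * V a a < inputCov σα σb (X n ω) a a}) atTop (𝓝 0))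
    (a a' : Fin 2) :
    TendstoInMeasure P (fun n ω =>
      (∑ i, φ (layerPreactivation (X n ω, C n ω) (A n ω, b n ω) a i) *
        φ (layerPreactivation (X n ω, C n ω) (A n ω, b n ω) a' i)) / (N n : ℝ)) atTop
      fun _ => activationCov φ (fun a a' => γ * V a a') a a' := by
  obtain ⟨δ, hδ, hδ1, hgood⟩ := exists_tendsto_compl_goodConditions H hγ hN hr hV hV2
  -- The bound by `δ` serves the random units; the bound by `γ` serves the limit law, whose variance
  -- `γ * V a a` is also compared with `2 * V a a`.
  set δ' : ℝ := min δ γ / 4 with hδ'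
  have hδ'p : 0 < δ' := by have := lt_min hδ hγ; positivity
  have hδ'δ : 4 * δ' ≤ δ := by have := min_le_left δ γ; linarith
  have hδ'γ : 4 * δ' ≤ γ := by have := min_le_right δ γ; linarith
  have hδ'1 : δ' ≤ 1 := by linarith
  set K : ℝ := (Real.sqrt δ')⁻¹ with hK
  have hKp : 0 < K := by positivity
  set q : Fin 2 → Fin 2 → ℝ := fun a a' => γ * V a a' with hq
  have hqform : ∀ a a' s t, covForm q a a' s t = γ * covForm V a a' s t := fun a a' s t => by
    simp only [hq, covForm]; ring
  have hVform := covForm_nonneg_of_tendstoInMeasure hV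
  have hqnn : ∀ a a' s t, 0 ≤ covForm q a a' s t := fun a a' s t => by
    rw [hqform]; exact mul_nonneg hγ.le (hVform a a' s t)
  have hV0 : ∀ a, 0 ≤ V a a := fun a => (covForm_self_nonneg (hVform a a)).1
  -- Approximating in the sum of the two reference Gaussians yields one trigonometric polynomial
  -- that is good for both inputs.
  set μ : Measure ℝ := gaussianReal 0 (2 * V a a).toNNReal + gaussianReal 0 (2 * V a' a').toNNReal
    with hμ
  have hφμ : MemLp φ 2 μ := by
    rw [memLp_two_iff_integrable_sq hφ.aestronglyMeasurable, hμ, integrable_add_measure]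
    exact ⟨(memLp_gaussianReal_of_integrable hφ hφ2 _).integrable_sq,
      (memLp_gaussianReal_of_integrable hφ hφ2 _).integrable_sq⟩
  suffices hc : TendstoInMeasure P (fun n ω =>
      (∑ i, ((φ (layerPreactivation (X n ω, C n ω) (A n ω, b n ω) a i) *
        φ (layerPreactivation (X n ω, C n ω) (A n ω, b n ω) a' i) : ℝ) : ℂ)) / (N n : ℂ)) atTop
      fun _ => ((activationCov φ q a a' : ℝ) : ℂ) by
    have h1 := TendstoInMeasure.map_const (Φ := Complex.re) hc Complex.continuous_re.continuousAt
    rw [Complex.ofReal_re] at h1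
    refine h1.congr_left fun n => Eventually.of_forall fun ω => ?_
    simp only
    rw [← Complex.ofReal_sum, ← Complex.ofReal_natCast, ← Complex.ofReal_div, Complex.ofReal_re]
  refine tendstoInMeasure_of_ne_top fun ε hε hεt => ?_
  rw [ENNReal.tendsto_nhds_zero]
  intro κ hκ
  obtain ⟨κ', hκ'0, hκ'⟩ := ENNReal.exists_ofReal_le hκ
  set ε' : ℝ := ε.toReal with hε'
  have hε'p : 0 < ε' := ENNReal.toReal_pos hε.ne' hεt
  -- After multiplication by the comparison constant `K`, the first bound keeps the limit within `ε'
  -- / 3`. The second makes Markov's inequality at level `ε' / 3` cost at most `κ' / 3`.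
  set η : ℝ := min (ε' / 3) (κ' / 3 * (ε' / 3)) / K with hη
  have hηp : 0 < η := by
    have : 0 < min (ε' / 3) (κ' / 3 * (ε' / 3)) := lt_min (by positivity) (by positivity)
    positivity
  have hKη : K * η = min (ε' / 3) (κ' / 3 * (ε' / 3)) := by rw [hη]; field_simp
  obtain ⟨c, Φ, hΦm, hΦμ, hΦ⟩ := exists_trigPolynomial_mul_approx hφ hφμ hηp
  rw [hμ, lintegral_add_measure] at hΦμ
  -- error of the limits
  set I : ℂ := ((activationCov φ q a a' : ℝ) : ℂ) with hI
  set I' : ℂ := ∑ s ∈ c.support, ∑ t ∈ c.support, (c s * c t) *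
    ((Real.exp (-(covForm q a a' s t / 2)) : ℝ) : ℂ) with hI'
  have hlim : ‖((activationCov φ q a a' : ℝ) : ℂ) - ∑ s ∈ c.support, ∑ t ∈ c.support, (c s * c t) *
      ((Real.exp (-(covForm q a a' s t / 2)) : ℝ) : ℂ)‖ₑ ≤ ENNReal.ofReal (ε' / 3) := by
    refine (enorm_activationCov_sub_le hφ hφ2 (hqnn a a') hΦm hΦ).trans ?_
    have hdom : ∀ a, ∫⁻ x, Φ x ∂(gaussianReal 0 (q a a).toNNReal) ≤
        ENNReal.ofReal K * ∫⁻ x, Φ x ∂(gaussianReal 0 (2 * V a a).toNNReal) := fun a => by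
      have hV0 := hV0 a
      refine lintegral_gaussianReal_le_of_var_le hδ'p hδ'1 (Real.toNNReal_le_toNNReal ?_) ?_ Φ
      · simp only [hq]; nlinarith
      · rw [Real.coe_toNNReal _ (by positivity), Real.coe_toNNReal _ (mul_nonneg hγ.le hV0)]
        nlinarith
    calc _ ≤ ENNReal.ofReal K * ∫⁻ x, Φ x ∂(gaussianReal 0 (2 * V a a).toNNReal) +
          ENNReal.ofReal K * ∫⁻ x, Φ x ∂(gaussianReal 0 (2 * V a' a').toNNReal) :=
          add_le_add (hdom a) (hdom a')
      _ ≤ ENNReal.ofReal K * ENNReal.ofReal η := by rw [← mul_add]; gcongr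
      _ ≤ ENNReal.ofReal (ε' / 3) := by
          rw [← ENNReal.ofReal_mul hKp.le, hKη]
          exact ENNReal.ofReal_le_ofReal (min_le_left _ _)
  -- convergence for the trigonometric polynomial
  have htrig : TendstoInMeasure P (fun n ω => (∑ i, (c.sum fun s d => d * expWave s
      (layerPreactivation (X n ω, C n ω) (A n ω, b n ω) a i)) * (c.sum fun s d => d * expWave s
        (layerPreactivation (X n ω, C n ω) (A n ω, b n ω) a' i))) / (N n : ℂ)) atTop
      fun _ => I' :=
    tendstoInMeasure_trigPolynomial_mul (fun s t => by
      rw [hqform]; exact tendstoInMeasure_layer_expWave H hγ hN hr hV hgood a a' s t) c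
  have htrig' := (ENNReal.tendsto_nhds_zero.1 (htrig (ENNReal.ofReal (ε' / 3))
    (ENNReal.ofReal_pos.2 (by positivity)))) (ENNReal.ofReal (κ' / 3))
    (ENNReal.ofReal_pos.2 (by positivity))
  have hgood' := (ENNReal.tendsto_nhds_zero.1 (hgood 1 one_pos)) (ENNReal.ofReal (κ' / 3))
    (ENNReal.ofReal_pos.2 (by positivity))
  filter_upwards [htrig', hgood'] with n hn1 hn2
  -- error of the random sums
  let F : Ω → ENNReal := fun ω =>
    (N n : ENNReal)⁻¹ * ∑ i, Φ (layerPreactivation (X n ω, C n ω) (A n ω, b n ω) a i) +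
      (N n : ENNReal)⁻¹ * ∑ i, Φ (layerPreactivation (X n ω, C n ω) (A n ω, b n ω) a' i)
  have hmark : P {ω | ENNReal.ofReal (ε' / 3) ≤ F ω} ≤
      P {ω | (X n ω, C n ω) ∉ goodConditions (m n) (N n) (r n) σα σb V δ 1} +
        ENNReal.ofReal (K * η) / ENNReal.ofReal (ε' / 3) := by
    refine (measure_ge_average_add_le (V := V) (e := 1) (H n) hδ'p hδ'δ hδ'1 a a' hΦm
      (ENNReal.ofReal_pos.2 (by positivity)).ne' ENNReal.ofReal_ne_top).trans ?_
    rw [ENNReal.ofReal_mul hKp.le]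
    gcongr
  have hdiv : ENNReal.ofReal (K * η) / ENNReal.ofReal (ε' / 3) ≤ ENNReal.ofReal (κ' / 3) := by
    rw [← ENNReal.ofReal_div_of_pos (by positivity)]
    refine ENNReal.ofReal_le_ofReal ?_
    rw [div_le_iff₀ (by positivity), hKη]
    exact min_le_right _ _
  have hsplit : ε = ENNReal.ofReal (ε' / 3) + ENNReal.ofReal (ε' / 3) + ENNReal.ofReal (ε' / 3) := by
    rw [← ENNReal.ofReal_add (by positivity) (by positivity),
      ← ENNReal.ofReal_add (by positivity) (by positivity), hε']
    rw [show ε.toReal / 3 + ε.toReal / 3 + ε.toReal / 3 = ε.toReal by ring,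
      ENNReal.ofReal_toReal hεt]
  refine le_trans ?_ hκ'
  let T : Ω → ℂ := fun ω => (∑ i, ((φ (layerPreactivation (X n ω, C n ω) (A n ω, b n ω) a i) *
    φ (layerPreactivation (X n ω, C n ω) (A n ω, b n ω) a' i) : ℝ) : ℂ)) / (N n : ℂ)
  let T' : Ω → ℂ := fun ω => (∑ i, (c.sum fun s d => d * expWave s
    (layerPreactivation (X n ω, C n ω) (A n ω, b n ω) a i)) * (c.sum fun s d => d * expWave s
      (layerPreactivation (X n ω, C n ω) (A n ω, b n ω) a' i))) / (N n : ℂ)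
  have hTT' : ∀ ω, edist (T ω) (T' ω) ≤ F ω := fun ω => by
    rw [edist_eq_enorm_sub]
    refine (enorm_average_sub_le (N n) _ _ fun i => hΦ _ _).trans ?_
    rw [Finset.sum_add_distrib, mul_add]
  have hII' : edist I' I ≤ ENNReal.ofReal (ε' / 3) := by
    rw [edist_comm, edist_eq_enorm_sub]; exact hlim
  change P {ω | ε ≤ edist (T ω) I} ≤ _
  change P {ω | ENNReal.ofReal (ε' / 3) ≤ edist (T' ω) I'} ≤ _ at hn1
  calc P {ω | ε ≤ edist (T ω) I}
      ≤ P ({ω | ENNReal.ofReal (ε' / 3) ≤ F ω} ∪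
          {ω | ENNReal.ofReal (ε' / 3) ≤ edist (T' ω) I'}) := by
        refine measure_mono fun ω hω => ?_
        by_contra hcon
        simp only [Set.mem_union, Set.mem_ofPred_eq, not_or, not_le] at hcon
        refine absurd (show ε ≤ edist (T ω) I from hω) (not_le.2 ?_)
        -- The path runs from the average `T` to its polynomial version `T'`, to the limit `I'` of
        -- the latter, to `I`. Only the last estimate is non-strict, which is enough since it is
        -- finite.
        refine (edist_triangle4 _ (T' ω) I' _).trans_lt ?_
        rw [hsplit]
        exact ENNReal.add_lt_add_of_lt_of_le (hII'.trans_lt ENNReal.ofReal_lt_top).ne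
          (ENNReal.add_lt_add ((hTT' ω).trans_lt hcon.1) hcon.2) hII'
    _ ≤ (ENNReal.ofReal (κ' / 3) + ENNReal.ofReal (κ' / 3)) + ENNReal.ofReal (κ' / 3) := by
        refine (measure_union_le _ _).trans (add_le_add (hmark.trans (add_le_add hn2 hdiv)) hn1)
    _ = ENNReal.ofReal κ' := by
        rw [← ENNReal.ofReal_add (by positivity) (by positivity),
          ← ENNReal.ofReal_add (by positivity) (by positivity)]
        congr 1; ring

/-- If the limit of the mean square activation vanishes, so do the activations, with probability
tending to one. -/
theorem tendsto_measure_activation_ne_zero (hφ : Measurable φ)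
    (hφ2 : ∀ s : ℝ, Integrable (fun z => φ (s * z) ^ 2) stdGaussian1)
    (H : ∀ n, IsRandomLayer P σα σb (X n) (C n) (A n) (b n))
    (hγ : 0 < γ) (hN : Tendsto N atTop atTop)
    (hr : Tendsto (fun n => (r n : ℝ) / N n) atTop (𝓝 γ))
    (hV : ∀ a b, TendstoInMeasure P (fun n ω => inputCov σα σb (X n ω) a b) atTop fun _ => V a b)
    (hV2 : ∀ a, Tendsto (fun n => P {ω | 2 * V a a < inputCov σα σb (X n ω) a a}) atTop (𝓝 0))
    {a : Fin 2} (h0 : ∫ x, φ x ^ 2 ∂(gaussianReal 0 (γ * V a a).toNNReal) = 0) :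
    Tendsto (fun n => P {ω | ∃ i, φ (layerPreactivation (X n ω, C n ω) (A n ω, b n ω) a i) ≠ 0})
      atTop (𝓝 0) := by
  obtain ⟨δ, hδ, hδ1, hgood⟩ := exists_tendsto_compl_goodConditions H hγ hN hr hV hV2
  have hV0 : 0 ≤ V a a := (covForm_self_nonneg (covForm_nonneg_of_tendstoInMeasure hV a a)).1
  have hae : ∀ᵐ x ∂(gaussianReal 0 (2 * V a a).toNNReal), φ x = 0 := by
    have h1 : ∀ᵐ x ∂(gaussianReal 0 (γ * V a a).toNNReal), φ x = 0 := by
      have h2 := (integral_eq_zero_iff_of_nonneg (fun x => sq_nonneg (φ x))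
        (memLp_gaussianReal_of_integrable hφ hφ2 _).integrable_sq).1 h0
      filter_upwards [h2] with x hx
      exact pow_eq_zero_iff (two_ne_zero) |>.1 hx
    -- Both Gaussians are the Dirac mass at `0`, or both are nondegenerate and mutually absolutely
    -- continuous.
    rcases hV0.eq_or_lt with h | h
    · rw [← h] at h1 ⊢; simpa using h1
    · have hne : (γ * V a a).toNNReal ≠ 0 := (Real.toNNReal_pos.2 (by positivity)).ne'
      have hne' : (2 * V a a).toNNReal ≠ 0 := (Real.toNNReal_pos.2 (by positivity)).ne'
      exact (gaussianReal_absolutelyContinuous 0 hne').ae_le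
        ((gaussianReal_absolutelyContinuous' 0 hne).ae_le h1)
  have hset : MeasurableSet {x | φ x ≠ 0} := (measurableSet_eq_fun hφ measurable_const).compl
  -- With the value `⊤`, a single active unit makes the average infinite for every `N`, while the
  -- integral against the reference Gaussian is still zero.
  set Φ : ℝ → ENNReal := {x | φ x ≠ 0}.indicator fun _ => ⊤ with hΦ
  have hΦm : Measurable Φ := measurable_const.indicator hset
  have hΦ0 : ∫⁻ x, Φ x ∂(gaussianReal 0 (2 * V a a).toNNReal) = 0 := by
    rw [lintegral_eq_zero_iff hΦm]
    filter_upwards [hae] with x hx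
    simp [hΦ, hx]
  have h1 := tendsto_measure_ge_of_lintegral_le H hgood
    (F := fun n u w => (N n : ENNReal)⁻¹ * ∑ i, Φ (layerPreactivation u w a i))
    (fun n => (Finset.measurable_fun_sum _ fun i _ =>
      hΦm.comp (measurable_layerPreactivation a i)).const_mul _)
    (fun η hη => ⟨1, one_pos, Eventually.of_forall fun n u hu => by
      have h2 := lintegral_average_le (H n) (δ' := δ / 4) (by positivity) (by linarith)
        (by linarith) hu a hΦm
      rw [hΦ0, mul_zero] at h2
      exact h2.trans zero_le⟩) one_pos
  refine tendsto_of_tendsto_of_tendsto_of_le_of_le tendsto_const_nhds h1 (fun _ => zero_le)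
    fun n => measure_mono (Set.ofPred_subset_ofPred.2 fun ω hω => ?_)
  obtain ⟨i, hi⟩ := hω
  have htop : ∑ i, Φ (layerPreactivation (X n ω, C n ω) (A n ω, b n ω) a i) = ⊤ := by
    refine ENNReal.sum_eq_top.2 ⟨i, Finset.mem_univ i, ?_⟩
    simp [hΦ, hi]
  rw [htop, ENNReal.mul_top (by simp)]
  exact le_top

end LayerProductLimit

/-! ### Layers of the random network: measurability and independence -/

section RandomNetwork

/-- If `X` is independent of `(Y, Z)` and `Y` of `Z`, then `(X, Y)` is independent of `Z`. -/
theorem ProbabilityTheory.IndepFun.prodMk_left_of_prodMk_right {Ω 𝒳 𝒴 𝒵 : Type*} [MeasurableSpace Ω]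
    [MeasurableSpace 𝒳] [MeasurableSpace 𝒴] [MeasurableSpace 𝒵] {P : Measure Ω}
    [IsProbabilityMeasure P] {X : Ω → 𝒳} {Y : Ω → 𝒴} {Z : Ω → 𝒵} (hX : Measurable X)
    (hY : Measurable Y) (hZ : Measurable Z) (h : IndepFun X (fun ω => (Y ω, Z ω)) P)
    (h' : IndepFun Y Z P) : IndepFun (fun ω => (X ω, Y ω)) Z P := by
  have := Measure.isProbabilityMeasure_map (μ := P) hX.aemeasurable
  have := Measure.isProbabilityMeasure_map (μ := P) hY.aemeasurable
  have := Measure.isProbabilityMeasure_map (μ := P) hZ.aemeasurable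
  have hXY : IndepFun X Y P := h.comp measurable_id measurable_fst
  have e1 := (indepFun_iff_map_prod_eq_prod_map_map hX.aemeasurable
    (hY.prodMk hZ).aemeasurable).1 h
  have e2 := (indepFun_iff_map_prod_eq_prod_map_map hY.aemeasurable hZ.aemeasurable).1 h'
  have e3 := (indepFun_iff_map_prod_eq_prod_map_map hX.aemeasurable hY.aemeasurable).1 hXY
  refine (indepFun_iff_map_prod_eq_prod_map_map (hX.prodMk hY).aemeasurable
    hZ.aemeasurable).2 ?_
  have hassoc := (measurePreserving_prodAssoc (P.map X) (P.map Y) (P.map Z)).symm.map_eq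
  rw [e3, ← hassoc, ← e2, ← e1, Measure.map_map (MeasurableEquiv.measurable _)
    (hX.prodMk (hY.prodMk hZ))]
  rfl

variable {d : ℕ} {N r : ℕ → ℕ}

theorem LowRankNetwork.measurable_output {Ω : Type*} [MeasurableSpace Ω] {φ : ℝ → ℝ}
    (hφ : Measurable φ) {θ : Ω → LowRankNetwork d N r} (x : Fin d → ℝ) (l : ℕ)
    (hC : ∀ j < l, Measurable fun ω => (θ ω).C j) (hA : ∀ j < l, Measurable fun ω => (θ ω).A j)
    (hb : ∀ j < l, Measurable fun ω => (θ ω).b j) :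
    Measurable fun ω => (θ ω).output φ x l := by
  induction l with
  | zero => exact measurable_const
  | succ l ih =>
    have ih' := ih (fun j hj => hC j (by omega)) (fun j hj => hA j (by omega))
      (fun j hj => hb j (by omega))
    have hCl := fun i k => (measurable_matrix_apply i k).comp (hC l (by omega))
    have hAl := fun k i => (measurable_matrix_apply k i).comp (hA l (by omega))
    have hbl := fun k => (measurable_pi_apply k).comp (hb l (by omega))
    have hout := fun j => (measurable_pi_apply j).comp ih'
    refine measurable_pi_lambda _ fun i => hφ.comp ?_
    change Measurable fun ω => (∑ j, (∑ k, (θ ω).C l i k * (θ ω).A l k j) *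
      (θ ω).output φ x l j) + ∑ k, (θ ω).C l i k * (θ ω).b l k
    exact (Finset.measurable_fun_sum _ fun j _ => (Finset.measurable_fun_sum _ fun k _ =>
      (hCl i k).mul (hAl k j)).mul (hout j)).add
        (Finset.measurable_fun_sum _ fun k _ => (hCl i k).mul (hbl k))

theorem LowRankNetwork.preactivation_eq_layerPreactivation (φ : ℝ → ℝ) (θ : LowRankNetwork d N r)
    (x : Fin 2 → Fin d → ℝ) (l : ℕ) (a : Fin 2) (i : Fin (N (l + 1))) :
    θ.preactivation φ (x a) l i =
      layerPreactivation (fun a => θ.output φ (x a) l, θ.C l) (θ.A l, θ.b l) a i := by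
  simp only [LowRankNetwork.preactivation, LowRankNetwork.weight, LowRankNetwork.bias,
    layerPreactivation, affineImage, one_smul, Matrix.mulVec_add, Matrix.mulVec_mulVec]

/-- The outputs feeding a layer are functions of the parameters of earlier layers, hence independent
of its own parameters. Independence of `C` from `(A, b)` inside the layer then puts `C` on the side
of the inputs. -/
theorem IsLowRankInit.isRandomLayer {Ω : Type*} [MeasurableSpace Ω] {P : Measure Ω}
    [IsProbabilityMeasure P] {L : ℕ} {σα σb : ℝ} {θ : Ω → LowRankNetwork d N r}
    (h : IsLowRankInit P L σα σb θ) {φ : ℝ → ℝ} (hφ : Measurable φ) (x : Fin 2 → Fin d → ℝ)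
    {l : ℕ} (hl : l < L) :
    IsRandomLayer P σα σb (fun ω a => (θ ω).output φ (x a) l) (fun ω => (θ ω).C l)
      (fun ω => (θ ω).A l) (fun ω => (θ ω).b l) := by
  have hX : Measurable fun ω (a : Fin 2) => (θ ω).output φ (x a) l :=
    measurable_pi_lambda _ fun a => LowRankNetwork.measurable_output hφ (x a) l
      (fun j hj => h.measurable_C j (hj.trans hl)) (fun j hj => h.measurable_A j (hj.trans hl))
      (fun j hj => h.measurable_b j (hj.trans hl))
  have hAb := (h.measurable_A l hl).prodMk (h.measurable_b l hl)
  have hind := h.indep_layers.indepFun_finset (Finset.univ.filter fun j : Fin L => (j : ℕ) < l)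
    {⟨l, hl⟩} (by simp) fun j => (h.measurable_C j j.2).prodMk
      ((h.measurable_A j j.2).prodMk (h.measurable_b j j.2))
  have hXind : IndepFun (fun ω (a : Fin 2) => (θ ω).output φ (x a) l)
      (fun ω => ((θ ω).C l, (θ ω).A l, (θ ω).b l)) P := by
    rw [IndepFun_iff_Indep] at hind ⊢
    refine indep_of_indep_of_le_left (indep_of_indep_of_le_right hind ?_) ?_
    · refine Measurable.comap_le ?_
      exact (measurable_pi_apply (⟨⟨l, hl⟩, by simp⟩ : ({⟨l, hl⟩} : Finset (Fin L)))).comp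
        (comap_measurable fun ω (i : ({⟨l, hl⟩} : Finset (Fin L))) =>
          ((θ ω).C i, (θ ω).A i, (θ ω).b i))
    · refine Measurable.comap_le ?_
      have hj := fun (j : ℕ) (hj : j < l) =>
        (measurable_pi_apply (⟨⟨j, hj.trans hl⟩, by simpa using hj⟩ :
          (Finset.univ.filter fun j : Fin L => (j : ℕ) < l : Finset (Fin L)))).comp
        (comap_measurable fun ω (i : (Finset.univ.filter fun j : Fin L => (j : ℕ) < l :
          Finset (Fin L))) => ((θ ω).C i, (θ ω).A i, (θ ω).b i))
      -- Measurability is taken with respect to the σ-algebra generated by the earlier layers, hence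
      -- the explicit instance arguments.
      refine @measurable_pi_lambda _ _ _ (_) _ _ fun a => ?_
      exact @LowRankNetwork.measurable_output d N r Ω (_) φ hφ θ (x a) l
        (fun j hj' => measurable_fst.comp (hj j hj'))
        (fun j hj' => (measurable_fst.comp measurable_snd).comp (hj j hj'))
        (fun j hj' => (measurable_snd.comp measurable_snd).comp (hj j hj'))
  exact
    { measurable_X := hX
      measurable_C := h.measurable_C l hl
      gaussian :=
        { measurable_A := h.measurable_A l hl
          measurable_b := h.measurable_b l hl
          law_A := h.law_A l hl
          law_b := h.law_b l hl
          indep_entries_A := h.indep_entries_A l hl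
          indep_entries_b := h.indep_entries_b l hl
          indep_A_b := h.indep_A_b l hl }
      law_C := h.law_C l hl
      indep := hXind.prodMk_left_of_prodMk_right hX (h.measurable_C l hl) hAb (h.indep_C_Ab l hl) }

end RandomNetwork

/-! ### The diagonal of the covariance map is the length map -/

section SelfCovariance

/-- The self-correlation is `1` for `q > 0`. For `q = 0` it is `0` by default, but the factor `√q`
vanishes anyway. -/
theorem gaussU₂_corr_self {q : ℝ} (hq : 0 ≤ q) (z : ℝ × ℝ) :
    gaussU₂ q (corr q q q) z = Real.sqrt q * z.1 := by
  rcases hq.eq_or_lt with rfl | h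
  · simp [gaussU₂]
  · simp [gaussU₂, corr, Real.sqrt_mul_self hq, h.ne']

theorem activationCov_self (φ : ℝ → ℝ) {q : Fin 2 → Fin 2 → ℝ} {a : Fin 2} (hq : 0 ≤ q a a) :
    activationCov φ q a a = ∫ z, φ (Real.sqrt (q a a) * z) ^ 2 ∂stdGaussian1 := by
  simp only [activationCov, gaussU₂_corr_self hq, gaussU₁]
  rw [integral_fun_fst (fun z => φ (Real.sqrt (q a a) * z) * φ (Real.sqrt (q a a) * z))]
  simp [sq]

theorem integral_sq_gaussianReal {φ : ℝ → ℝ} (hφ : Measurable φ) {q : Fin 2 → Fin 2 → ℝ} {a : Fin 2}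
    (hq : ∀ s t, 0 ≤ covForm q a a s t) :
    ∫ x, φ x ^ 2 ∂(gaussianReal 0 (q a a).toNNReal) = activationCov φ q a a := by
  rw [activationCov, ← map_gaussU₁ hq, integral_map (measurable_gaussU₁ _).aemeasurable
    (hφ.pow_const 2).aestronglyMeasurable]
  simp only [gaussU₂_corr_self (covForm_self_nonneg hq).1, gaussU₁, sq]

end SelfCovariance

/-! ### Induction over the layers -/

section NetworkLimit

/-- The limit of the input covariances of the layers of a wide low-rank network. -/
noncomputable def limitCov (φ : ℝ → ℝ) (γ : ℕ → ℝ) (σα σb : ℝ) {d : ℕ} (x : Fin 2 → Fin d → ℝ) :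
    ℕ → Fin 2 → Fin 2 → ℝ
  | 0 => inputCov σα σb x
  | l + 1 => fun a b =>
      σα ^ 2 * activationCov φ (fun a b => γ (l + 1) * limitCov φ γ σα σb x l a b) a b + σb ^ 2

variable {Ω : Type*} [MeasurableSpace Ω] {P : Measure Ω} [IsProbabilityMeasure P]

omit [IsProbabilityMeasure P] in
theorem tendsto_measure_two_mul_lt {Y : ℕ → Ω → ℝ} {v : ℝ} (hv : 0 < v)
    (h : TendstoInMeasure P Y atTop fun _ => v) :
    Tendsto (fun n => P {ω | 2 * v < Y n ω}) atTop (𝓝 0) := by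
  refine tendsto_of_tendsto_of_tendsto_of_le_of_le tendsto_const_nhds
    (tendstoInMeasure_iff_dist.1 h v hv) (fun _ => zero_le)
    fun n => measure_mono (Set.ofPred_subset_ofPred.2 fun ω hω => ?_)
  rw [Real.dist_eq]
  exact le_trans (by linarith) (le_abs_self _)

/-- Index `l` refers to the inputs of layer `l + 1`, so `l = 0` is deterministic. The second
conclusion strengthens the induction: it adds information only for a zero limit, and the next layer
needs it there. -/
theorem tendsto_inputCov_layer {L d : ℕ} {x : Fin 2 → Fin d → ℝ} {φ : ℝ → ℝ} (hφ : Measurable φ)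
    (hφ2 : ∀ s : ℝ, Integrable (fun z => φ (s * z) ^ 2) stdGaussian1) {σα σb : ℝ}
    {N r : ℕ → ℕ → ℕ} {γ : ℕ → ℝ} (hγ : ∀ l, 1 ≤ l → l ≤ L → 0 < γ l ∧ γ l ≤ 1)
    (hN : ∀ l, 1 ≤ l → l ≤ L → Tendsto (fun n => N n l) atTop atTop)
    (hr : ∀ l, 1 ≤ l → l ≤ L → Tendsto (fun n => (r n l : ℝ) / (N n l : ℝ)) atTop (𝓝 (γ l)))
    {θ : (n : ℕ) → Ω → LowRankNetwork d (N n) (r n)}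
    (hθ : ∀ n, IsLowRankInit P L σα σb (θ n)) (l : ℕ) (hl : l < L) :
    (∀ a b, TendstoInMeasure P
      (fun n ω => inputCov σα σb (fun a => (θ n ω).output φ (x a) l) a b) atTop
      fun _ => limitCov φ γ σα σb x l a b) ∧
    ∀ a, Tendsto (fun n => P {ω | 2 * limitCov φ γ σα σb x l a a <
      inputCov σα σb (fun a => (θ n ω).output φ (x a) l) a a}) atTop (𝓝 0) := by
  induction l with
  | zero =>
    have hz : ∀ n ω a b, inputCov σα σb (fun a => (θ n ω).output φ (x a) 0) a b =
        inputCov σα σb x a b := fun _ _ _ _ => rfl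
    simp only [hz, limitCov]
    refine ⟨fun a b => tendstoInMeasure_const _, fun a => ?_⟩
    have h0 : ¬ 2 * inputCov σα σb x a a < inputCov σα σb x a a := by
      linarith [inputCov_self_nonneg σα σb x a]
    simp [h0]
  | succ l ih =>
    obtain ⟨hV, hV2⟩ := ih (by omega)
    obtain ⟨hγ0, hγ1⟩ := hγ (l + 1) (by omega) hl.le
    have H := fun n => (hθ n).isRandomLayer hφ x (l := l) (by omega)
    set V := limitCov φ γ σα σb x l with hVdef
    set q : Fin 2 → Fin 2 → ℝ := fun a b => γ (l + 1) * V a b with hq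
    have hout : ∀ n ω a b, inputCov σα σb (fun a => (θ n ω).output φ (x a) (l + 1)) a b =
        σα ^ 2 * ((∑ i, φ (layerPreactivation (fun a => (θ n ω).output φ (x a) l, (θ n ω).C l)
          ((θ n ω).A l, (θ n ω).b l) a i) *
          φ (layerPreactivation (fun a => (θ n ω).output φ (x a) l, (θ n ω).C l)
          ((θ n ω).A l, (θ n ω).b l) b i)) / (N n (l + 1) : ℝ)) + σb ^ 2 := fun n ω a b => by
      simp only [← LowRankNetwork.preactivation_eq_layerPreactivation]
      rfl
    have hconv : ∀ a b, TendstoInMeasure P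
        (fun n ω => inputCov σα σb (fun a => (θ n ω).output φ (x a) (l + 1)) a b) atTop
        fun _ => limitCov φ γ σα σb x (l + 1) a b := fun a b => by
      have h1 := tendstoInMeasure_layer_activation hφ hφ2 H hγ0 hγ1 (hN _ (by omega) hl.le)
        (hr _ (by omega) hl.le) hV hV2 a b
      simp only [hout]
      exact TendstoInMeasure.map_const (Φ := fun y => σα ^ 2 * y + σb ^ 2) h1 (by fun_prop)
    refine ⟨hconv, fun a => ?_⟩
    have hqa : ∀ s t, 0 ≤ covForm q a a s t := fun s t => by
      have h1 := covForm_nonneg_of_tendstoInMeasure hV a a s t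
      have h2 : covForm q a a s t = γ (l + 1) * covForm V a a s t := by
        simp only [hq, covForm]; ring
      rw [h2]; positivity
    have hact : 0 ≤ activationCov φ q a a := by
      rw [activationCov_self φ (covForm_self_nonneg hqa).1]
      exact integral_nonneg fun z => sq_nonneg _
    have hlim : limitCov φ γ σα σb x (l + 1) a a = σα ^ 2 * activationCov φ q a a + σb ^ 2 := rfl
    rcases (show 0 ≤ limitCov φ γ σα σb x (l + 1) a a by rw [hlim]; positivity).lt_or_eq
      with hpos | hzero
    · exact tendsto_measure_two_mul_lt hpos (hconv a a)
    -- A zero limit forces `σb = 0`. Then either `σα = 0` and the input variance is identically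
    -- zero, or the mean square activation has limit zero and all activations vanish with
    -- probability tending to one.
    · rw [← hzero]
      rw [hlim] at hzero
      have hσb : σb ^ 2 = 0 := by nlinarith [sq_nonneg σb, mul_nonneg (sq_nonneg σα) hact]
      have hprod : σα ^ 2 * activationCov φ q a a = 0 := by linarith
      simp only [hout, hσb, mul_zero, add_zero]
      rcases mul_eq_zero.1 hprod with hσα | h0
      · simp [hσα]
      · have h1 := tendsto_measure_activation_ne_zero hφ hφ2 H hγ0 (hN _ (by omega) hl.le)
          (hr _ (by omega) hl.le) hV hV2 (a := a) ((integral_sq_gaussianReal hφ hqa).trans h0)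
        refine tendsto_of_tendsto_of_tendsto_of_le_of_le tendsto_const_nhds h1 (fun _ => zero_le)
          fun n => measure_mono (Set.ofPred_subset_ofPred.2 fun ω hω => ?_)
        by_contra! hcon
        simp [hcon] at hω

end NetworkLimit

theorem lengthMap_eq_pooleLengthMap (φ : ℝ → ℝ) (γ σα σb q : ℝ) :
    lengthMap φ γ σα σb q = pooleLengthMap φ (γ * σα ^ 2) (γ * σb ^ 2) q := by
  rw [lengthMap, pooleLengthMap]; ring

theorem covMap_eq_pooleCovMap (φ : ℝ → ℝ) (γ σα σb q₁₂ q₁₁ q₂₂ : ℝ) :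
    covMap φ γ σα σb q₁₂ q₁₁ q₂₂ = pooleCovMap φ (γ * σα ^ 2) (γ * σb ^ 2) q₁₂ q₁₁ q₂₂ := by
  rw [covMap, pooleCovMap]; ring

theorem mainTheorem1
    {Ω : Type*} [MeasurableSpace Ω] (P : Measure Ω) [IsProbabilityMeasure P]
    -- depth, input dimension, two inputs
    (L d : ℕ) (hd : 0 < d) (x : Fin 2 → Fin d → ℝ)
    -- activation function, for which the Gaussian integrals are finite
    (φ : ℝ → ℝ) (hφ : Measurable φ)
    (hφ2 : ∀ s : ℝ, Integrable (fun z => φ (s * z) ^ 2) stdGaussian1)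
    (σα σb : ℝ)
    -- widths and ranks of a sequence of networks, rank-to-width ratios
    (N r : ℕ → ℕ → ℕ) (γ : ℕ → ℝ)
    (hγ : ∀ l, 1 ≤ l → l ≤ L → 0 < γ l ∧ γ l ≤ 1)
    (hN : ∀ l, 1 ≤ l → l ≤ L → Tendsto (fun n => N n l) atTop atTop)
    (hr : ∀ l, 1 ≤ l → l ≤ L → Tendsto (fun n => (r n l : ℝ) / (N n l : ℝ)) atTop (𝓝 (γ l)))
    -- the random networks
    (θ : (n : ℕ) → Ω → LowRankNetwork d (N n) (r n))
    (hθ : ∀ n, IsLowRankInit P L σα σb (θ n)) :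
    ∃ q : ℕ → Fin 2 → Fin 2 → ℝ,
      -- lengths and covariances of layers `1, …, L` converge in probability to `q`
      (∀ l < L, ∀ a b, TendstoInMeasure P (fun n ω => (θ n ω).overlap φ (x a) (x b) l) atTop
        (fun _ => q (l + 1) a b)) ∧
      -- first layer, fed with the input itself
      (∀ a b, 1 ≤ L → q 1 a b = γ 1 * (σα ^ 2 * ((∑ i, x a i * x b i) / (d : ℝ)) + σb ^ 2)) ∧
      -- recursion from layer `l` to layer `l + 1`
      (∀ l, 1 ≤ l → l < L →
        (∀ a, 0 ≤ q l a a ∧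
          q (l + 1) a a = lengthMap φ (γ (l + 1)) σα σb (q l a a) ∧
          q (l + 1) a a =
            pooleLengthMap φ (γ (l + 1) * σα ^ 2) (γ (l + 1) * σb ^ 2) (q l a a)) ∧
        (|corr (q l 0 1) (q l 0 0) (q l 1 1)| ≤ 1 ∧
          Integrable (fun z => φ (gaussU₁ (q l 0 0) z) *
            φ (gaussU₂ (q l 1 1) (corr (q l 0 1) (q l 0 0) (q l 1 1)) z))
            (stdGaussian1.prod stdGaussian1) ∧
          q (l + 1) 0 1 = covMap φ (γ (l + 1)) σα σb (q l 0 1) (q l 0 0) (q l 1 1) ∧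
          q (l + 1) 0 1 =
            pooleCovMap φ (γ (l + 1) * σα ^ 2) (γ (l + 1) * σb ^ 2)
              (q l 0 1) (q l 0 0) (q l 1 1))) := by
  have hlayer := tendsto_inputCov_layer (x := x) hφ hφ2 hγ hN hr hθ
  -- `limitCov` at `l - 1` describes the inputs of layer `l`. The truncated subtraction affects only
  -- the value at `l = 0`, which the statement never uses.
  refine ⟨fun l a b => γ l * limitCov φ γ σα σb x (l - 1) a b, fun l hl a b => ?_,
    fun a b _ => rfl, fun l hl1 hlL => ?_⟩
  · obtain ⟨hV, hV2⟩ := hlayer l hl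
    simp only [LowRankNetwork.overlap, LowRankNetwork.preactivation_eq_layerPreactivation]
    exact tendstoInMeasure_layer_overlap (fun n => (hθ n).isRandomLayer hφ x hl)
      (hγ _ (by omega) hl).1 (hN _ (by omega) hl) (hr _ (by omega) hl) hV hV2 a b
  · obtain ⟨k, rfl⟩ : ∃ k, l = k + 1 := ⟨l - 1, by omega⟩
    set q : Fin 2 → Fin 2 → ℝ := fun a b => γ (k + 1) * limitCov φ γ σα σb x k a b with hq
    have hqnn : ∀ a b s t, 0 ≤ covForm q a b s t := fun a b s t => by
      have h1 := covForm_nonneg_of_tendstoInMeasure (hlayer k (by omega)).1 a b s t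
      have h2 : covForm q a b s t = γ (k + 1) * covForm (limitCov φ γ σα σb x k) a b s t := by
        simp only [hq, covForm]; ring
      rw [h2]
      exact mul_nonneg (hγ _ (by omega) hlL.le).1.le h1
    have hq0 := fun a => (covForm_self_nonneg (hqnn a a)).1
    -- The recursion defines diagonal entries by the two-dimensional integral too, which collapses
    -- to one variable.
    have hself : ∀ a, γ (k + 1 + 1) * limitCov φ γ σα σb x (k + 1) a a =
        lengthMap φ (γ (k + 1 + 1)) σα σb (q a a) := fun a => by
      rw [lengthMap, ← activationCov_self φ (hq0 a)]; rfl
    have hcross : γ (k + 1 + 1) * limitCov φ γ σα σb x (k + 1) 0 1 =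
        covMap φ (γ (k + 1 + 1)) σα σb (q 0 1) (q 0 0) (q 1 1) := rfl
    exact ⟨fun a => ⟨hq0 a, hself a, (hself a).trans (lengthMap_eq_pooleLengthMap _ _ _ _ _)⟩,
      abs_corr_le_one (sq_le_mul_of_covForm_nonneg (hqnn 0 1)),
      integrable_mul_gaussU hφ hφ2 (hqnn 0 1), hcross,
      hcross.trans (covMap_eq_pooleCovMap _ _ _ _ _ _ _)⟩
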